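/- **Setting and notation.** For a directed acyclic graph (DAG) $D$ on $\{1,\dots,p\}$, $pa_D(i)$ is the set of parents of $i$ and the skeleton of $D$ is the underlying undirected graph. A v-structure is a triple $i\to j\leftarrow k$ with $i\neq k$ not adjacent; two DAGs are *equivalent* if they have the same skeleton and the same v-structures. For a positive definite matrix $S$, a set $K$ and indices $i,j$ put $S_{ij|K}=S_{ij}-S_{i,K}S_{K,K}^{-1}S_{K,j}$ and $\rho_{ij|K}(S)=S_{ij|K}/\sqrt{S_{ii|K}S_{jj|K}}$; for $X\sim\mathcal N(0,S)$, $S_{ii|K}=\mathrm{Var}(X_i\mid X_K)$ and $\rho_{ij|K}(S)$ is the partial correlation. The same formulas are used for sample covariance matrices. **Assumptions.** For every $n$ let $p_n\in\mathbb N$, let $\Sigma_n$ be a positive definite $p_n\times p_n$ matrix, $G_n$ a DAG on $\{1,\dots,p_n\}$ and $c_n>0$. (A) $X^{(1)},\dots,X^{(n)}$ are i.i.d. $\sim P_n=\mathcal N(0,\Sigma_n)$, and $P_n$ is Markov and faithful to $G_n$: for all disjoint $A,B,C$, $X_A\perp\!\!\!\perp X_B\mid X_C$ if and only if $A$ and $B$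 are d-separated by $C$ in $G_n$. (A path is blocked by $C$ if it contains a non-collider in $C$, or a collider such that neither it nor any of its descendants is in $C$; $A,B$ are d-separated by $C$ if every path from $A$ to $B$ is blocked by $C$.) (B) $(\Sigma_n)_{ii}\le\sigma^2<\infty$ for all $n,i$. (C) $p_n=O(n^a)$ for some $0\le a<\infty$. (D) $q_n=\max_i|adj(i,G_n)|=O(n^{1/2-b})$ for some $0<b\le 1/2$. (E) There is $M<1$ with $|\rho_{ij|K}(\Sigma_n)|\le M$ for all $n$, $i\ne j$, $K\subseteq\{1,\dots,p_n\}\setminus\{i,j\}$; and $|\rho_{ij|K}(\Sigma_n)|\ge c_n$ for all such $n,i,j,K$ with $\rho_{ij|K}(\Sigma_n)\neq0$, where $c_n^{-1}=O(n^d)$ for some $0<d<1/4+b/2$. (F) There is $r>0$ such that for every $n$, every DAG $D$ equivalent to $G_n$, every $i$ and every $j\in pa_D(i)$: $\mathrm{Var}(X_j\mid X_{pa_D(i)\setminus\{j\}})\ge r$; and for every such $n$, $D$ and every $i$: $\mathrm{Var}(X_i\mid X_{pa_D(i)})\ge r$. **The estimator.** Let $\hat\Sigma=n^{-1}\sum_{k}(X^{(k)}-\bar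 X)(X^{(k)}-\bar X)^T$, $\hat\rho_{ij|K}=\rho_{ij|K}(\hat\Sigma)$, and $Z(i,j\mid K)=\frac12\log\frac{1+\hat\rho_{ij|K}}{1-\hat\rho_{ij|K}}$. Let $\Phi$ be the standard normal distribution function. The PC-algorithm with parameter $\alpha$ runs as follows; all choices of order are arbitrary. *Skeleton.* Start with the complete undirected graph. For $l=0,1,2,\dots$: as long as there are an ordered pair of adjacent nodes $(i,j)$ and $K\subseteq adj(i)\setminus\{j\}$ (adjacency in the current graph) with $|K|=l$ and $\sqrt{n-|K|-3}\,|Z(i,j\mid K)|\le\Phi^{-1}(1-\alpha/2)$ (the square root being read as $0$ if $n-|K|-3<0$), delete the edge $i-j$ and record $S(i,j)=S(j,i)=K$. Stop after level $l$ if $|adj(i)\setminus\{j\}|<l$ for all adjacent $i,j$. *Orientation.* For nonadjacent $i\ne j$ with common neighbour $k\notin S(i,j)$ orient $i\to k\leftarrow j$, discarding a v-structure that conflicts with an orientation made earlier. Then apply repeatedly, until nothing changes: (R1) orient $j-k$ into $j\to k$ if there is $i\to j$ with $i\neq k$ nonadjacent to $k$; (R2) orient $i-j$ into $i\to j$ if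 there is a chain $i\to k\to j$; (R3) orient $i-j$ into $i\to j$ if there are chains $i-k\to j$ and $i-l\to j$ with $k\ne l$ nonadjacent. The result is the estimated CPDAG. Let $\hat G_n$ be any DAG obtained from the estimated CPDAG for $\alpha=\alpha_n=2(1-\Phi(n^{1/2}c_n/2))$ by directing its undirected edges without creating cycles or additional v-structures (any DAG at all if this is impossible). For a DAG $D$ let $\hat A$ be the matrix with $\hat A_{ii}=1$, $\hat A_{ij}=-(\hat\Sigma_{i,pa_D(i)}\hat\Sigma_{pa_D(i),pa_D(i)}^{-1})_j$ for $j\in pa_D(i)$ and $\hat A_{ij}=0$ otherwise, and put $\hat\Sigma_D^{-1}=\hat A^T\,\mathrm{diag}\big(\hat\Sigma_{ii|pa_D(i)}\big)^{-1}\hat A$. **Theorem.** Under (A)–(F), for every such choice of $\hat G_n$, $$\sup_{i,j}\Big|\big(\hat\Sigma^{-1}_{\hat G_n}\big)_{ij}-\big(\Sigma_n^{-1}\big)_{ij}\Big|\xrightarrow{P}0\qquad(n\to\infty).$$ (If the left-hand side is not measurable, convergence is meant with respect to outer probability. Matrix inverses, quotients and logarithms that do not exist are given the value $0$.) -/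

import Mathlib

open MeasureTheory ProbabilityTheory Filter Topology Matrix Asymptotics

noncomputable section

namespace PCDAG

/-! ### Directed acyclic graphs -/

/-- A directed acyclic graph on the vertex set `V`: `edge i j` means `i → j`. -/
structure DAG (V : Type*) where
  edge : V → V → Prop
  acyclic : ∀ v, ¬ Relation.TransGen edge v v

namespace DAG

variable {V : Type*}

/-- The skeleton: forget the arrowheads. -/
def skeleton (D : DAG V) : SimpleGraph V where
  Adj i j := D.edge i j ∨ D.edge j i
  symm := ⟨fun _ _ h => h.symm⟩
  loopless := ⟨fun v h => D.acyclic v (Relation.TransGen.single (h.elim id id))⟩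

open scoped Classical in
/-- The set `pa(i)` of parents of `i`. -/
def parents [Fintype V] (D : DAG V) (i : V) : Finset V :=
  Finset.univ.filter fun j => D.edge j i

open scoped Classical in
/-- The maximal cardinality of an adjacency set, `max_i |adj(i, D)|`. -/
def maxAdj [Fintype V] (D : DAG V) : ℕ := D.skeleton.maxDegree

/-- The triple `(i, j, k)` is a v-structure: `i → j ← k` with `i`, `k` distinct, nonadjacent. -/
def IsVStructure (D : DAG V) (i j k : V) : Prop :=
  D.edge i j ∧ D.edge k j ∧ i ≠ k ∧ ¬ D.skeleton.Adj i k

/-- Two DAGs belong to the same equivalence class (are represented by the same CPDAG): they have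
the same skeleton and the same v-structures. -/
def Equivalent (D D' : DAG V) : Prop :=
  D.skeleton = D'.skeleton ∧ ∀ i j k, D.IsVStructure i j k ↔ D'.IsVStructure i j k

/-- The `m`-th vertex of a path is an inner vertex at which two arrowheads of the path meet. -/
def ColliderAt (D : DAG V) {i j : V} (q : D.skeleton.Walk i j) (m : ℕ) : Prop :=
  0 < m ∧ m < q.length ∧ D.edge (q.getVert (m - 1)) (q.getVert m) ∧
    D.edge (q.getVert (m + 1)) (q.getVert m)

/-- A path is blocked by `C` if it contains a non-collider that lies in `C`, or a collider such
that neither the collider nor any of its descendants lies in `C`. -/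
def Blocked (D : DAG V) {i j : V} (q : D.skeleton.Walk i j) (C : Set V) : Prop :=
  ∃ m ≤ q.length,
    (q.getVert m ∈ C ∧ ¬ D.ColliderAt q m) ∨
    (D.ColliderAt q m ∧ ∀ c ∈ C, ¬ Relation.ReflTransGen D.edge (q.getVert m) c)

/-- `A` and `B` are d-separated by `C`: every path from `A` to `B` is blocked by `C`. -/
def DSep (D : DAG V) (A B C : Set V) : Prop :=
  ∀ i ∈ A, ∀ j ∈ B, ∀ q : D.skeleton.Walk i j, q.IsPath → D.Blocked q C

end DAG

/-! ### Conditional independence, Markov property, faithfulness -/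

section Markov

variable {V : Type*}

/-- The subvector `x_A` of `x`. -/
def coords (A : Set V) (x : EuclideanSpace ℝ V) : A → ℝ := fun a => x a

theorem measurable_coords (A : Set V) : Measurable (coords A) := by
  unfold coords
  fun_prop

variable [Fintype V]

/-- Under the law `P` of `(X_i)_{i ∈ V}`, `X_A` and `X_B` are conditionally independent given
`X_C`. -/
def CondIndepCoords (P : Measure (EuclideanSpace ℝ V)) [IsFiniteMeasure P] (A B C : Set V) : Prop :=
  CondIndepFun (MeasurableSpace.comap (coords C) inferInstance) (measurable_coords C).comap_le
    (coords A) (coords B) P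

/-- The directed global Markov property of `P` relative to `D`. -/
def IsMarkov (P : Measure (EuclideanSpace ℝ V)) [IsFiniteMeasure P] (D : DAG V) : Prop :=
  ∀ A B C : Set V, Disjoint A B → Disjoint A C → Disjoint B C →
    D.DSep A B C → CondIndepCoords P A B C

/-- Faithfulness of `P` to `D`. -/
def IsFaithful (P : Measure (EuclideanSpace ℝ V)) [IsFiniteMeasure P] (D : DAG V) : Prop :=
  ∀ A B C : Set V, Disjoint A B → Disjoint A C → Disjoint B C →
    (CondIndepCoords P A B C ↔ D.DSep A B C)

end Markov

/-! ### Regression quantities of a covariance matrix -/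

section Regression

variable {V : Type*} [Fintype V] [DecidableEq V]

/-- The row vector `S_{i,K} (S_{K,K})⁻¹`. -/
def regCoef (S : Matrix V V ℝ) (i : V) (K : Finset V) : K → ℝ :=
  (fun k : K => S i k) ᵥ* (S.submatrix (Subtype.val : K → V) (Subtype.val : K → V))⁻¹

/-- The conditional covariance `S_{i,j} - S_{i,K} (S_{K,K})⁻¹ S_{K,j}` of `X_i`, `X_j` given
`X_K`. -/
def condCov (S : Matrix V V ℝ) (i j : V) (K : Finset V) : ℝ :=
  S i j - regCoef S i K ⬝ᵥ fun k : K => S k j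

/-- The conditional variance of `X_i` given `X_K`. -/
def condVar (S : Matrix V V ℝ) (i : V) (K : Finset V) : ℝ := condCov S i i K

/-- The partial correlation of `X_i` and `X_j` given `X_K`. -/
def partialCorr (S : Matrix V V ℝ) (i j : V) (K : Finset V) : ℝ :=
  condCov S i j K / (√(condVar S i K) * √(condVar S j K))

/-- The matrix `A` of the regressions of every variable on its parents in `D`. -/
def regMatrix (S : Matrix V V ℝ) (D : DAG V) : Matrix V V ℝ :=
  Matrix.of fun i j =>
    if h : j ∈ D.parents i then - regCoef S i (D.parents i) ⟨j, h⟩ else if j = i then 1 else 0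

/-- The diagonal covariance matrix of the regression errors. -/
def errorCov (S : Matrix V V ℝ) (D : DAG V) : Matrix V V ℝ :=
  Matrix.diagonal fun i => condVar S i (D.parents i)

/-- The concentration matrix `Aᵀ Cov(ε)⁻¹ A` built from `S` and the DAG `D`. -/
def dagConcentration (S : Matrix V V ℝ) (D : DAG V) : Matrix V V ℝ :=
  (regMatrix S D)ᵀ * (errorCov S D)⁻¹ * regMatrix S D

end Regression

/-! ### Sample quantities and the test for a vanishing partial correlation -/

section Sample

variable {V : Type*} {n : ℕ}

/-- The sample mean. -/
def sampleMean (x : Fin n → EuclideanSpace ℝ V) (i : V) : ℝ := (n : ℝ)⁻¹ * ∑ r, x r i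

/-- The maximum likelihood estimator of the covariance matrix. -/
def sampleCov (x : Fin n → EuclideanSpace ℝ V) : Matrix V V ℝ :=
  Matrix.of fun i j =>
    (n : ℝ)⁻¹ * ∑ r, (x r i - sampleMean x i) * (x r j - sampleMean x j)

/-- The distribution function `Φ` of the standard normal distribution. -/
def stdNormalCDF (t : ℝ) : ℝ := cdf (gaussianReal 0 1) t

/-- The quantile function `Φ⁻¹` on `(0, 1)`. -/
def stdNormalQuantile (u : ℝ) : ℝ := sInf {t : ℝ | u ≤ stdNormalCDF t}

variable [Fintype V] [DecidableEq V]

/-- Fisher's z-transform of the sample partial correlation. -/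
def fisherZ (x : Fin n → EuclideanSpace ℝ V) (i j : V) (K : Finset V) : ℝ :=
  (1 / 2) * Real.log ((1 + partialCorr (sampleCov x) i j K) / (1 - partialCorr (sampleCov x) i j K))

/-- The test at level `α` does not reject `ρ_{i,j|K} = 0`. -/
def TestIndep (x : Fin n → EuclideanSpace ℝ V) (α : ℝ) (i j : V) (K : Finset V) : Prop :=
  √((n : ℝ) - K.card - 3) * |fisherZ x i j K| ≤ stdNormalQuantile (1 - α / 2)

end Sample

/-! ### The PC-algorithm

The algorithm leaves the order in which pairs, conditioning sets, and orientations are treated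
open; it is described by the relation between inputs and possible outputs. -/

/-- `y` is reached from `x` by a sequence of steps after which no further step is possible. -/
def RunsTo {α : Type*} (step : α → α → Prop) (x y : α) : Prop :=
  Relation.ReflTransGen step x y ∧ ∀ z, ¬ step y z

section Algorithm

variable {V : Type*} [DecidableEq V]

/-- State of the skeleton search: the current graph and the separation sets `S(i,j) = S(j,i)`. -/
structure SkelState (V : Type*) where
  graph : SimpleGraph V
  sep : Sym2 V → Finset V

/-- Deletion of an edge at level `l`: for an ordered pair `i, j` of adjacent nodes and some
`K ⊆ adj(i) \ {j}` with `|K| = l` for which independence is accepted, the edge is deleted and `K`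
is saved as a separation set. -/
inductive DeleteStep (indep : V → V → Finset V → Prop) (l : ℕ) : SkelState V → SkelState V → Prop
  | delete {s : SkelState V} {i j : V} {K : Finset V}
      (adj : s.graph.Adj i j) (sub : (K : Set V) ⊆ s.graph.neighborSet i \ {j})
      (card : K.card = l) (accept : indep i j K) :
      DeleteStep indep l s
        ⟨s.graph.deleteEdges {Sym2.mk i j}, Function.update s.sep (Sym2.mk i j) K⟩

/-- The stopping criterion of the skeleton search at level `l`. -/
def SkelStop (l : ℕ) (s : SkelState V) : Prop :=
  ∀ i j, s.graph.Adj i j → (s.graph.neighborSet i \ {j}).ncard < l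

/-- `SkelRun indep l s t`: the skeleton search, entering level `l` in state `s`, may end in state
`t`. A level is completed when all its tests on the remaining edges have been rejected. -/
inductive SkelRun (indep : V → V → Finset V → Prop) : ℕ → SkelState V → SkelState V → Prop
  | last {l : ℕ} {s t : SkelState V} (level : RunsTo (DeleteStep indep l) s t)
      (done : SkelStop l t) : SkelRun indep l s t
  | next {l : ℕ} {s u t : SkelState V} (level : RunsTo (DeleteStep indep l) s u)
      (more : ¬ SkelStop l u) (rest : SkelRun indep (l + 1) u t) : SkelRun indep l s t

/-- Orientation of a v-structure: for nonadjacent `i, j` with common neighbour `k ∉ S(i,j)`, orient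
`i → k ← j`. A v-structure that conflicts with an orientation made before is discarded. The relation
`E` collects the arrows oriented so far; edges of the skeleton without arrow are undirected. -/
inductive VStep (s : SkelState V) : (V → V → Prop) → (V → V → Prop) → Prop
  | orient {E : V → V → Prop} {i j k : V} (ne : i ≠ j) (nadj : ¬ s.graph.Adj i j)
      (hik : s.graph.Adj i k) (hjk : s.graph.Adj j k) (sep : k ∉ s.sep (Sym2.mk i j))
      (conf_i : ¬ E k i) (conf_j : ¬ E k j) (fresh : ¬ (E i k ∧ E j k)) :
      VStep s E (fun u v => E u v ∨ (v = k ∧ (u = i ∨ u = j)))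

/-- The edge `i - j` of the skeleton `G` is not yet oriented by `E`. -/
def Undirected (G : SimpleGraph V) (E : V → V → Prop) (i j : V) : Prop :=
  G.Adj i j ∧ ¬ E i j ∧ ¬ E j i

/-- The orientation rules R1, R2, R3. -/
inductive RuleStep (G : SimpleGraph V) : (V → V → Prop) → (V → V → Prop) → Prop
  | r1 {E : V → V → Prop} {i j k : V} (hjk : Undirected G E j k) (hij : E i j) (ne : i ≠ k)
      (nadj : ¬ G.Adj i k) :
      RuleStep G E (fun u v => E u v ∨ (u = j ∧ v = k))
  | r2 {E : V → V → Prop} {i j k : V} (hij : Undirected G E i j) (hik : E i k) (hkj : E k j) :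
      RuleStep G E (fun u v => E u v ∨ (u = i ∧ v = j))
  | r3 {E : V → V → Prop} {i j k l : V} (hij : Undirected G E i j)
      (hik : Undirected G E i k) (hkj : E k j) (hil : Undirected G E i l) (hlj : E l j)
      (ne : k ≠ l) (nadj : ¬ G.Adj k l) :
      RuleStep G E (fun u v => E u v ∨ (u = i ∧ v = j))

/-- The partially directed graph with skeleton `G` and arrows `E` is a possible output of the
PC-algorithm with conditional independence decisions `indep`. -/
def PCOutput (indep : V → V → Finset V → Prop) (G : SimpleGraph V) (E : V → V → Prop) : Prop :=
  ∃ (t : SkelState V) (E₀ : V → V → Prop),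
    SkelRun indep 0 ⟨⊤, fun _ => ∅⟩ t ∧ t.graph = G ∧
    RunsTo (VStep t) (fun _ _ => False) E₀ ∧ RunsTo (RuleStep G) E₀ E

/-- `D` is obtained from the partially directed graph with skeleton `G` and arrows `E` by directing
the undirected edges without creating cycles or additional v-structures. -/
def IsExtension (G : SimpleGraph V) (E : V → V → Prop) (D : DAG V) : Prop :=
  D.skeleton = G ∧ (∀ i j, E i j → D.edge i j) ∧
    ∀ i j k, D.IsVStructure i j k → E i j ∧ E k j

/-- `D` is a DAG estimate obtained from the data `x` by the PC-algorithm with tuning parameter `α`: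
a DAG in the estimated CPDAG. If the output describes no DAG at all, `D` is arbitrary. -/
def IsPCDAG [Fintype V] {n : ℕ} (x : Fin n → EuclideanSpace ℝ V) (α : ℝ) (D : DAG V) : Prop :=
  ∃ (G : SimpleGraph V) (E : V → V → Prop), PCOutput (TestIndep x α) G E ∧
    (IsExtension G E D ∨ ∀ D' : DAG V, ¬ IsExtension G E D')

end Algorithm

end PCDAG

end

/-!
The estimated concentration matrix depends on the estimated DAG only through its equivalence class.
Two equivalent DAGs are connected by reversals of covered edges (`DAG.Equivalent.induction`), and
such a reversal changes only two terms of `∑_l w_l w_lᵀ / v_l`, where `w_l` is the residual vector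
of the regression of the variable `l` on its parents and `v_l` the residual variance; the sum of
the two terms is the same before and after (`dagConcentration_eq_of_equivalent`). This is an
algebraic identity, valid for the sample covariance matrix. Hence, on the event that the
PC-algorithm finds the equivalence class of the true DAG `G`, the estimator is the one computed from
the fixed DAG `G`, and no uniformity over the equivalence class is needed. For the true covariance
matrix `S`, the local Markov property shows that the matrix computed from `G` is `S⁻¹`
(`dagConcentration_eq_inv`).

*The PC-algorithm.* If the conditional independence decisions of orders up to the maximal adjacency
size `q` agree with d-separation, every run of the algorithm ends in a CPDAG whose extensions are
equivalent to `G` (`PCOutput.equivalent`). For Gaussian faithful laws d-separation means that the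
partial correlation vanishes (`partialCorr_eq_zero_iff_dSep`), and with the given tuning parameter
the tests decide correctly once the sample partial correlations are accurate up to
`min(c, 1, 1 - M) / 4` (`testIndep_iff`).

*Concentration.* The sample conditional covariance of `i` and `j` given `K` does not change when the
variables are replaced by their true residuals given `K`, which are independent of `X_K`. It is then
a sample second moment of the residuals, corrected by products of their means and by the part that
the variables in `K` explain in the sample. The latter is a squared projection of a standard
Gaussian vector onto the span of `|K|` independent random vectors. All these quantities have
exponential tails (`IsGaussianSample.measure_not_sampleGood`): the deviation exceeds `3 η` times the
product of the residual standard deviations with probability at most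
`4 exp(-n η² / 8) + 6 · 2^|K| exp(-n η / 4)`.

*Rates.* The tests need an accuracy of the order `c_n ≥ const · n^{-d}` for `p^{O(q)}` conditional
covariances, which is affordable as `q log p = o(n^{1 - 2 d})`. An entry of the concentration matrix
of `G` is a sum of at most `q + 1` nonzero terms (`abs_dagConcentration_sub_le`) that depend on
polynomially many conditional covariances, so that these may be required to be accurate up to
`n^{-1/2 + b/2} = o(1 / q)`.
-/

namespace PCDAG

/-! ### d-separation in a directed acyclic graph -/

namespace DAG

variable {V : Type*}

theorem ext_edge {D D' : DAG V} (h : ∀ i j, D.edge i j ↔ D'.edge i j) : D = D' := by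
  cases D; cases D'
  congr
  funext i j
  exact propext (h i j)

theorem not_edge_of_edge (D : DAG V) {i j : V} (h : D.edge i j) : ¬ D.edge j i := fun h' =>
  D.acyclic i ((Relation.TransGen.single h).tail h')

theorem ne_of_edge (D : DAG V) {i j : V} (h : D.edge i j) : i ≠ j := by
  rintro rfl
  exact D.acyclic i (Relation.TransGen.single h)

theorem mem_parents [Fintype V] {D : DAG V} {i j : V} : j ∈ D.parents i ↔ D.edge j i := by
  simp [parents]

theorem self_notMem_parents [Fintype V] (D : DAG V) (i : V) : i ∉ D.parents i := fun h =>
  D.ne_of_edge (mem_parents.1 h) rfl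

theorem ncard_neighborSet_le_maxAdj [Fintype V] (D : DAG V) (i : V) :
    (D.skeleton.neighborSet i).ncard ≤ D.maxAdj := by
  classical
  rw [Set.ncard_eq_toFinset_card', ← SimpleGraph.neighborFinset_def,
    SimpleGraph.card_neighborFinset_eq_degree]
  unfold maxAdj
  convert! D.skeleton.degree_le_maxDegree i

theorem card_parents_le_maxAdj [Fintype V] (D : DAG V) (i : V) :
    (D.parents i).card ≤ D.maxAdj := by
  refine le_trans ?_ (D.ncard_neighborSet_le_maxAdj i)
  rw [← Set.ncard_coe_finset]
  exact Set.ncard_le_ncard (fun j hj => Or.inr (mem_parents.1 hj)) (Set.toFinite _)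

theorem card_children_le_maxAdj [Fintype V] [DecidableEq V] (D : DAG V) (i : V) :
    (Finset.univ.filter fun l => i ∈ D.parents l).card ≤ D.maxAdj := by
  refine le_trans ?_ (D.ncard_neighborSet_le_maxAdj i)
  rw [← Set.ncard_coe_finset]
  exact Set.ncard_le_ncard (fun j hj => Or.inl (mem_parents.1 (Finset.mem_filter.1 hj).2))
    (Set.toFinite _)

/-- Adjacent vertices are never d-separated: the path that consists of their edge is open. -/
theorem not_dSep_of_adj (D : DAG V) {i j : V} {K : Set V} (h : D.skeleton.Adj i j) (hi : i ∉ K)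
    (hj : j ∉ K) : ¬ D.DSep {i} {j} K := by
  intro hs
  obtain ⟨m, hm, h | h⟩ := hs i rfl j rfl h.toWalk (by simpa using h.ne)
  · simp only [SimpleGraph.Walk.length_cons, SimpleGraph.Walk.length_nil] at hm
    interval_cases m <;> simp_all
  · have := h.1.1
    have := h.1.2.1
    simp at this
    omega

/-- The local Markov property of d-separation: the parents of `i` separate `i` from every
nonadjacent non-descendant. -/
theorem dSep_parents [Fintype V] (D : DAG V) {i j : V} (hij : i ≠ j)
    (hd : ¬ Relation.TransGen D.edge i j) : D.DSep {i} {j} (D.parents i : Set V) := by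
  intro i' hi' j' hj' q _
  obtain rfl : i' = i := hi'
  obtain rfl : j' = j := hj'
  have hlen : 0 < q.length := by
    rcases Nat.eq_zero_or_pos q.length with h | h
    · exact absurd (SimpleGraph.Walk.eq_of_length_eq_zero h) hij
    · exact h
  have h01 := q.adj_getVert_succ hlen
  rw [q.getVert_zero, zero_add] at h01
  rcases h01 with h01 | h01
  swap
  · refine ⟨1, hlen, Or.inl ⟨Finset.mem_coe.2 (mem_parents.2 h01), fun hc => ?_⟩⟩
    have := hc.2.2.1
    simp only [Nat.sub_self, q.getVert_zero] at this
    exact D.not_edge_of_edge h01 this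
  -- Follow the path forwards until an arrow is met head-on: that collider is a descendant of `i`.
  by_contra hb
  have key : ∀ m, m + 1 ≤ q.length →
      Relation.TransGen D.edge i' (q.getVert (m + 1)) ∧
        D.edge (q.getVert m) (q.getVert (m + 1)) := by
    intro m
    induction m with
    | zero => exact fun _ => ⟨Relation.TransGen.single h01, by simpa using h01⟩
    | succ m ih =>
      intro hm
      obtain ⟨ht, he⟩ := ih (by omega)
      rcases q.adj_getVert_succ (show m + 1 < q.length by omega) with h | h
      · exact ⟨ht.tail h, h⟩
      · refine absurd ⟨m + 1, by omega, Or.inr ⟨⟨by omega, by omega, by simpa using he, h⟩, ?_⟩⟩ hb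
        intro c hc hr
        exact D.acyclic _ ((ht.trans_left hr).tail (mem_parents.1 (Finset.mem_coe.1 hc)))
  have := (key (q.length - 1) (by omega)).1
  rw [Nat.sub_add_cancel hlen, q.getVert_length] at this
  exact hd this

/-- Two nonadjacent vertices are d-separated by the parents of one of them. -/
theorem dSep_parents_or [Fintype V] (D : DAG V) {i j : V} (hij : i ≠ j) :
    D.DSep {i} {j} (D.parents i : Set V) ∨ D.DSep {j} {i} (D.parents j : Set V) := by
  by_cases h : Relation.TransGen D.edge i j
  · exact Or.inr (D.dSep_parents hij.symm fun h' => D.acyclic i (h.trans h'))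
  · exact Or.inl (D.dSep_parents hij h)

/-- A set that separates the ends of an unshielded triple contains its middle vertex if and only
if the triple is not a v-structure. -/
theorem mem_iff_not_isVStructure_of_dSep (D : DAG V) {i j k : V} {K : Set V}
    (hij : i ≠ j) (hik : D.skeleton.Adj i k) (hkj : D.skeleton.Adj k j)
    (hn : ¬ D.skeleton.Adj i j) (hi : i ∉ K) (hj : j ∉ K) (hs : D.DSep {i} {j} K) :
    k ∈ K ↔ ¬ D.IsVStructure i k j := by
  have hb := hs i rfl j rfl (.cons hik (.cons hkj .nil))
    (by simp [hik.ne, hkj.ne, hij])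
  have hcol : ∀ m, D.ColliderAt (.cons hik (.cons hkj .nil)) m →
      m = 1 ∧ D.edge i k ∧ D.edge j k := by
    intro m hm
    have h1 := hm.1
    have h2 := hm.2.1
    simp only [SimpleGraph.Walk.length_cons, SimpleGraph.Walk.length_nil] at h2
    obtain rfl : m = 1 := by omega
    exact ⟨rfl, by simpa using hm.2.2⟩
  constructor
  · intro hk hv
    obtain ⟨m, hm, h | h⟩ := hb
    · simp only [SimpleGraph.Walk.length_cons, SimpleGraph.Walk.length_nil] at hm
      interval_cases m
      · simp_all
      · apply h.2
        exact ⟨by simp, by simp, by simpa using hv.1, by simpa using hv.2.1⟩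
      · simp_all
    · obtain rfl := (hcol m h.1).1
      exact h.2 k hk (by simpa using Relation.ReflTransGen.refl)
  · intro hv
    by_contra hk
    obtain ⟨m, hm, h | h⟩ := hb
    · simp only [SimpleGraph.Walk.length_cons, SimpleGraph.Walk.length_nil] at hm
      interval_cases m <;> simp_all
    · have := hcol m h.1
      exact hv ⟨this.2.1, this.2.2, hij, hn⟩

end DAG

/-! ### The PC-algorithm with correct decisions -/

section PCCorrect

variable {V : Type*}

/-- `K` is a set without `i` and `j` that separates `i` and `j` in `G`. -/
def Separates (G : DAG V) (i j : V) (K : Finset V) : Prop :=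
  (G.DSep {i} {j} K ∨ G.DSep {j} {i} K) ∧ i ∉ K ∧ j ∉ K

theorem Separates.symm {G : DAG V} {i j : V} {K : Finset V} (h : Separates G i j K) :
    Separates G j i K := ⟨h.1.symm, h.2.2, h.2.1⟩

theorem Separates.not_adj {G : DAG V} {i j : V} {K : Finset V} (h : Separates G i j K) :
    ¬ G.skeleton.Adj i j := fun ha => h.1.elim
  (G.not_dSep_of_adj ha (by simpa using h.2.1) (by simpa using h.2.2))
  (G.not_dSep_of_adj ha.symm (by simpa using h.2.2) (by simpa using h.2.1))

theorem Separates.mem_iff {G : DAG V} {i j k : V} {K : Finset V} (h : Separates G i j K)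
    (hij : i ≠ j) (hik : G.skeleton.Adj i k) (hjk : G.skeleton.Adj j k) :
    k ∈ K ↔ ¬ G.IsVStructure i k j := by
  rcases h.1 with hs | hs
  · simpa using G.mem_iff_not_isVStructure_of_dSep hij hik hjk.symm h.not_adj
      (by simpa using h.2.1) (by simpa using h.2.2) hs
  · have := G.mem_iff_not_isVStructure_of_dSep hij.symm hjk hik.symm h.symm.not_adj
      (by simpa using h.2.2) (by simpa using h.2.1) hs
    simp only [Finset.mem_coe] at this
    rw [this, DAG.IsVStructure, DAG.IsVStructure, G.skeleton.adj_comm i j]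
    tauto

/-- Invariant of the skeleton search: no edge of `G` has been deleted, and every deleted edge has a
separating set. -/
def SkelInv (G : DAG V) (s : SkelState V) : Prop :=
  G.skeleton ≤ s.graph ∧ ∀ i j, i ≠ j → ¬ s.graph.Adj i j → Separates G i j (s.sep s(i, j))

/-- All tests of level `l` that are left in the state `s` reject independence. -/
def LevelDone (indep : V → V → Finset V → Prop) (l : ℕ) (s : SkelState V) : Prop :=
  ∀ i j (K : Finset V), s.graph.Adj i j → (K : Set V) ⊆ s.graph.neighborSet i \ {j} →
    K.card = l → ¬ indep i j K

/-- The decisions `indep` agree with d-separation in `G` for conditioning sets of at most `maxAdj`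
elements. -/
def DecidesDSep [Fintype V] (indep : V → V → Finset V → Prop) (G : DAG V) : Prop :=
  ∀ i j (K : Finset V), i ≠ j → i ∉ K → j ∉ K → K.card ≤ G.maxAdj →
    (indep i j K ↔ G.DSep {i} {j} K)

variable {indep : V → V → Finset V → Prop} {G : DAG V}

theorem LevelDone.anti {l : ℕ} {s t : SkelState V} (h : LevelDone indep l s)
    (hts : t.graph ≤ s.graph) : LevelDone indep l t := fun i j K ha hK hc =>
  h i j K (hts ha) (fun _ hv => ⟨hts (hK hv).1, (hK hv).2⟩) hc

theorem DeleteStep.graph_le [DecidableEq V] {l : ℕ} {s t : SkelState V}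
    (h : DeleteStep indep l s t) :
    t.graph ≤ s.graph := by
  cases h
  exact SimpleGraph.deleteEdges_le _

theorem DeleteStep.skelInv [DecidableEq V] [Fintype V] {l : ℕ} {s t : SkelState V}
    (hdec : DecidesDSep indep G)
    (hl : l ≤ G.maxAdj) (h : DeleteStep indep l s t) (hs : SkelInv G s) : SkelInv G t := by
  obtain @⟨i, j, K, adj, sub, card, accept⟩ := h
  have hi : i ∉ K := fun h => s.graph.loopless.irrefl i (sub h).1
  have hj : j ∉ K := fun h => (sub h).2 rfl
  have hK : Separates G i j K :=
    ⟨Or.inl ((hdec i j K adj.ne hi hj (card ▸ hl)).1 accept), hi, hj⟩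
  refine ⟨fun a b hab => ?_, fun a b hab hn => ?_⟩
  · simp only [SimpleGraph.deleteEdges_adj, Set.mem_singleton_iff]
    refine ⟨hs.1 hab, fun h => ?_⟩
    rcases Sym2.eq_iff.1 h with ⟨rfl, rfl⟩ | ⟨rfl, rfl⟩
    · exact hK.not_adj hab
    · exact hK.not_adj hab.symm
  · by_cases h : s(a, b) = s(i, j)
    · simp only [h, Function.update_self]
      rcases Sym2.eq_iff.1 h with ⟨rfl, rfl⟩ | ⟨rfl, rfl⟩
      · exact hK
      · exact hK.symm
    · simp only [Function.update_of_ne h]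
      refine hs.2 a b hab fun h' => hn ?_
      simp only [SimpleGraph.deleteEdges_adj, Set.mem_singleton_iff]
      exact ⟨h', h⟩

/-- If all levels up to the size of the parent sets are done, then only edges of `G` are left. -/
theorem graph_eq_skeleton [Fintype V] {s : SkelState V} (hdec : DecidesDSep indep G)
    (hs : SkelInv G s)
    (hd : ∀ i j, s.graph.Adj i j → ∀ K : Finset V, (K : Set V) ⊆ s.graph.neighborSet i \ {j} →
      K.card ≤ G.maxAdj → LevelDone indep K.card s) : s.graph = G.skeleton := by
  refine le_antisymm (fun i j hij => ?_) hs.1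
  by_contra hn
  have main : ∀ i j, s.graph.Adj i j → ¬ G.skeleton.Adj i j →
      ¬ G.DSep {i} {j} (G.parents i : Set V) := by
    intro i j hij hn hsep
    have hj : j ∉ G.parents i := fun h => hn (Or.inr (DAG.mem_parents.1 h))
    have hsub : (G.parents i : Set V) ⊆ s.graph.neighborSet i \ {j} := by
      intro k hk
      refine ⟨hs.1 (Or.inr (DAG.mem_parents.1 hk)), ?_⟩
      rintro rfl
      exact hj hk
    refine hd i j hij _ hsub (G.card_parents_le_maxAdj i) i j _ hij hsub rfl ?_
    exact (hdec i j _ hij.ne (G.self_notMem_parents i) hj (G.card_parents_le_maxAdj i)).2 hsep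
  rcases G.dSep_parents_or hij.ne with h | h
  · exact main i j hij hn h
  · exact main j i hij.symm (fun h => hn h.symm) h

theorem levelDone_of_runsTo [DecidableEq V] {l : ℕ} {s t : SkelState V}
    (h : RunsTo (DeleteStep indep l) s t) : LevelDone indep l t :=
  fun _ _ _ ha hK hc hi => h.2 _ (DeleteStep.delete ha hK hc hi)

theorem graph_le_of_runsTo [DecidableEq V] {l : ℕ} {s t : SkelState V}
    (h : Relation.ReflTransGen (DeleteStep indep l) s t) : t.graph ≤ s.graph := by
  induction h with
  | refl => exact le_rfl
  | tail _ h ih => exact h.graph_le.trans ih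

theorem skelInv_of_runsTo [DecidableEq V] [Fintype V] {l : ℕ} {s t : SkelState V}
    (hdec : DecidesDSep indep G)
    (hl : l ≤ G.maxAdj) (h : Relation.ReflTransGen (DeleteStep indep l) s t)
    (hs : SkelInv G s) : SkelInv G t := by
  induction h with
  | refl => exact hs
  | tail _ h ih => exact h.skelInv hdec hl ih

/-- The skeleton search never goes beyond level `maxAdj`, so it uses correct decisions only, and it
ends with the skeleton of `G`. -/
theorem SkelRun.correct [DecidableEq V] [Fintype V] (hdec : DecidesDSep indep G) {l : ℕ}
    {s t : SkelState V}
    (h : SkelRun indep l s t) :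
    SkelInv G s → (∀ l' < l, LevelDone indep l' s) → l ≤ G.maxAdj →
      t.graph = G.skeleton ∧ SkelInv G t := by
  induction h with
  | @last l s t level done =>
    intro hs hd hl
    have ht := skelInv_of_runsTo hdec hl level.1 hs
    refine ⟨graph_eq_skeleton hdec ht fun i j hij K hK _ => ?_, ht⟩
    refine (hd K.card ?_).anti (graph_le_of_runsTo level.1)
    refine lt_of_le_of_lt ?_ (done i j hij)
    rw [← Set.ncard_coe_finset]
    exact Set.ncard_le_ncard hK (Set.toFinite _)
  | @next l s u t level more _ ih =>
    intro hs hd hl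
    have hu := skelInv_of_runsTo hdec hl level.1 hs
    have hdu : ∀ l' < l + 1, LevelDone indep l' u := by
      intro l' hl'
      rcases Nat.lt_succ_iff_lt_or_eq.1 hl' with h | rfl
      · exact (hd l' h).anti (graph_le_of_runsTo level.1)
      · exact levelDone_of_runsTo level
    refine ih hu hdu ?_
    by_contra hlt
    have hl' : l = G.maxAdj := by omega
    have hg := graph_eq_skeleton hdec hu fun i j _ K _ hc => hdu K.card (by omega)
    refine more fun i j hij => ?_
    rw [hg] at hij ⊢
    calc (G.skeleton.neighborSet i \ {j}).ncard < (G.skeleton.neighborSet i).ncard :=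
          Set.ncard_sdiff_singleton_lt_of_mem hij (Set.toFinite _)
      _ ≤ l := hl' ▸ G.ncard_neighborSet_le_maxAdj i

/-- The orientation of v-structures with correct separating sets yields the arrows that belong to
a v-structure of `G`. -/
theorem vStep_correct [DecidableEq V] {t : SkelState V} (hg : t.graph = G.skeleton)
    (ht : SkelInv G t)
    {E₀ : V → V → Prop} (h : RunsTo (VStep t) (fun _ _ => False) E₀) (i j : V) :
    E₀ i j ↔ ∃ k, G.IsVStructure i j k := by
  have sound : ∀ i j, E₀ i j → ∃ k, G.IsVStructure i j k := by
    have h1 := h.1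
    clear h
    induction h1 with
    | refl => exact fun _ _ h => h.elim
    | tail _ hstep ih =>
      obtain @⟨a, b, k, ne, nadj, hik, hjk, sep, -, -, -⟩ := hstep
      have hv : G.IsVStructure a k b := by
        by_contra hv
        refine sep (((ht.2 a b ne nadj).mem_iff ne ?_ ?_).2 hv)
        · rwa [hg] at hik
        · rwa [hg] at hjk
      rintro u v (hE | ⟨rfl, rfl | rfl⟩)
      · exact ih u v hE
      · exact ⟨b, hv⟩
      · exact ⟨a, hv.2.1, hv.1, hv.2.2.1.symm, fun h => hv.2.2.2 h.symm⟩
  refine ⟨sound i j, fun ⟨k, hv⟩ => ?_⟩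
  by_contra hE
  have hn : ¬ t.graph.Adj i k := by rw [hg]; exact hv.2.2.2
  have hij : G.skeleton.Adj i j := Or.inl hv.1
  have hkj : G.skeleton.Adj k j := Or.inl hv.2.1
  refine h.2 _ (VStep.orient hv.2.2.1 hn (hg ▸ hij) (hg ▸ hkj) ?_ ?_ ?_ fun h => hE h.1)
  · exact fun h => ((ht.2 i k hv.2.2.1 hn).mem_iff hv.2.2.1 hij hkj).1 h hv
  · intro h
    obtain ⟨_, h'⟩ := sound _ _ h
    exact G.not_edge_of_edge hv.1 h'.1
  · intro h
    obtain ⟨_, h'⟩ := sound _ _ h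
    exact G.not_edge_of_edge hv.2.1 h'.1

/-- The rules R1, R2, R3 only introduce arrows of `G` when they start from arrows of `G` that
include all arrows of v-structures. -/
theorem ruleStep_correct {E₀ E : V → V → Prop} (h₀ : ∀ i j, E₀ i j → G.edge i j)
    (hv : ∀ i j k, G.IsVStructure i j k → E₀ i j)
    (h : Relation.ReflTransGen (RuleStep G.skeleton) E₀ E) :
    (∀ i j, E i j → G.edge i j) ∧ ∀ i j k, G.IsVStructure i j k → E i j := by
  induction h with
  | refl => exact ⟨h₀, hv⟩
  | tail _ hstep ih =>
    obtain ⟨ihE, ihv⟩ := ih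
    refine ⟨?_, ?_⟩
    swap
    · intro i j k h
      cases hstep <;> exact Or.inl (ihv i j k h)
    have orient : ∀ i j, G.skeleton.Adj i j → ¬ G.edge j i → G.edge i j :=
      fun i j h hn => h.resolve_right hn
    cases hstep with
    | @r1 i j k hjk hij ne nadj =>
      rintro u v (hE | ⟨rfl, rfl⟩)
      · exact ihE u v hE
      · refine orient _ _ hjk.1 fun hkj => hjk.2.2 ?_
        exact ihv v u i ⟨hkj, ihE _ _ hij, ne.symm, fun h => nadj h.symm⟩
    | @r2 i j k hij hik hkj =>
      rintro u v (hE | ⟨rfl, rfl⟩)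
      · exact ihE u v hE
      · refine orient _ _ hij.1 fun hji => ?_
        exact G.acyclic u (((Relation.TransGen.single (ihE _ _ hik)).tail (ihE _ _ hkj)).tail hji)
    | @r3 i j k l hij hik hkj hil hlj ne nadj =>
      rintro u v (hE | ⟨rfl, rfl⟩)
      · exact ihE u v hE
      · refine orient _ _ hij.1 fun hji => ?_
        -- Otherwise acyclicity forces the v-structure `k → i ← l`, whose arrows are already there.
        have hin : ∀ m, G.skeleton.Adj u m → G.edge m v → G.edge m u := by
          intro m hum hmv
          refine hum.resolve_left fun hum' => ?_
          exact G.acyclic u (((Relation.TransGen.single hum').tail hmv).tail hji)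
        exact hik.2.2 (ihv k u l ⟨hin k hik.1 (ihE _ _ hkj), hin l hil.1 (ihE _ _ hlj), ne, nadj⟩)

/-- With decisions that agree with d-separation in `G`, every DAG in the output of the
PC-algorithm is equivalent to `G`. As `G` itself is such a DAG, the output describes at least
one. -/
theorem PCOutput.equivalent [DecidableEq V] [Fintype V] (hdec : DecidesDSep indep G)
    {H : SimpleGraph V} {E : V → V → Prop}
    (h : PCOutput indep H E) {D : DAG V}
    (hD : IsExtension H E D ∨ ∀ D' : DAG V, ¬ IsExtension H E D') : D.Equivalent G := by
  obtain ⟨t, E₀, hrun, rfl, hV, hR⟩ := h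
  obtain ⟨hg, ht⟩ := hrun.correct hdec ⟨le_top, fun i j hij h => absurd hij (by simpa using h)⟩
    (by simp) (Nat.zero_le _)
  have h₀ := vStep_correct hg ht hV
  rw [hg] at hR hD
  obtain ⟨hE, hEv⟩ := ruleStep_correct (fun i j h => by obtain ⟨k, hk⟩ := (h₀ i j).1 h; exact hk.1)
    (fun i j k h => (h₀ i j).2 ⟨k, h⟩) hR.1
  have hswap : ∀ i j k, G.IsVStructure i j k → G.IsVStructure k j i := fun i j k h =>
    ⟨h.2.1, h.1, h.2.2.1.symm, fun h' => h.2.2.2 h'.symm⟩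
  have hex : IsExtension G.skeleton E G :=
    ⟨rfl, hE, fun i j k h => ⟨hEv i j k h, hEv k j i (hswap i j k h)⟩⟩
  obtain ⟨hs, hED, hDv⟩ := hD.resolve_right fun h => h G hex
  refine ⟨hs, fun i j k => ⟨fun h => ?_, fun h => ?_⟩⟩
  · obtain ⟨h1, h2⟩ := hDv i j k h
    exact ⟨hE _ _ h1, hE _ _ h2, h.2.2.1, hs ▸ h.2.2.2⟩
  · exact ⟨hED _ _ (hEv i j k h), hED _ _ (hEv k j i (hswap i j k h)), h.2.2.1, hs ▸ h.2.2.2⟩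

end PCCorrect

/-! ### Equivalent graphs and reversals of covered edges -/

namespace DAG

variable {V : Type*}

/-- `D'` arises from `D` by the reversal of the covered edge `x → y`: apart from `x`, the vertices
`x` and `y` have the same parents in `D`. -/
structure CoveredFlip (D D' : DAG V) (x y : V) : Prop where
  edge : D.edge x y
  covered : ∀ z, z ≠ x → (D.edge z y ↔ D.edge z x)
  flip : ∀ u v, D'.edge u v ↔ (u = y ∧ v = x) ∨ (D.edge u v ∧ ¬ (u = x ∧ v = y))

/-- The reversal of a covered edge creates no directed cycle. -/
theorem exists_coveredFlip (D : DAG V) {x y : V} (hxy : D.edge x y)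
    (hcov : ∀ z, z ≠ x → (D.edge z y ↔ D.edge z x)) : ∃ D', CoveredFlip D D' x y := by
  set H : V → V → Prop := fun u v => D.edge u v ∧ ¬ (u = x ∧ v = y) with hH
  set F : V → V → Prop := fun u v => (u = y ∧ v = x) ∨ H u v with hF
  have hHD : ∀ {u v}, Relation.ReflTransGen H u v → Relation.ReflTransGen D.edge u v :=
    fun h => Relation.ReflTransGen.mono (fun _ _ h => h.1) _ _ h
  have split : ∀ u v, Relation.TransGen F u v → Relation.TransGen H u v ∨
      (Relation.ReflTransGen H u y ∧ Relation.ReflTransGen H x v) := by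
    intro u v h
    induction h with
    | single h =>
      rcases h with ⟨rfl, rfl⟩ | h
      · exact Or.inr ⟨.refl, .refl⟩
      · exact Or.inl (.single h)
    | tail _ h ih =>
      rcases h with ⟨rfl, rfl⟩ | h
      · rcases ih with ih | ih
        · exact Or.inr ⟨ih.to_reflTransGen, .refl⟩
        · exact Or.inr ⟨ih.1, .refl⟩
      · rcases ih with ih | ih
        · exact Or.inl (ih.tail h)
        · exact Or.inr ⟨ih.1, ih.2.tail h⟩
  refine ⟨⟨F, fun v hv => ?_⟩, hxy, hcov, fun u v => Iff.rfl⟩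
  rcases split v v hv with h | h
  · exact D.acyclic v (Relation.TransGen.mono (fun _ _ h => h.1) _ _ h)
  · rcases (h.2.trans h.1).cases_tail with h' | ⟨z, hxz, hzy⟩
    · exact D.ne_of_edge hxy h'.symm
    · have hzx : z ≠ x := fun h => hzy.2 ⟨h, rfl⟩
      exact D.acyclic x (Relation.TransGen.tail' (hHD hxz) ((hcov z hzx).1 hzy.1))

theorem CoveredFlip.symm {D D' : DAG V} {x y : V} (h : CoveredFlip D D' x y) :
    CoveredFlip D' D y x := by
  have hne := D.ne_of_edge h.edge
  have hyx := D.not_edge_of_edge h.edge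
  refine ⟨(h.flip y x).2 (Or.inl ⟨rfl, rfl⟩), fun z hz => ?_, fun u v => ?_⟩
  · rw [h.flip, h.flip]
    by_cases hzx : z = x
    · subst hzx
      have : ¬ D.edge z z := fun h => D.ne_of_edge h rfl
      tauto
    · have := h.covered z hzx
      tauto
  · rw [h.flip]
    by_cases h1 : u = x ∧ v = y
    · simp only [h1, and_self, true_or, iff_true]
      exact h.edge
    · by_cases h2 : u = y ∧ v = x
      · obtain ⟨rfl, rfl⟩ := h2
        tauto
      · tauto

theorem CoveredFlip.skeleton_eq {D D' : DAG V} {x y : V} (h : CoveredFlip D D' x y) :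
    D'.skeleton = D.skeleton := by
  ext u v
  change D'.edge u v ∨ D'.edge v u ↔ D.edge u v ∨ D.edge v u
  rw [h.flip, h.flip]
  have := h.edge
  constructor
  · rintro ((⟨rfl, rfl⟩ | h) | (⟨rfl, rfl⟩ | h)) <;> tauto
  · by_cases h1 : u = x ∧ v = y
    · tauto
    · by_cases h2 : v = x ∧ u = y <;> tauto

theorem CoveredFlip.isVStructure_of {D D' : DAG V} {x y : V} (h : CoveredFlip D D' x y)
    {i j k : V} (hv : D.IsVStructure i j k) : D'.IsVStructure i j k := by
  obtain ⟨hij, hkj, hne, hn⟩ := hv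
  refine ⟨(h.flip i j).2 (Or.inr ⟨hij, ?_⟩), (h.flip k j).2 (Or.inr ⟨hkj, ?_⟩), hne, ?_⟩
  · rintro ⟨rfl, rfl⟩
    exact hn (Or.inr ((h.covered k hne.symm).1 hkj))
  · rintro ⟨rfl, rfl⟩
    exact hn (Or.inl ((h.covered i hne).1 hij))
  · rwa [h.skeleton_eq]

theorem CoveredFlip.equivalent {D D' : DAG V} {x y : V} (h : CoveredFlip D D' x y) :
    D'.Equivalent D :=
  ⟨h.skeleton_eq, fun _ _ _ => ⟨h.symm.isVStructure_of, h.isVStructure_of⟩⟩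

theorem Equivalent.symm {D D' : DAG V} (h : D.Equivalent D') : D'.Equivalent D :=
  ⟨h.1.symm, fun i j k => (h.2 i j k).symm⟩

theorem Equivalent.trans {D D' D'' : DAG V} (h : D.Equivalent D') (h' : D'.Equivalent D'') :
    D.Equivalent D'' :=
  ⟨h.1.trans h'.1, fun i j k => (h.2 i j k).trans (h'.2 i j k)⟩

/-- If the equivalent DAGs `G` and `D` differ, then some edge `x → y` of `G` that is reversed in
`D` is covered in `G`. It is found by taking `y` minimal, in the order of `G`, among the heads of
reversed edges, and `x` maximal among the tails of the reversed edges into `y`. -/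
theorem Equivalent.exists_covered [Finite V] {G D : DAG V} (h : G.Equivalent D) {u v : V}
    (huv : G.edge u v) (hvu : D.edge v u) :
    ∃ x y, G.edge x y ∧ D.edge y x ∧ ∀ z, z ≠ x → (G.edge z y ↔ G.edge z x) := by
  have hirr : Std.Irrefl (Relation.TransGen G.edge) := ⟨G.acyclic⟩
  have hwf : WellFounded (Relation.TransGen G.edge) :=
    Finite.wellFounded_of_trans_of_irrefl _
  have hirr' : Std.Irrefl (Function.swap (Relation.TransGen G.edge)) := ⟨G.acyclic⟩
  have htr' : IsTrans V (Function.swap (Relation.TransGen G.edge)) := ⟨fun _ _ _ h h' => h'.trans h⟩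
  have hwf' : WellFounded (Function.swap (Relation.TransGen G.edge)) :=
    Finite.wellFounded_of_trans_of_irrefl _
  have hadj : ∀ {a b}, G.skeleton.Adj a b ↔ D.skeleton.Adj a b := by rw [h.1]
  obtain ⟨y, ⟨x', hx'y, hyx'⟩, hy⟩ := hwf.has_min {y | ∃ x, G.edge x y ∧ D.edge y x} ⟨v, u, huv, hvu⟩
  obtain ⟨x, ⟨hxy, hyx⟩, hx⟩ := hwf'.has_min {x | G.edge x y ∧ D.edge y x} ⟨x', hx'y, hyx'⟩
  have before : ∀ {w z}, Relation.TransGen G.edge w y → G.edge z w → D.edge z w := by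
    intro w z hwy hzw
    rcases hadj.1 (Or.inl hzw : G.skeleton.Adj z w) with h' | h'
    · exact h'
    · exact absurd hwy (hy w ⟨z, hzw, h'⟩)
  refine ⟨x, y, hxy, hyx, fun z hzx => ⟨fun hzy => ?_, fun hzx' => ?_⟩⟩
  · by_cases ha : G.skeleton.Adj z x
    · refine ha.resolve_right fun hxz => ?_
      rcases hadj.1 (Or.inl hzy : G.skeleton.Adj z y) with h' | h'
      · have hDxz := before (.single hzy) hxz
        exact D.acyclic x (((Relation.TransGen.single hDxz).tail h').tail hyx)
      · exact hx z ⟨hzy, h'⟩ (.single hxz)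
    · have := ((h.2 z y x).1 ⟨hzy, hxy, hzx, ha⟩).2.1
      exact absurd this (D.not_edge_of_edge hyx)
  · have hDzx := before (.single hxy) hzx'
    by_cases ha : G.skeleton.Adj z y
    · refine ha.resolve_right fun hyz => ?_
      exact G.acyclic x (((Relation.TransGen.single hxy).tail hyz).tail hzx')
    · have hzy : z ≠ y := by
        rintro rfl
        exact G.not_edge_of_edge hxy hzx'
      have := ((h.2 z x y).2 ⟨hDzx, hyx, hzy, fun h' => ha (hadj.2 h')⟩).2.1
      exact absurd this (G.not_edge_of_edge hxy)

/-- A property that is preserved by reversals of covered edges within the equivalence class of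
`G` passes from `G` to the whole class. -/
theorem Equivalent.induction [Finite V] {G D : DAG V} (h : G.Equivalent D) {P : DAG V → Prop}
    (hG : P G) (step : ∀ D₁ D₂ x y, CoveredFlip D₁ D₂ x y → D₁.Equivalent G → P D₁ → P D₂) :
    P D := by
  suffices ∀ m : ℕ, ∀ G' : DAG V, {e : V × V | G'.edge e.1 e.2 ∧ D.edge e.2 e.1}.ncard = m →
      G'.Equivalent G → P G' → P D from this _ G rfl ⟨rfl, fun _ _ _ => Iff.rfl⟩ hG
  intro m
  induction m using Nat.strong_induction_on with
  | _ m ih =>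
    intro G' hm hGG' hP
    have hG'D := hGG'.trans h
    by_cases hrev : ∃ u v, G'.edge u v ∧ D.edge v u
    · obtain ⟨u, v, huv, hvu⟩ := hrev
      obtain ⟨x, y, hxy, hyx, hcov⟩ := hG'D.exists_covered huv hvu
      obtain ⟨G'', hflip⟩ := G'.exists_coveredFlip hxy hcov
      refine ih _ ?_ G'' rfl (hflip.equivalent.trans hGG') (step _ _ _ _ hflip hGG' hP)
      rw [← hm]
      refine Set.ncard_lt_ncard ?_ (Set.toFinite _)
      refine (Set.ssubset_iff_of_subset ?_).2 ⟨(x, y), ⟨hxy, hyx⟩, ?_⟩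
      · rintro ⟨a, b⟩ ⟨h1, h2⟩
        refine ⟨?_, h2⟩
        rcases (hflip.flip a b).1 h1 with ⟨rfl, rfl⟩ | h1
        · exact absurd h2 (D.not_edge_of_edge hyx)
        · exact h1.1
      · rintro ⟨h1, -⟩
        rcases (hflip.flip x y).1 h1 with ⟨h1, -⟩ | h1
        · exact G'.ne_of_edge hxy h1
        · exact h1.2 ⟨rfl, rfl⟩
    · push Not at hrev
      have hadj : ∀ {a b}, G'.skeleton.Adj a b ↔ D.skeleton.Adj a b := by rw [hG'D.1]
      have : G' = D := by
        refine ext_edge fun a b => ⟨fun hab => ?_, fun hab => ?_⟩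
        · exact (hadj.1 (Or.inl hab)).resolve_right (hrev a b hab)
        · refine (hadj.2 (Or.inl hab)).resolve_right fun hba => hrev b a hba hab
      exact this ▸ hP

end DAG

end PCDAG

namespace PCDAG

/-! ### Residual vectors and conditional covariances -/

section LinearAlgebra

variable {V : Type*} [Fintype V]

/-- The bilinear form `uᵀ T w` of the matrix `T`. For a covariance matrix `T` it is the covariance
of the linear functionals with coefficient vectors `u` and `w`. -/
def form (T : Matrix V V ℝ) (u w : V → ℝ) : ℝ := u ⬝ᵥ T *ᵥ w

theorem form_comm {T : Matrix V V ℝ} (hT : T.IsSymm) (u w : V → ℝ) : form T u w = form T w u := by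
  rw [form, form, dotProduct_mulVec, ← mulVec_transpose, hT.eq, dotProduct_comm]

theorem form_add_left (T : Matrix V V ℝ) (u u' w : V → ℝ) :
    form T (u + u') w = form T u w + form T u' w := add_dotProduct _ _ _

theorem form_add_right (T : Matrix V V ℝ) (u w w' : V → ℝ) :
    form T u (w + w') = form T u w + form T u w' := by
  simp [form, mulVec_add, dotProduct_add]

theorem form_smul_left (T : Matrix V V ℝ) (c : ℝ) (u w : V → ℝ) :
    form T (c • u) w = c * form T u w := by simp [form]

theorem form_smul_right (T : Matrix V V ℝ) (c : ℝ) (u w : V → ℝ) :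
    form T u (c • w) = c * form T u w := by simp [form, mulVec_smul]

theorem form_sub_left (T : Matrix V V ℝ) (u u' w : V → ℝ) :
    form T (u - u') w = form T u w - form T u' w := sub_dotProduct _ _ _

theorem form_sub_right (T : Matrix V V ℝ) (u w w' : V → ℝ) :
    form T u (w - w') = form T u w - form T u w' := by
  simp [form, mulVec_sub, dotProduct_sub]

/-- The Cauchy-Schwarz inequality. -/
theorem form_sq_le {T : Matrix V V ℝ} (hT : T.IsSymm) {u w : V → ℝ}
    (h : ∀ c : ℝ, 0 ≤ form T (u + c • w) (u + c • w)) :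
    form T u w ^ 2 ≤ form T u u * form T w w := by
  have := discrim_le_zero (a := form T w w) (b := 2 * form T u w) (c := form T u u) fun c => by
    have := h c
    simp only [form_add_left, form_add_right, form_smul_left, form_smul_right,
      form_comm hT w u] at this
    linarith
  rw [discrim] at this
  linarith

/-- The vector `w` has its support in `K`. -/
def SupportedOn (K : Finset V) (w : V → ℝ) : Prop := ∀ v ∉ K, w v = 0

theorem form_eq_zero_of_supportedOn {T : Matrix V V ℝ} {K : Finset V} {a w : V → ℝ}
    (ha : SupportedOn K a) (hw : ∀ k ∈ K, (T *ᵥ w) k = 0) : form T a w = 0 :=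
  Finset.sum_eq_zero fun v _ => by
    by_cases hv : v ∈ K
    · simp [hw v hv]
    · simp [ha v hv]

/-- The form of `T` is positive definite on the vectors supported in `K`. -/
def PosDefOn (T : Matrix V V ℝ) (K : Finset V) : Prop :=
  ∀ w, SupportedOn K w → w ≠ 0 → 0 < form T w w

theorem PosDefOn.mono {T : Matrix V V ℝ} {K L : Finset V} (h : PosDefOn T L) (hKL : K ⊆ L) :
    PosDefOn T K := fun w hw => h w fun v hv => hw v fun hv' => hv (hKL hv')

theorem posDefOn_of_posDef {T : Matrix V V ℝ} (h : T.PosDef) (K : Finset V) : PosDefOn T K :=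
  fun w _ hw => by simpa [form] using h.dotProduct_mulVec_pos hw

omit [Fintype V] in
theorem isSymm_of_posDef {T : Matrix V V ℝ} (h : T.PosDef) : T.IsSymm := by
  have := h.isHermitian
  rwa [IsHermitian, conjTranspose_eq_transpose_of_trivial] at this

variable [DecidableEq V]

/-- The vector on `V` that extends a vector on `K` by zero. -/
def extendZero (K : Finset V) (f : K → ℝ) : V → ℝ := fun v => if h : v ∈ K then f ⟨v, h⟩ else 0

omit [Fintype V] in
theorem supportedOn_extendZero (K : Finset V) (f : K → ℝ) : SupportedOn K (extendZero K f) :=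
  fun v hv => by simp [extendZero, hv]

theorem extendZero_dotProduct (K : Finset V) (f : K → ℝ) (g : V → ℝ) :
    extendZero K f ⬝ᵥ g = f ⬝ᵥ fun k : K => g k := by
  simp only [dotProduct]
  rw [← Finset.sum_subset (Finset.subset_univ K) (fun v _ hv => by simp [extendZero, hv]),
    ← Finset.sum_coe_sort]
  exact Finset.sum_congr rfl fun k _ => by simp [extendZero]

/-- The principal submatrix `T_{K,K}`. -/
abbrev princ (T : Matrix V V ℝ) (K : Finset V) : Matrix K K ℝ :=
  T.submatrix (Subtype.val : K → V) (Subtype.val : K → V)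

theorem mulVec_extendZero (T : Matrix V V ℝ) (K : Finset V) (f : K → ℝ) (k : K) :
    (T *ᵥ extendZero K f) k = (princ T K *ᵥ f) k := by
  rw [mulVec, dotProduct_comm, extendZero_dotProduct, dotProduct_comm]
  rfl

theorem PosDefOn.posDef_princ {T : Matrix V V ℝ} (hT : T.IsSymm) {K : Finset V}
    (hK : PosDefOn T K) : (princ T K).PosDef := by
  refine PosDef.of_dotProduct_mulVec_pos ?_ fun f hf => ?_
  · rw [IsHermitian, conjTranspose_eq_transpose_of_trivial, transpose_submatrix, hT.eq]
  · have := hK _ (supportedOn_extendZero K f) fun h => hf <| by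
      funext k
      simpa [extendZero] using congrFun h k
    rw [form, extendZero_dotProduct] at this
    simpa [mulVec_extendZero, star_trivial] using this

theorem PosDefOn.isUnit_det_princ {T : Matrix V V ℝ} (hT : T.IsSymm) {K : Finset V}
    (hK : PosDefOn T K) : IsUnit (princ T K).det :=
  (isUnit_iff_isUnit_det _).1 (hK.posDef_princ hT).isUnit

/-- The coefficient vector of the residual in the regression of the variable `i` on the variables
in `K`. -/
noncomputable def resVec (T : Matrix V V ℝ) (i : V) (K : Finset V) : V → ℝ :=
  Pi.single i 1 - extendZero K (regCoef T i K)

/-- `w` is a vector whose functional differs from the variable `i` by a combination of the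
variables in `K` and is uncorrelated with these. -/
structure IsResidual (T : Matrix V V ℝ) (i : V) (K : Finset V) (w : V → ℝ) : Prop where
  supp : SupportedOn K (w - Pi.single i 1)
  orth : ∀ k ∈ K, (T *ᵥ w) k = 0

theorem isResidual_resVec {T : Matrix V V ℝ} (hT : T.IsSymm) {K : Finset V} (hK : PosDefOn T K)
    (i : V) : IsResidual T i K (resVec T i K) := by
  refine ⟨fun v hv => ?_, fun k hk => ?_⟩
  · simp [resVec, supportedOn_extendZero K (regCoef T i K) v hv]
  · have h1 : (T *ᵥ extendZero K (regCoef T i K)) k = T i k := by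
      rw [mulVec_extendZero T K (regCoef T i K) ⟨k, hk⟩, regCoef]
      have h2 : (princ T K)ᵀ = princ T K := by rw [transpose_submatrix, hT.eq]
      rw [← h2, mulVec_transpose, vecMul_vecMul]
      change (_ ᵥ* ((princ T K)⁻¹ * princ T K)) _ = _
      rw [nonsing_inv_mul _ (hK.isUnit_det_princ hT), vecMul_one]
    rw [resVec, mulVec_sub, Pi.sub_apply, h1, mulVec_single_one, col_apply, hT.apply]
    exact sub_self _

theorem IsResidual.unique {T : Matrix V V ℝ} {i : V} {K : Finset V} (hK : PosDefOn T K)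
    {w w' : V → ℝ} (h : IsResidual T i K w) (h' : IsResidual T i K w') : w = w' := by
  have hs : SupportedOn K (w - w') := fun v hv => by
    have h1 := h.supp v hv
    have h2 := h'.supp v hv
    simp only [Pi.sub_apply] at h1 h2 ⊢
    linarith
  by_contra hne
  have := hK _ hs (sub_ne_zero.2 hne)
  rw [form_eq_zero_of_supportedOn hs fun k hk => by
    rw [mulVec_sub, Pi.sub_apply, h.orth k hk, h'.orth k hk, sub_zero]] at this
  exact lt_irrefl _ this

omit [Fintype V] in
theorem resVec_ne_zero (T : Matrix V V ℝ) {i : V} {K : Finset V} (hi : i ∉ K) :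
    resVec T i K ≠ 0 := fun h => by
  have := congrFun h i
  simp [resVec, extendZero, hi] at this

theorem condCov_eq_form_single (T : Matrix V V ℝ) (i j : V) (K : Finset V) :
    condCov T i j K = form T (resVec T i K) (Pi.single j 1) := by
  rw [condCov, form, resVec, sub_dotProduct, extendZero_dotProduct]
  simp [col_apply]

theorem IsResidual.form_congr_right {T : Matrix V V ℝ} (hT : T.IsSymm) {i : V} {K : Finset V}
    {u w w' : V → ℝ} (hu : IsResidual T i K u) (hw : SupportedOn K (w - w')) :
    form T u w = form T u w' := by
  rw [← sub_eq_zero, ← form_sub_right, form_comm hT]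
  exact form_eq_zero_of_supportedOn hw hu.orth

theorem condCov_eq_form {T : Matrix V V ℝ} (hT : T.IsSymm) {K : Finset V} (hK : PosDefOn T K)
    (i j : V) : condCov T i j K = form T (resVec T i K) (resVec T j K) := by
  rw [condCov_eq_form_single]
  refine ((isResidual_resVec hT hK i).form_congr_right hT ?_).symm
  exact (isResidual_resVec hT hK j).supp

theorem condCov_comm {T : Matrix V V ℝ} (hT : T.IsSymm) {K : Finset V} (hK : PosDefOn T K)
    (i j : V) : condCov T i j K = condCov T j i K := by
  rw [condCov_eq_form hT hK, condCov_eq_form hT hK, form_comm hT]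

theorem condVar_eq_form {T : Matrix V V ℝ} (hT : T.IsSymm) {K : Finset V} (hK : PosDefOn T K)
    (i : V) : condVar T i K = form T (resVec T i K) (resVec T i K) := condCov_eq_form hT hK i i

/-- The part of the covariance of the functionals `u` and `t` that is explained by the variables
in `K`. -/
noncomputable def explained (T : Matrix V V ℝ) (K : Finset V) (u t : V → ℝ) : ℝ :=
  (fun k : K => (T *ᵥ u) k) ⬝ᵥ (princ T K)⁻¹ *ᵥ fun k : K => (T *ᵥ t) k

/-- The conditional covariance does not change when combinations of the variables in `K` are added
to the variables `i` and `j`. -/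
theorem condCov_eq_form_sub_explained {T : Matrix V V ℝ} (hT : T.IsSymm) {K : Finset V}
    (hK : PosDefOn T K) {i j : V} {u t : V → ℝ} (hu : SupportedOn K (u - Pi.single i 1))
    (ht : SupportedOn K (t - Pi.single j 1)) :
    condCov T i j K = form T u t - explained T K u t := by
  have hi := isResidual_resVec hT hK i
  have hj := isResidual_resVec hT hK j
  set b := extendZero K ((princ T K)⁻¹ *ᵥ fun k : K => (T *ᵥ t) k) with hb
  have hres : IsResidual T j K (t - b) := by
    refine ⟨fun v hv => ?_, fun k hk => ?_⟩
    · have h1 := ht v hv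
      have h2 := supportedOn_extendZero K ((princ T K)⁻¹ *ᵥ fun k : K => (T *ᵥ t) k) v hv
      simp only [Pi.sub_apply] at h1 ⊢
      linarith
    · rw [mulVec_sub, Pi.sub_apply, mulVec_extendZero T K _ ⟨k, hk⟩, mulVec_mulVec,
        mul_nonsing_inv _ (hK.isUnit_det_princ hT), one_mulVec, sub_self]
  have hE : explained T K u t = form T u b := by
    rw [form_comm hT, form, hb, extendZero_dotProduct, dotProduct_comm]
    rfl
  rw [condCov_eq_form hT hK, hres.unique hK hj |>.symm, hE, ← form_sub_right, form_comm hT,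
    form_comm hT u]
  refine hres.form_congr_right hT fun v hv => ?_
  have h1 := hu v hv
  have h2 := hi.supp v hv
  simp only [Pi.sub_apply] at h1 h2 ⊢
  linarith

theorem explained_sq_le {T : Matrix V V ℝ} (hT : T.IsSymm) {K : Finset V}
    (hK : PosDefOn T K) (u t : V → ℝ) :
    explained T K u t ^ 2 ≤ explained T K u u * explained T K t t := by
  have hM := (hK.posDef_princ hT).inv
  exact form_sq_le (isSymm_of_posDef hM) fun c => by
    have := hM.posSemidef.dotProduct_mulVec_nonneg
      ((fun k : K => (T *ᵥ u) k) + c • fun k : K => (T *ᵥ t) k)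
    rwa [star_trivial] at this

theorem condVar_nonneg {T : Matrix V V ℝ} (hT : T.IsSymm) {K : Finset V} (hK : PosDefOn T K)
    {i : V} (h : PosDefOn T (insert i K)) : 0 ≤ condVar T i K := by
  rw [condVar_eq_form hT hK]
  rcases eq_or_ne (resVec T i K) 0 with h0 | h0
  · rw [h0, form, zero_dotProduct]
  · refine (h _ (fun v hv => ?_) h0).le
    rw [Finset.mem_insert, not_or] at hv
    simpa [hv.1] using (isResidual_resVec hT hK i).supp v hv.2

theorem condVar_pos {T : Matrix V V ℝ} (hT : T.IsSymm) {K : Finset V} {i : V}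
    (h : PosDefOn T (insert i K)) (hi : i ∉ K) : 0 < condVar T i K := by
  have hK := h.mono (Finset.subset_insert i K)
  rw [condVar_eq_form hT hK]
  refine h _ (fun v hv => ?_) (resVec_ne_zero T hi)
  rw [Finset.mem_insert, not_or] at hv
  simpa [hv.1] using (isResidual_resVec hT hK i).supp v hv.2

/-- Positive definiteness is inherited by a further variable whose conditional variance is
positive. -/
theorem PosDefOn.insert {T : Matrix V V ℝ} (hT : T.IsSymm) {K : Finset V} (hK : PosDefOn T K)
    {i : V} (hi : i ∉ K) (hv : 0 < condVar T i K) : PosDefOn T (insert i K) := by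
  intro w hw hw0
  have hr := isResidual_resVec hT hK i
  set y := w - w i • resVec T i K with hy
  have hri : resVec T i K i = 1 := by simp [resVec, extendZero, hi]
  have hys : SupportedOn K y := by
    intro v hv
    by_cases hvi : v = i
    · subst hvi
      simp [hy, hri]
    · have h1 := hw v (by simp [hvi, hv])
      have h2 := hr.supp v hv
      simp only [Pi.sub_apply, Pi.single_eq_of_ne hvi, sub_zero] at h2
      simp [hy, h1, h2]
  have hdec : w = y + w i • resVec T i K := by simp [hy]
  have hcross : form T y (resVec T i K) = 0 := form_eq_zero_of_supportedOn hys hr.orth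
  have hform : form T w w = form T y y + w i ^ 2 * condVar T i K := by
    rw [condVar_eq_form hT hK]
    conv_lhs => rw [hdec]
    simp only [form_add_left, form_add_right, form_smul_left, form_smul_right,
      form_comm hT _ y, hcross]
    ring
  rw [hform]
  by_cases hwi : w i = 0
  · have hwy : w = y := by rw [hdec]; simp [hwi]
    rw [hwi]
    simpa [← hwy] using hK w (hwy ▸ hys) hw0
  · have h1 : 0 ≤ form T y y := by
      rcases eq_or_ne y 0 with h0 | h0
      · rw [h0, form, zero_dotProduct]
      · exact (hK y hys h0).le
    have h2 : 0 < w i ^ 2 := by positivity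
    positivity

/-- If all conditional variances given at most `q` variables are positive, then all principal
submatrices of size at most `q + 1` are positive definite. -/
theorem posDefOn_of_condVar_pos {T : Matrix V V ℝ} (hT : T.IsSymm) {q : ℕ}
    (h : ∀ i (K : Finset V), i ∉ K → K.card ≤ q → PosDefOn T K → 0 < condVar T i K)
    (K : Finset V) (hK : K.card ≤ q + 1) : PosDefOn T K := by
  induction K using Finset.induction_on with
  | empty => exact fun w hw hw0 => absurd (funext fun v => hw v (Finset.notMem_empty v)) hw0
  | insert i K hi ih =>
    rw [Finset.card_insert_of_notMem hi] at hK
    have := ih (by omega)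
    exact this.insert hT hi (h i K hi (by omega) this)

/-- Passing from `K` to `K ∪ {x}` subtracts the regression on the residual of `x`. -/
theorem resVec_insert {T : Matrix V V ℝ} (hT : T.IsSymm) {K : Finset V} {x y : V}
    (h : PosDefOn T (insert x K)) (hx : x ∉ K) :
    resVec T y (insert x K) =
      resVec T y K - (condCov T x y K / condVar T x K) • resVec T x K := by
  have hK := h.mono (Finset.subset_insert x K)
  have hxr := isResidual_resVec hT hK x
  have hyr := isResidual_resVec hT hK y
  refine (isResidual_resVec hT h y).unique h ⟨fun v hv => ?_, fun k hk => ?_⟩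
  · rw [Finset.mem_insert, not_or] at hv
    have h1 := hxr.supp v hv.2
    have h2 := hyr.supp v hv.2
    simp only [Pi.sub_apply, Pi.single_eq_of_ne hv.1, sub_zero] at h1
    simp only [Pi.sub_apply] at h2
    simp only [Pi.sub_apply, Pi.smul_apply, h1, smul_zero, sub_zero]
    exact h2
  · rw [mulVec_sub, mulVec_smul, Pi.sub_apply, Pi.smul_apply]
    rcases Finset.mem_insert.1 hk with rfl | hk
    · have hval : ∀ j, (T *ᵥ resVec T j K) k = condCov T j k K := fun j => by
        rw [condCov_eq_form_single, form_comm hT, form, single_one_dotProduct]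
      rw [hval, hval, smul_eq_mul, condCov_comm hT hK y, ← condVar,
        div_mul_cancel₀ _ (condVar_pos hT h hx).ne', sub_self]
    · rw [hxr.orth k hk, hyr.orth k hk, smul_zero, sub_zero]

theorem condCov_insert {T : Matrix V V ℝ} (hT : T.IsSymm) {K : Finset V} {x y : V}
    (h : PosDefOn T (insert x K)) (hx : x ∉ K) (z : V) :
    condCov T y z (insert x K) =
      condCov T y z K - condCov T x y K / condVar T x K * condCov T x z K := by
  rw [condCov_eq_form_single, resVec_insert hT h hx, form_sub_left, form_smul_left,
    ← condCov_eq_form_single, ← condCov_eq_form_single]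

theorem condVar_insert {T : Matrix V V ℝ} (hT : T.IsSymm) {K : Finset V} {x y : V}
    (h : PosDefOn T (insert x K)) (hx : x ∉ K) :
    condVar T y (insert x K) = condVar T y K - condCov T x y K ^ 2 / condVar T x K := by
  rw [condVar, condCov_insert hT h hx, ← condVar]
  ring

omit [Fintype V] in
theorem resVec_apply_of_mem (T : Matrix V V ℝ) {i l : V} {K : Finset V} (hi : i ∈ K)
    (hl : l ∉ K) : resVec T l K i = - regCoef T l K ⟨i, hi⟩ := by
  have : i ≠ l := by rintro rfl; exact hl hi
  simp [resVec, extendZero, hi, this]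

/-- A regression coefficient is the quotient of the conditional covariance and the conditional
variance given the other regressors. -/
theorem resVec_apply_of_mem_eq_div {T : Matrix V V ℝ} (hT : T.IsSymm) {K : Finset V} {i l : V}
    (hK : PosDefOn T K) (hi : i ∈ K) (hl : l ∉ K) :
    resVec T l K i = - (condCov T i l (K.erase i) / condVar T i (K.erase i)) := by
  have hne : i ≠ l := by rintro rfl; exact hl hi
  conv_lhs => rw [← Finset.insert_erase hi]
  rw [resVec_insert hT (by rwa [Finset.insert_erase hi]) (Finset.notMem_erase i K)]
  simp [resVec, extendZero, hne]

/-! ### The concentration matrix of a DAG -/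

theorem regMatrix_apply (T : Matrix V V ℝ) (D : DAG V) (i j : V) :
    regMatrix T D i j = resVec T i (D.parents i) j := by
  rw [regMatrix, of_apply]
  split_ifs with h1 h2
  · rw [resVec_apply_of_mem T h1 (D.self_notMem_parents i)]
  · subst h2
    simp [resVec, extendZero, h1]
  · simp [resVec, extendZero, h1, h2]

theorem dagConcentration_apply (T : Matrix V V ℝ) (D : DAG V)
    (hv : ∀ l, condVar T l (D.parents l) ≠ 0) (i j : V) :
    dagConcentration T D i j = ∑ l, resVec T l (D.parents l) i * resVec T l (D.parents l) j /
      condVar T l (D.parents l) := by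
  have hinv : (errorCov T D)⁻¹ = diagonal fun l => (condVar T l (D.parents l))⁻¹ := by
    refine inv_eq_right_inv ?_
    rw [errorCov, diagonal_mul_diagonal]
    simp [hv]
  rw [dagConcentration, hinv, Matrix.mul_apply]
  refine Finset.sum_congr rfl fun l _ => ?_
  rw [mul_diagonal, transpose_apply, regMatrix_apply, regMatrix_apply]
  ring

theorem DAG.CoveredFlip.parents_left {D D' : DAG V} {x y : V} (h : D.CoveredFlip D' x y) :
    D.parents y = insert x (D.parents x) ∧ D'.parents x = insert y (D.parents x) ∧
      D'.parents y = D.parents x ∧ ∀ l, l ≠ x → l ≠ y → D'.parents l = D.parents l := by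
  have hxx : ¬ D.edge x x := fun h => D.ne_of_edge h rfl
  have hne := D.ne_of_edge h.edge
  have hyx := D.not_edge_of_edge h.edge
  have hxy := h.edge
  refine ⟨?_, ?_, ?_, fun l hlx hly => ?_⟩
  · ext z
    rw [Finset.mem_insert, DAG.mem_parents, DAG.mem_parents]
    by_cases hz : z = x
    · simp [hz, hxy]
    · simp [hz, h.covered z hz]
  · ext z
    rw [Finset.mem_insert, DAG.mem_parents, DAG.mem_parents, h.flip]
    tauto
  · ext z
    rw [DAG.mem_parents, DAG.mem_parents, h.flip]
    by_cases hz : z = x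
    · subst hz
      tauto
    · have := h.covered z hz
      tauto
  · ext z
    rw [DAG.mem_parents, DAG.mem_parents, h.flip]
    tauto

/-- The reversal of a covered edge `x → y` does not change the concentration matrix: the summands
of `x` and `y` together depend on the pair of residuals of `x` and `y` given their common parents
only through the inverse of its covariance matrix, which is symmetric in `x` and `y`. -/
theorem DAG.CoveredFlip.dagConcentration_eq {T : Matrix V V ℝ} (hT : T.IsSymm) {D D' : DAG V}
    {x y : V} (h : D.CoveredFlip D' x y)
    (hD : ∀ l, PosDefOn T (insert l (D.parents l)))
    (hD' : ∀ l, PosDefOn T (insert l (D'.parents l))) :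
    dagConcentration T D' = dagConcentration T D := by
  obtain ⟨hy, hx', hy', hl⟩ := h.parents_left
  have hne : x ≠ y := D.ne_of_edge h.edge
  have hv : ∀ l, condVar T l (D.parents l) ≠ 0 := fun l =>
    (condVar_pos hT (hD l) (D.self_notMem_parents l)).ne'
  have hv' : ∀ l, condVar T l (D'.parents l) ≠ 0 := fun l =>
    (condVar_pos hT (hD' l) (D'.self_notMem_parents l)).ne'
  ext i j
  rw [dagConcentration_apply T D' hv', dagConcentration_apply T D hv,
    ← Finset.add_sum_erase _ _ (Finset.mem_univ x), ← Finset.add_sum_erase _ _ (Finset.mem_univ x),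
    ← Finset.add_sum_erase _ _ (Finset.mem_erase.2 ⟨hne.symm, Finset.mem_univ y⟩),
    ← Finset.add_sum_erase _ _ (Finset.mem_erase.2 ⟨hne.symm, Finset.mem_univ y⟩),
    ← add_assoc, ← add_assoc]
  congr 1
  swap
  · refine Finset.sum_congr rfl fun l hlm => ?_
    rw [Finset.mem_erase, Finset.mem_erase] at hlm
    rw [hl l hlm.2.1 hlm.1]
  have hxQ : x ∉ D.parents x := D.self_notMem_parents x
  have hyQ : y ∉ D.parents x := by
    have := D'.self_notMem_parents y
    rwa [hy'] at this
  have hPx := hD x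
  have hPy : PosDefOn T (insert y (D.parents x)) := by have := hD' y; rwa [hy'] at this
  have hQ := hPx.mono (Finset.subset_insert _ _)
  have hvy := hv y
  have hvx' := hv' x
  have ha := (condVar_pos hT hPx hxQ).ne'
  have hd := (condVar_pos hT hPy hyQ).ne'
  rw [hy] at hvy
  rw [hx'] at hvx'
  rw [hx', hy', hy, resVec_insert hT hPx hxQ, resVec_insert hT hPy hyQ]
  rw [condVar_insert hT hPx hxQ] at hvy ⊢
  rw [condVar_insert hT hPy hyQ] at hvx' ⊢
  rw [condCov_comm hT hQ y x] at hvx' ⊢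
  simp only [Pi.sub_apply, Pi.smul_apply, smul_eq_mul]
  generalize condCov T x y (D.parents x) = c at *
  generalize condVar T x (D.parents x) = A at *
  generalize condVar T y (D.parents x) = B at *
  have h1 : A * B - c ^ 2 ≠ 0 := fun h0 => hvy (by field_simp; linarith)
  have h2 : A - c ^ 2 / B = (A * B - c ^ 2) / B := by field_simp
  have h3 : B - c ^ 2 / A = (A * B - c ^ 2) / A := by field_simp
  rw [h2, h3]
  generalize hE : A * B - c ^ 2 = E at *
  field_simp
  linear_combination (B * resVec T x (D.parents x) i * resVec T x (D.parents x) j -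
    A * resVec T y (D.parents x) i * resVec T y (D.parents x) j) * hE

end LinearAlgebra

end PCDAG

namespace PCDAG

/-! ### Conditional independence of Gaussian variables -/

section CondIndep

variable {Ω β γ δ γ' : Type*} [MeasurableSpace Ω] [MeasurableSpace β] [MeasurableSpace γ]
  [MeasurableSpace δ] [MeasurableSpace γ']

/-- If `e` is independent of `U`, the conditional distribution of `F (φ U) e` given `U` is obtained
by inserting the value of `U` and integrating over the law of `e`. -/
theorem condDistrib_comp_of_indepFun [StandardBorelSpace β] [Nonempty β] {μ : Measure Ω}
    [IsProbabilityMeasure μ] {U : Ω → γ'} {e : Ω → δ} {φ : γ' → γ} {F : γ × δ → β}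
    (hU : Measurable U) (he : Measurable e) (hφ : Measurable φ) (hF : Measurable F)
    (hind : IndepFun U e μ) :
    condDistrib (fun ω => F (φ (U ω), e ω)) U μ =ᵐ[μ.map U]
      (((Kernel.id ×ₖ Kernel.const γ (μ.map e)).map F).comap φ hφ : Kernel γ' β) := by
  have hp : IsProbabilityMeasure (μ.map e) := Measure.isProbabilityMeasure_map he.aemeasurable
  have hk : IsMarkovKernel ((Kernel.id ×ₖ Kernel.const γ (μ.map e)).map F) :=
    Kernel.IsMarkovKernel.map _ hF
  refine condDistrib_ae_eq_of_measure_eq_compProd U (by fun_prop) ?_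
  refine Measure.ext_prod fun {s t} hs ht => ?_
  rw [Measure.compProd_apply_prod hs ht, Measure.map_apply (by fun_prop) (hs.prod ht)]
  have h1 : (fun ω => (U ω, F (φ (U ω), e ω))) ⁻¹' (s ×ˢ t) =
      (fun ω => (U ω, e ω)) ⁻¹' ((s ×ˢ Set.univ) ∩ (fun z : γ' × δ => F (φ z.1, z.2)) ⁻¹' t) := by
    ext ω
    simp
  have hm : MeasurableSet ((s ×ˢ Set.univ) ∩ (fun z : γ' × δ => F (φ z.1, z.2)) ⁻¹' t) :=
    (hs.prod MeasurableSet.univ).inter ((by fun_prop : Measurable _) ht)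
  rw [h1, ← Measure.map_apply (by fun_prop) hm,
    (indepFun_iff_map_prod_eq_prod_map_map hU.aemeasurable he.aemeasurable).1 hind,
    Measure.prod_apply hm, ← lintegral_indicator hs]
  refine lintegral_congr fun u => ?_
  by_cases hu : u ∈ s
  · rw [Set.indicator_of_mem hu, Kernel.comap_apply, Kernel.map_apply' _ hF _ ht,
      Kernel.prod_apply' _ _ _ (hF ht), Kernel.id_apply,
      lintegral_dirac' _ (measurable_measure_prodMk_left (hF ht)), Kernel.const_apply]
    congr 1
    ext y
    simp [hu]
  · rw [Set.indicator_of_notMem hu]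
    simp [hu]

/-- If `e` is independent of `(k, g)`, then `g` and any function of `k` and `e` are conditionally
independent given `k`. -/
theorem condIndepFun_of_indepFun_prod [StandardBorelSpace Ω] [StandardBorelSpace β] [Nonempty β]
    [StandardBorelSpace γ'] [Nonempty γ'] {μ : Measure Ω}
    [IsProbabilityMeasure μ] {k : Ω → γ} {g : Ω → γ'} {e : Ω → δ} {F : γ × δ → β}
    (hk : Measurable k) (hg : Measurable g) (he : Measurable e) (hF : Measurable F)
    (hind : IndepFun (fun ω => (k ω, g ω)) e μ) :
    CondIndepFun (MeasurableSpace.comap k inferInstance) hk.comap_le g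
      (fun ω => F (k ω, e ω)) μ := by
  rw [condIndepFun_iff_condDistrib_prod_ae_eq_prodMkRight (by fun_prop) hg hk]
  have h1 := condDistrib_comp_of_indepFun (φ := Prod.fst) (hk.prodMk hg) he measurable_fst hF hind
  have h2 := condDistrib_comp_of_indepFun (φ := id) hk he measurable_id hF
    (hind.comp measurable_fst measurable_id)
  have h3 : ∀ᵐ z ∂μ.map (fun ω => (k ω, g ω)), condDistrib (fun ω => F (k ω, e ω)) k μ z.1 =
      (((Kernel.id ×ₖ Kernel.const γ (μ.map e)).map F).comap id measurable_id : Kernel γ β) z.1 := by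
    have : μ.map k = (μ.map (fun ω => (k ω, g ω))).map Prod.fst := by
      rw [Measure.map_map measurable_fst (by fun_prop)]
      rfl
    rw [this] at h2
    exact ae_of_ae_map measurable_fst.aemeasurable h2
  filter_upwards [h1, h3] with z hz1 hz3
  rw [hz1, Kernel.prodMkRight_apply, hz3]
  rfl

/-- If `f` and `g` are conditionally independent given `k`, then `g` does not contribute to the
conditional expectation of `f` given `(k, g)`. -/
theorem condExp_prod_eq_of_condIndepFun [StandardBorelSpace Ω] [StandardBorelSpace γ'] [Nonempty γ']
    {μ : Measure Ω} [IsProbabilityMeasure μ] {k : Ω → γ} {g : Ω → γ'} {f : Ω → ℝ}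
    (hk : Measurable k) (hg : Measurable g) (hf : Measurable f) (hfi : Integrable f μ)
    (h : CondIndepFun (MeasurableSpace.comap k inferInstance) hk.comap_le g f μ) :
    μ[f | MeasurableSpace.comap (fun ω => (k ω, g ω)) inferInstance] =ᵐ[μ]
      μ[f | MeasurableSpace.comap k inferInstance] := by
  rw [condIndepFun_iff_condDistrib_prod_ae_eq_prodMkRight hf hg hk] at h
  have h1 := condExp_ae_eq_integral_condDistrib' (hk.prodMk hg) hfi
  have h2 := condExp_ae_eq_integral_condDistrib' hk hfi
  have h3 := ae_of_ae_map (hk.prodMk hg).aemeasurable h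
  filter_upwards [h1, h2, h3] with ω h1 h2 h3
  rw [h1, h2, h3, Kernel.prodMkRight_apply]

end CondIndep

section Gaussian

variable {V : Type*} [Fintype V]

/-- The linear functional with coefficient vector `w`. -/
def lin (w : V → ℝ) (x : EuclideanSpace ℝ V) : ℝ := ∑ v, w v * x v

@[fun_prop]
theorem measurable_lin (w : V → ℝ) : Measurable (lin w) := by
  unfold lin
  fun_prop

/-- Several linear functionals, as one continuous linear map. -/
noncomputable def linMap {ι : Type*} (a : ι → V → ℝ) : EuclideanSpace ℝ V →L[ℝ] (ι → ℝ) :=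
  ContinuousLinearMap.pi fun i => ∑ v, a i v • EuclideanSpace.proj v

theorem linMap_apply {ι : Type*} (a : ι → V → ℝ) (x : EuclideanSpace ℝ V) :
    linMap a x = fun i => lin (a i) x := by
  ext i
  simp [linMap, lin]

theorem lin_add (u w : V → ℝ) (x : EuclideanSpace ℝ V) : lin (u + w) x = lin u x + lin w x := by
  simp [lin, add_mul, Finset.sum_add_distrib]

theorem lin_sub (u w : V → ℝ) (x : EuclideanSpace ℝ V) : lin (u - w) x = lin u x - lin w x := by
  simp [lin, sub_mul, Finset.sum_sub_distrib]

theorem lin_smul (c : ℝ) (w : V → ℝ) (x : EuclideanSpace ℝ V) : lin (c • w) x = c * lin w x := by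
  simp [lin, mul_assoc, Finset.mul_sum]

variable [DecidableEq V]

theorem lin_single (i : V) (x : EuclideanSpace ℝ V) : lin (Pi.single i 1) x = x i := by
  simp [lin, Pi.single_apply]

theorem lin_extendZero (K : Finset V) (f : K → ℝ) (x : EuclideanSpace ℝ V) :
    lin (extendZero K f) x = ∑ k : K, f k * x k := extendZero_dotProduct K f _

theorem covariance_lin {S : Matrix V V ℝ} (hS : S.PosDef) (u w : V → ℝ) :
    cov[lin u, lin w; multivariateGaussian 0 S] = form S u w := by
  have h (u : V → ℝ) : lin u = fun x => inner ℝ (WithLp.toLp 2 u) x := by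
    ext x
    simp [lin, PiLp.inner_apply, mul_comm]
  rw [h u, h w, ← covarianceBilin_apply_eq_cov IsGaussian.memLp_two_id,
    covarianceBilin_multivariateGaussian hS.posSemidef]
  rfl

theorem integral_lin (S : Matrix V V ℝ) (w : V → ℝ) :
    ∫ x, lin w x ∂(multivariateGaussian 0 S) = 0 := by
  have h : lin w = fun x => inner ℝ (WithLp.toLp 2 w) x := by
    ext x
    simp [lin, PiLp.inner_apply, mul_comm]
  rw [h, integral_inner IsGaussian.integrable_fun_id]
  simp

theorem hasGaussianLaw_lin (S : Matrix V V ℝ) {ι : Type*} [Finite ι] (a : ι → V → ℝ) :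
    HasGaussianLaw (fun x i => lin (a i) x) (multivariateGaussian 0 S) := by
  have := Fintype.ofFinite ι
  have h := (IsGaussian.hasGaussianLaw_id (μ := multivariateGaussian 0 S)).map_fun (linMap a)
  simpa only [linMap_apply, id_eq] using h

theorem memLp_lin (S : Matrix V V ℝ) (w : V → ℝ) : MemLp (lin w) 2 (multivariateGaussian 0 S) :=
  ((hasGaussianLaw_lin S (fun _ : Unit => w)).eval ()).memLp_two

/-- Uncorrelated families of linear functionals of a Gaussian vector are independent. -/
theorem indepFun_lin {S : Matrix V V ℝ} (hS : S.PosDef) {ι κ : Type*} [Finite ι] [Finite κ]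
    (a : ι → V → ℝ) (b : κ → V → ℝ) (h : ∀ i j, form S (a i) (b j) = 0) :
    IndepFun (fun x i => lin (a i) x) (fun x j => lin (b j) x) (multivariateGaussian 0 S) := by
  have := Fintype.ofFinite ι
  have := Fintype.ofFinite κ
  refine HasGaussianLaw.indepFun_of_covariance_eval ?_ fun i j => ?_
  · have h := (IsGaussian.hasGaussianLaw_id (μ := multivariateGaussian 0 S)).map_fun
      ((linMap a).prod (linMap b))
    simpa only [ContinuousLinearMap.prod_apply, linMap_apply, id_eq] using h
  · exact (covariance_lin hS _ _).trans (h i j)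

theorem eval_eq_lin_resVec_add (S : Matrix V V ℝ) (i : V) (K : Finset V)
    (x : EuclideanSpace ℝ V) :
    x i = lin (resVec S i K) x + ∑ k : K, regCoef S i K k * x k := by
  rw [resVec, lin_sub, lin_single, lin_extendZero, sub_add_cancel]

theorem form_single_resVec {S : Matrix V V ℝ} (hS : S.PosDef) (i k : V) {K : Finset V}
    (hk : k ∈ K) : form S (Pi.single k 1) (resVec S i K) = 0 := by
  rw [form, single_one_dotProduct]
  exact (isResidual_resVec (isSymm_of_posDef hS) (posDefOn_of_posDef hS K) i).orth k hk

/-- Two components of a Gaussian vector are conditionally independent given a set of others if and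
only if their conditional covariance vanishes. -/
theorem condIndepCoords_iff {S : Matrix V V ℝ} (hS : S.PosDef) (i j : V) (K : Finset V) :
    CondIndepCoords (multivariateGaussian 0 S) {j} {i} (K : Set V) ↔ condCov S i j K = 0 := by
  set P := multivariateGaussian 0 S with hP
  have hsymm := isSymm_of_posDef hS
  have hpd := posDefOn_of_posDef hS K
  have hmi (v : V) : Measurable fun x : EuclideanSpace ℝ V => x v := by fun_prop
  have hreal : CondIndepCoords P {j} {i} (K : Set V) ↔
      CondIndepFun (MeasurableSpace.comap (coords (K : Set V)) inferInstance)
        (measurable_coords (K : Set V)).comap_le (fun x => x j) (fun x => x i) P := by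
    constructor
    · intro h
      exact h.comp (φ := fun y : ({j} : Set V) → ℝ => y ⟨j, rfl⟩)
        (ψ := fun y : ({i} : Set V) → ℝ => y ⟨i, rfl⟩) (by fun_prop) (by fun_prop)
    · intro h
      have h' := h.comp (φ := fun y : ℝ => fun _ : ({j} : Set V) => y)
        (ψ := fun y : ℝ => fun _ : ({i} : Set V) => y) (by fun_prop) (by fun_prop)
      have e (l : V) : coords ({l} : Set V) =
          (fun y : ℝ => fun _ : ({l} : Set V) => y) ∘ fun x : EuclideanSpace ℝ V => x l := by
        ext x v
        simp [coords, Set.mem_singleton_iff.1 v.2]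
      rw [CondIndepCoords, e j, e i]
      exact h'
  rw [hreal]
  -- The regression function of the variable `l`, as a function of the subvector `x_K`.
  let reg (l : V) (y : ((K : Set V) : Type _) → ℝ) : ℝ := ∑ k : K, regCoef S l K k * y k
  have hreg (l : V) : Measurable (reg l) := by fun_prop
  have hdec (l : V) (x : EuclideanSpace ℝ V) :
      x l = reg l (coords (K : Set V) x) + lin (resVec S l K) x := by
    rw [eval_eq_lin_resVec_add S l K x, add_comm]
    rfl
  have hu : Measurable fun y : Unit → ℝ => y () := measurable_pi_apply ()
  constructor
  · intro h
    have hxi : Integrable (fun x : EuclideanSpace ℝ V => x i) P := by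
      have := (memLp_lin S (Pi.single i 1)).integrable one_le_two
      rwa [funext (lin_single i)] at this
    have hce := condExp_prod_eq_of_condIndepFun (measurable_coords (K : Set V)) (hmi j) (hmi i)
      hxi h
    set m := MeasurableSpace.comap (fun x => (coords (K : Set V) x, x j)) inferInstance with hm
    have hle := ((measurable_coords (K : Set V)).prodMk (hmi j)).comap_le
    have hi1 : Integrable (fun x => reg i (coords (K : Set V) x)) P := by
      have : (fun x => reg i (coords (K : Set V) x)) =
          fun x : EuclideanSpace ℝ V => lin (extendZero K (regCoef S i K)) x := by
        funext x
        exact (lin_extendZero K _ x).symm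
      rw [this]
      exact (memLp_lin S _).integrable one_le_two
    have hi2 : Integrable (lin (resVec S i K)) P := (memLp_lin S _).integrable one_le_two
    have hindep : IndepFun (lin (resVec S i K)) (coords (K : Set V)) P := by
      have := (indepFun_lin hS (fun _ : Unit => resVec S i K)
        (fun k : K => (Pi.single k.1 1 : V → ℝ)) fun _ k => by
          rw [form_comm hsymm]; exact form_single_resVec hS i k.1 k.2).comp
        (φ := fun y : Unit → ℝ => y ()) (ψ := fun y => fun k : (K : Set V) => y k) hu
          (by fun_prop)
      simp only [Function.comp_def, lin_single] at this
      exact this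
    have hck : P[fun x => x i | MeasurableSpace.comap (coords (K : Set V)) inferInstance] =ᵐ[P]
        fun x => reg i (coords (K : Set V) x) := by
      have h0 : (fun x : EuclideanSpace ℝ V => x i) =
          (fun x => reg i (coords (K : Set V) x)) + lin (resVec S i K) := funext (hdec i)
      rw [h0]
      refine (condExp_add hi1 hi2 _).trans ?_
      have h1 := condExp_of_stronglyMeasurable (measurable_coords (K : Set V)).comap_le
        (((hreg i).comp (comap_measurable _)).stronglyMeasurable) hi1
      have h2 := condExp_indep_eq (m₁ := MeasurableSpace.comap (lin (resVec S i K)) inferInstance)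
        (measurable_lin _).comap_le (measurable_coords (K : Set V)).comap_le
        (comap_measurable (lin (resVec S i K))).stronglyMeasurable
        ((IndepFun_iff_Indep _ _ _).1 hindep)
      filter_upwards [h2] with x h2
      rw [Pi.add_apply, h2, integral_lin, add_zero]
      exact congrFun h1 x
    -- The residual of `i` has mean zero given `x_K` and `x_j`, so it is orthogonal to that of `j`.
    have hzero : P[lin (resVec S i K) | m] =ᵐ[P] 0 := by
      have h0 : lin (resVec S i K) =
          (fun x : EuclideanSpace ℝ V => x i) - fun x => reg i (coords (K : Set V) x) := by
        funext x
        simp [hdec i x]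
      rw [h0]
      refine (condExp_sub hxi hi1 _).trans ?_
      have h1 : P[fun x => reg i (coords (K : Set V) x) | m] =
          fun x => reg i (coords (K : Set V) x) := by
        refine condExp_of_stronglyMeasurable hle (Measurable.stronglyMeasurable ?_) hi1
        exact (hreg i).comp (measurable_fst.comp (comap_measurable _))
      filter_upwards [hce, hck] with x h2 h3
      rw [Pi.sub_apply, h1, h2, h3]
      simp
    have hmj : StronglyMeasurable[m] (lin (resVec S j K)) := by
      have h0 : lin (resVec S j K) = (fun z : (((K : Set V) : Type _) → ℝ) × ℝ => z.2 - reg j z.1) ∘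
          fun x : EuclideanSpace ℝ V => (coords (K : Set V) x, x j) := by
        funext x
        simp [hdec j x]
      rw [h0]
      refine Measurable.stronglyMeasurable (Measurable.comp ?_ (comap_measurable _))
      exact measurable_snd.sub ((hreg j).comp measurable_fst)
    have hprod : Integrable (lin (resVec S i K) * lin (resVec S j K)) P :=
      (memLp_lin S _).integrable_mul (memLp_lin S _)
    have hfin : ∫ x, lin (resVec S i K) x * lin (resVec S j K) x ∂P = 0 := by
      have h1 := condExp_mul_of_stronglyMeasurable_right hmj hprod hi2
      have h2 := integral_condExp (μ := P) (f := lin (resVec S i K) * lin (resVec S j K)) hle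
      simp only [Pi.mul_apply] at h2
      rw [← h2, integral_congr_ae (g := fun _ => (0 : ℝ)), integral_zero]
      filter_upwards [h1, hzero] with x h1 h3
      rw [h1, Pi.mul_apply, h3]
      simp
    rw [condCov_eq_form hsymm hpd, ← covariance_lin hS,
      covariance_eq_sub (memLp_lin S _) (memLp_lin S _), integral_lin, zero_mul, sub_zero]
    exact hfin
  · intro h
    have hind : IndepFun (fun x => (coords (K : Set V) x, x j)) (lin (resVec S i K)) P := by
      have := (indepFun_lin hS (fun v : Option K => (Pi.single (v.elim j fun k => k.1) 1 : V → ℝ))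
        (fun _ : Unit => resVec S i K) fun v _ => by
          rcases v with _ | k
          · rw [form_comm hsymm]
            exact (condCov_eq_form_single S i j K).symm.trans h
          · exact form_single_resVec hS i k.1 k.2).comp
        (φ := fun y : Option K → ℝ => (fun k : (K : Set V) => y (some k), y none))
        (ψ := fun y : Unit → ℝ => y ()) (by fun_prop) hu
      simp only [Function.comp_def, lin_single] at this
      exact this
    have := condIndepFun_of_indepFun_prod (F := fun z : (((K : Set V) : Type _) → ℝ) × ℝ =>
      reg i z.1 + z.2) (measurable_coords (K : Set V)) (hmi j) (measurable_lin (resVec S i K))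
      (((hreg i).comp measurable_fst).add measurable_snd) hind
    simpa only [← hdec i] using this

/-! ### Regressions on the parents in a Markov DAG -/

theorem condIndepCoords_of_dSep {S : Matrix V V ℝ} {G : DAG V}
    (h : IsMarkov (multivariateGaussian 0 S) G) {i j : V} {K : Finset V} (hij : i ≠ j)
    (hi : i ∉ K) (hj : j ∉ K) (hs : G.DSep {i} {j} K) :
    CondIndepCoords (multivariateGaussian 0 S) {i} {j} (K : Set V) :=
  h _ _ _ (by simpa using hij) (by simpa using hi) (by simpa using hj) hs

/-- For a Gaussian law that is Markov and faithful, d-separation of two vertices means a vanishing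
partial correlation. -/
theorem partialCorr_eq_zero_iff_dSep {S : Matrix V V ℝ} (hS : S.PosDef) {G : DAG V}
    (hG : IsFaithful (multivariateGaussian 0 S) G) {i j : V} {K : Finset V} (hij : i ≠ j)
    (hi : i ∉ K) (hj : j ∉ K) : partialCorr S i j K = 0 ↔ G.DSep {i} {j} K := by
  have hsymm := isSymm_of_posDef hS
  have hvi := condVar_pos hsymm (posDefOn_of_posDef hS _) hi
  have hvj := condVar_pos hsymm (posDefOn_of_posDef hS _) hj
  rw [← hG _ _ _ (by simpa using hij) (by simpa using hi) (by simpa using hj),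
    condIndepCoords_iff hS, partialCorr, div_eq_zero_iff,
    condCov_comm hsymm (posDefOn_of_posDef hS K)]
  refine or_iff_left ?_
  have := Real.sqrt_pos.2 hvi
  have := Real.sqrt_pos.2 hvj
  positivity

/-- The residual of `i` in the regression on its parents is uncorrelated with every
non-descendant of `i`. -/
theorem mulVec_resVec_parents_eq_zero {S : Matrix V V ℝ} (hS : S.PosDef) {G : DAG V}
    (hG : IsMarkov (multivariateGaussian 0 S) G) {i j : V} (hij : i ≠ j)
    (hd : ¬ Relation.TransGen G.edge i j) : (S *ᵥ resVec S i (G.parents i)) j = 0 := by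
  have hsymm := isSymm_of_posDef hS
  have hpd := posDefOn_of_posDef hS (G.parents i)
  by_cases hj : j ∈ G.parents i
  · exact (isResidual_resVec hsymm hpd i).orth j hj
  · have h := condIndepCoords_of_dSep hG hij (G.self_notMem_parents i) hj (G.dSep_parents hij hd)
    rw [condIndepCoords_iff hS, condCov_comm hsymm hpd, condCov_eq_form_single,
      form_comm hsymm, form, single_one_dotProduct] at h
    exact h

/-- The concentration matrix is recovered from the regressions on the parents in a Markov DAG. -/
theorem dagConcentration_eq_inv {S : Matrix V V ℝ} (hS : S.PosDef) {G : DAG V}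
    (hG : IsMarkov (multivariateGaussian 0 S) G) : dagConcentration S G = S⁻¹ := by
  have hsymm := isSymm_of_posDef hS
  have hv : ∀ l, condVar S l (G.parents l) ≠ 0 := fun l =>
    (condVar_pos hsymm (posDefOn_of_posDef hS _) (G.self_notMem_parents l)).ne'
  -- Of two different vertices one is not a descendant of the other, so the residuals of the two
  -- regressions are uncorrelated.
  have hzero : ∀ i l, i ≠ l → ¬ Relation.TransGen G.edge i l →
      form S (resVec S l (G.parents l)) (resVec S i (G.parents i)) = 0 := by
    intro i l hil hd
    have h0 : ∀ v ∈ insert l (G.parents l), (S *ᵥ resVec S i (G.parents i)) v = 0 := by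
      intro v hv
      rcases Finset.mem_insert.1 hv with rfl | hv
      · exact mulVec_resVec_parents_eq_zero hS hG hil hd
      · have hvl := DAG.mem_parents.1 hv
        refine mulVec_resVec_parents_eq_zero hS hG ?_ fun h => hd (h.tail hvl)
        rintro rfl
        exact hd (.single hvl)
    refine form_eq_zero_of_supportedOn (K := insert l (G.parents l)) (fun v hv => ?_) h0
    rw [Finset.mem_insert, not_or] at hv
    simp [resVec, extendZero, hv.1, hv.2]
  have hdiag : regMatrix S G * S * (regMatrix S G)ᵀ = errorCov S G := by
    ext i l
    have hform : (regMatrix S G * S * (regMatrix S G)ᵀ) i l =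
        form S (resVec S i (G.parents i)) (resVec S l (G.parents l)) := by
      rw [Matrix.mul_assoc, Matrix.mul_apply, form, dotProduct]
      refine Finset.sum_congr rfl fun v _ => ?_
      rw [regMatrix_apply, Matrix.mul_apply, mulVec, dotProduct]
      simp only [transpose_apply, regMatrix_apply]
    rw [hform, errorCov]
    by_cases hil : i = l
    · subst hil
      rw [diagonal_apply_eq, condVar_eq_form hsymm (posDefOn_of_posDef hS _)]
    · rw [diagonal_apply_ne _ hil]
      by_cases hd : Relation.TransGen G.edge l i
      · rw [form_comm hsymm]
        exact hzero i l hil fun h => G.acyclic i (h.trans hd)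
      · exact hzero l i (Ne.symm hil) hd
  have hunit : IsUnit (errorCov S G).det := by
    rw [errorCov, det_diagonal]
    exact (Finset.prod_ne_zero_iff.2 fun l _ => hv l).isUnit
  have h1 : regMatrix S G * (S * (regMatrix S G)ᵀ * (errorCov S G)⁻¹) = 1 := by
    rw [← Matrix.mul_assoc, ← Matrix.mul_assoc, hdiag, mul_nonsing_inv _ hunit]
  refine (inv_eq_right_inv ?_).symm
  rw [dagConcentration, ← mul_eq_one_comm.1 h1]
  simp only [Matrix.mul_assoc]

/-- Equivalent DAGs have the same concentration matrix. -/
theorem dagConcentration_eq_of_equivalent {T : Matrix V V ℝ} (hT : T.IsSymm) {G D : DAG V}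
    (h : D.Equivalent G) (hpd : ∀ K : Finset V, K.card ≤ G.maxAdj + 1 → PosDefOn T K) :
    dagConcentration T D = dagConcentration T G := by
  have hcard : ∀ D' : DAG V, D'.Equivalent G → ∀ l, PosDefOn T (insert l (D'.parents l)) := by
    intro D' hD' l
    refine hpd _ ((Finset.card_insert_le _ _).trans (Nat.succ_le_succ ?_))
    have := D'.card_parents_le_maxAdj l
    rwa [DAG.maxAdj, hD'.1] at this
  refine h.symm.induction (P := fun D' => dagConcentration T D' = dagConcentration T G) rfl ?_
  intro D₁ D₂ x y hflip hD₁ hP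
  rw [hflip.dagConcentration_eq hT (hcard _ hD₁) (hcard _ (hflip.equivalent.trans hD₁)), hP]

end Gaussian

end PCDAG

namespace PCDAG

/-! ### Tail bounds for squares of Gaussian variables -/

section ChiSquare

theorem mgf_sq_gaussianReal {t : ℝ} (ht : t < 1 / 2) :
    mgf (fun x : ℝ => x ^ 2) (gaussianReal 0 1) t = (√(1 - 2 * t))⁻¹ := by
  rw [mgf, integral_gaussianReal_eq_integral_smul one_ne_zero]
  have h1 : ∀ x : ℝ, gaussianPDFReal 0 1 x • Real.exp (t * x ^ 2) =
      (√(2 * Real.pi))⁻¹ * Real.exp (-(1 / 2 - t) * x ^ 2) := by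
    intro x
    rw [gaussianPDFReal, smul_eq_mul, mul_assoc, ← Real.exp_add]
    simp only [NNReal.coe_one, mul_one, sub_zero]
    congr 2
    ring
  simp_rw [h1]
  rw [integral_const_mul, integral_gaussian, ← Real.sqrt_inv, ← Real.sqrt_inv, ← Real.sqrt_mul]
  · congr 1
    have : 1 / 2 - t ≠ 0 := by linarith
    have : 1 - 2 * t ≠ 0 := by linarith
    field_simp
  · positivity

variable {Ω : Type*} [MeasurableSpace Ω] {μ : Measure Ω}

theorem mgf_sum_sq {ι : Type*} [Fintype ι] {g : ι → Ω → ℝ} (hm : ∀ r, Measurable (g r))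
    (hi : iIndepFun g μ) (hl : ∀ r, μ.map (g r) = gaussianReal 0 1) {t : ℝ} (ht : t < 1 / 2) :
    mgf (fun ω => ∑ r, g r ω ^ 2) μ t = (√(1 - 2 * t))⁻¹ ^ Fintype.card ι := by
  have h1 : iIndepFun (fun r ω => g r ω ^ 2) μ :=
    hi.comp (fun _ x => x ^ 2) fun _ => by fun_prop
  have h2 : (fun ω => ∑ r, g r ω ^ 2) = ∑ r, fun ω => g r ω ^ 2 := by
    ext ω
    simp
  rw [h2, h1.mgf_sum fun r => (hm r).pow_const 2]
  have h3 : ∀ r, mgf (fun ω => g r ω ^ 2) μ t = (√(1 - 2 * t))⁻¹ := by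
    intro r
    rw [← mgf_sq_gaussianReal ht, ← hl r, mgf_map (hm r).aemeasurable (by fun_prop)]
    rfl
  simp [h3]

theorem integrable_exp_sum_sq {ι : Type*} [Fintype ι] {g : ι → Ω → ℝ}
    (hm : ∀ r, Measurable (g r)) (hi : iIndepFun g μ) (hl : ∀ r, μ.map (g r) = gaussianReal 0 1)
    {t : ℝ} (ht : t < 1 / 2) : Integrable (fun ω => Real.exp (t * ∑ r, g r ω ^ 2)) μ := by
  by_contra h
  have h1 := mgf_sum_sq hm hi hl ht
  rw [mgf, integral_undef h] at h1
  have : 0 < 1 - 2 * t := by linarith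
  have : 0 < (√(1 - 2 * t))⁻¹ ^ Fintype.card ι := by positivity
  linarith

theorem inv_sqrt_le_exp {y c : ℝ} (h : Real.exp (-(2 * c)) ≤ y) : (√y)⁻¹ ≤ Real.exp c := by
  have h1 : Real.exp (-c) ≤ √y := by
    refine Real.le_sqrt_of_sq_le ?_
    rwa [← Real.exp_nat_mul, Nat.cast_ofNat, mul_neg]
  calc (√y)⁻¹ ≤ (Real.exp (-c))⁻¹ := inv_anti₀ (Real.exp_pos _) h1
    _ = Real.exp c := by rw [Real.exp_neg, inv_inv]

/-- Chernoff bound for the `χ²`-distribution. -/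
theorem measure_chiSquare_le [IsProbabilityMeasure μ] {n : ℕ} {g : Fin n → Ω → ℝ}
    (hm : ∀ r, Measurable (g r))
    (hi : iIndepFun g μ) (hl : ∀ r, μ.map (g r) = gaussianReal 0 1) {η : ℝ} (h0 : 0 ≤ η)
    (h1 : η ≤ 1) :
    μ {ω | n * η ≤ |(∑ r, g r ω ^ 2) - n|} ≤ ENNReal.ofReal (2 * Real.exp (-(n * η ^ 2 / 8))) := by
  have hup : μ.real {ω | n * (1 + η) ≤ ∑ r, g r ω ^ 2} ≤ Real.exp (-(n * η ^ 2 / 8)) := by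
    refine (measure_ge_le_exp_mul_mgf (t := η / 4) _ (by linarith)
      (integrable_exp_sum_sq hm hi hl (by linarith))).trans ?_
    rw [mgf_sum_sq hm hi hl (by linarith), Fintype.card_fin]
    have hb : (√(1 - 2 * (η / 4)))⁻¹ ≤ Real.exp (η / 4 + η ^ 2 / 8) := by
      refine inv_sqrt_le_exp ?_
      rw [Real.exp_neg, inv_le_comm₀ (Real.exp_pos _) (by linarith)]
      have hq := Real.quadratic_le_exp_of_nonneg (x := 2 * (η / 4 + η ^ 2 / 8)) (by positivity)
      refine le_trans ?_ hq
      rw [inv_le_iff_one_le_mul₀ (by linarith)]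
      have h2 : 0 ≤ η ^ 2 := sq_nonneg η
      have h3 : 0 ≤ 1 - η / 2 - η ^ 2 / 4 - η ^ 3 / 8 := by nlinarith [pow_le_one₀ h0 h1 (n := 3)]
      have h4 := mul_nonneg h2 h3
      nlinarith
    calc Real.exp (-(η / 4) * (n * (1 + η))) * (√(1 - 2 * (η / 4)))⁻¹ ^ n
        ≤ Real.exp (-(η / 4) * (n * (1 + η))) * Real.exp (η / 4 + η ^ 2 / 8) ^ n := by gcongr
      _ = Real.exp (-(n * η ^ 2 / 8)) := by
          rw [← Real.exp_nat_mul, ← Real.exp_add]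
          congr 1
          ring
  have hlo : μ.real {ω | ∑ r, g r ω ^ 2 ≤ n * (1 - η)} ≤ Real.exp (-(n * η ^ 2 / 8)) := by
    refine (measure_le_le_exp_mul_mgf (t := -(η / 4)) _ (by linarith)
      (integrable_exp_sum_sq hm hi hl (by linarith))).trans ?_
    rw [mgf_sum_sq hm hi hl (by linarith), Fintype.card_fin]
    have hb : (√(1 - 2 * -(η / 4)))⁻¹ ≤ Real.exp (-(η / 4) + η ^ 2 / 8) := by
      refine inv_sqrt_le_exp ?_
      have hq := Real.add_one_le_exp (2 * (-(η / 4) + η ^ 2 / 8))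
      rw [Real.exp_neg]
      refine (inv_anti₀ ?_ hq).trans ?_
      · nlinarith [sq_nonneg η]
      · rw [inv_le_iff_one_le_mul₀ (by nlinarith [sq_nonneg η])]
        nlinarith [pow_nonneg h0 3]
    calc Real.exp (- -(η / 4) * (n * (1 - η))) * (√(1 - 2 * -(η / 4)))⁻¹ ^ n
        ≤ Real.exp (- -(η / 4) * (n * (1 - η))) * Real.exp (-(η / 4) + η ^ 2 / 8) ^ n := by gcongr
      _ = Real.exp (-(n * η ^ 2 / 8)) := by
          rw [← Real.exp_nat_mul, ← Real.exp_add]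
          congr 1
          ring
  have hsub : {ω | n * η ≤ |(∑ r, g r ω ^ 2) - n|} ⊆
      {ω | n * (1 + η) ≤ ∑ r, g r ω ^ 2} ∪ {ω | ∑ r, g r ω ^ 2 ≤ n * (1 - η)} := by
    intro ω hω
    have hω' : n * η ≤ |(∑ r, g r ω ^ 2) - n| := hω
    rcases le_abs.1 hω' with h | h
    · have h' : n * (1 + η) ≤ ∑ r, g r ω ^ 2 := by linarith
      exact Or.inl h'
    · have h' : ∑ r, g r ω ^ 2 ≤ n * (1 - η) := by linarith
      exact Or.inr h'
  refine (measure_mono hsub).trans ((measure_union_le _ _).trans ?_)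
  rw [← ofReal_measureReal, ← ofReal_measureReal,
    ← ENNReal.ofReal_add (by positivity) (by positivity)]
  exact ENNReal.ofReal_le_ofReal (by linarith)

end ChiSquare

/-! ### Projections of Gaussian vectors -/

section Projection

variable {n : ℕ} {κ : Type*} [Fintype κ] [DecidableEq κ]

/-- The squared length of the projection of `z` onto the column space of `Z`, when the columns of
`Z` are linearly independent; otherwise the value is `0`. -/
noncomputable def projSq (Z : Matrix (Fin n) κ ℝ) (z : Fin n → ℝ) : ℝ :=
  (Zᵀ *ᵥ z) ⬝ᵥ (Zᵀ * Z)⁻¹ *ᵥ (Zᵀ *ᵥ z)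

theorem exists_orthonormal_projSq_le (Z : Matrix (Fin n) κ ℝ) :
    ∃ (d : ℕ) (b : Fin d → EuclideanSpace ℝ (Fin n)), d ≤ Fintype.card κ ∧ Orthonormal ℝ b ∧
      ∀ z : EuclideanSpace ℝ (Fin n), projSq Z z ≤ ∑ l, inner ℝ (b l) z ^ 2 := by
  set col : κ → EuclideanSpace ℝ (Fin n) := fun k => WithLp.toLp 2 fun r => Z r k with hcol
  set U : Submodule ℝ (EuclideanSpace ℝ (Fin n)) := Submodule.span ℝ (Set.range col) with hU
  refine ⟨Module.finrank ℝ U, fun l => (stdOrthonormalBasis ℝ U l : EuclideanSpace ℝ (Fin n)),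
    finrank_range_le_card col, ?_, fun z => ?_⟩
  · exact (stdOrthonormalBasis ℝ U).orthonormal.comp_linearIsometry U.subtypeₗᵢ
  set a := (Zᵀ * Z)⁻¹ *ᵥ (Zᵀ *ᵥ (z : Fin n → ℝ)) with ha
  have hmem : WithLp.toLp 2 (Z *ᵥ a) ∈ U := by
    have : WithLp.toLp 2 (Z *ᵥ a) = ∑ k, a k • col k := by
      ext r
      simp [hcol, mulVec, dotProduct, mul_comm]
    rw [this]
    exact Submodule.sum_mem _ fun k _ => Submodule.smul_mem _ _ (Submodule.subset_span ⟨k, rfl⟩)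
  set u : U := ⟨WithLp.toLp 2 (Z *ᵥ a), hmem⟩ with hu
  -- The projection `Z a` has the same inner product with `z` as with itself.
  have hF1 : projSq Z z = inner ℝ (u : EuclideanSpace ℝ (Fin n)) z := by
    rw [projSq, ← ha, hu, EuclideanSpace.inner_eq_star_dotProduct, star_trivial,
      mulVec_transpose, ← dotProduct_mulVec]
  have hF2 : projSq Z z = inner ℝ u u := by
    rw [projSq, ← ha, hu, Submodule.coe_inner, EuclideanSpace.inner_eq_star_dotProduct,
      star_trivial]
    change _ = (Z *ᵥ a) ⬝ᵥ (Z *ᵥ a)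
    rw [dotProduct_mulVec (Z *ᵥ a) Z a, ← mulVec_transpose Z, mulVec_mulVec a Zᵀ Z]
    by_cases hdet : IsUnit (Zᵀ * Z).det
    · rw [ha, mulVec_mulVec _ (Zᵀ * Z) (Zᵀ * Z)⁻¹, mul_nonsing_inv _ hdet, one_mulVec]
    · rw [ha, nonsing_inv_apply_not_isUnit _ hdet]
      simp
  set b := stdOrthonormalBasis ℝ U
  have h1 : inner ℝ u u = ∑ l, inner ℝ (b l) u ^ 2 := by
    rw [← b.sum_inner_mul_inner u u]
    refine Finset.sum_congr rfl fun l _ => ?_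
    rw [real_inner_comm u (b l), sq]
  have h2 : inner ℝ (u : EuclideanSpace ℝ (Fin n)) z =
      ∑ l, inner ℝ (b l) u * inner ℝ (b l : EuclideanSpace ℝ (Fin n)) z := by
    conv_lhs => rw [← b.sum_repr' u]
    simp [sum_inner, inner_smul_left]
  have hcs := Finset.sum_mul_sq_le_sq_mul_sq Finset.univ (fun l => inner ℝ (b l) u)
    fun l => inner ℝ (b l : EuclideanSpace ℝ (Fin n)) z
  rw [← h1, ← h2, ← hF1, ← hF2] at hcs
  have hnn : 0 ≤ projSq Z z := by rw [hF2]; exact real_inner_self_nonneg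
  rcases hnn.eq_or_lt with h | h
  · rw [← h]
    exact Finset.sum_nonneg fun l _ => sq_nonneg _
  · rw [sq] at hcs
    exact le_of_mul_le_mul_left hcs h

theorem lintegral_exp_projSq_le (Z : Matrix (Fin n) κ ℝ) :
    ∫⁻ z, ENNReal.ofReal (Real.exp (1 / 4 * projSq Z z)) ∂(Measure.pi fun _ => gaussianReal 0 1) ≤
      ENNReal.ofReal (2 ^ Fintype.card κ) := by
  obtain ⟨d, b, hd, hb, hle⟩ := exists_orthonormal_projSq_le Z
  set ν := stdGaussian (EuclideanSpace ℝ (Fin n)) with hν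
  set g : Fin d → EuclideanSpace ℝ (Fin n) → ℝ := fun l z => inner ℝ (b l) z with hg
  have hgm : ∀ l, Measurable (g l) := fun l => by fun_prop
  have hgl : HasGaussianLaw (fun z => (g · z)) ν := by
    have h := (IsGaussian.hasGaussianLaw_id (μ := ν)).map_fun
      (ContinuousLinearMap.pi fun l => innerSL ℝ (b l))
    simpa [hg] using h
  have hcov : ∀ l m, cov[g l, g m; ν] = if l = m then 1 else 0 := by
    intro l m
    rw [hg, ← covarianceBilin_apply_eq_cov IsGaussian.memLp_two_id, covarianceBilin_stdGaussian,
      innerSL_apply_apply]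
    exact orthonormal_iff_ite.1 hb l m
  have hind : iIndepFun g ν :=
    hgl.iIndepFun_of_covariance_eq_zero fun l m hlm => by rw [hcov, if_neg hlm]
  have hlaw : ∀ l, ν.map (g l) = gaussianReal 0 1 := by
    intro l
    rw [(hgl.eval l).map_eq_gaussianReal, ← covariance_self (hgm l).aemeasurable, hcov, if_pos rfl]
    have : ∫ z, g l z ∂ν = 0 := integral_strongDual_stdGaussian (innerSL ℝ (b l))
    rw [this]
    simp
  have hmgf := mgf_sum_sq hgm hind hlaw (t := 1 / 4) (by norm_num)
  have hint := integrable_exp_sum_sq hgm hind hlaw (t := 1 / 4) (by norm_num)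
  calc ∫⁻ z, ENNReal.ofReal (Real.exp (1 / 4 * projSq Z z)) ∂(Measure.pi fun _ => gaussianReal 0 1)
      ≤ ∫⁻ z, ENNReal.ofReal (Real.exp (1 / 4 * ∑ l, g l (WithLp.toLp 2 z) ^ 2))
          ∂(Measure.pi fun _ => gaussianReal 0 1) := by
        refine lintegral_mono fun z => ENNReal.ofReal_le_ofReal (Real.exp_le_exp.2 ?_)
        exact mul_le_mul_of_nonneg_left (hle (WithLp.toLp 2 z)) (by norm_num)
    _ = ∫⁻ z, ENNReal.ofReal (Real.exp (1 / 4 * ∑ l, g l z ^ 2)) ∂ν := by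
        rw [hν, ← map_pi_eq_stdGaussian, lintegral_map (by fun_prop) (by fun_prop)]
    _ = ENNReal.ofReal ((√(1 - 2 * (1 / 4)))⁻¹ ^ d) := by
        rw [← ofReal_integral_eq_lintegral_ofReal hint (ae_of_all _ fun _ => (Real.exp_pos _).le)]
        rw [mgf, Fintype.card_fin] at hmgf
        rw [hmgf]
    _ ≤ ENNReal.ofReal (2 ^ Fintype.card κ) := by
        refine ENNReal.ofReal_le_ofReal ?_
        have h1 : (√(1 - 2 * (1 / 4 : ℝ)))⁻¹ ≤ 2 := by
          rw [inv_le_comm₀ (by positivity) (by norm_num)]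
          exact Real.le_sqrt_of_sq_le (by norm_num)
        exact (pow_le_pow_left₀ (by positivity) h1 d).trans (pow_le_pow_right₀ (by norm_num) hd)

theorem measurable_projSq {α : Type*} [TopologicalSpace α] [MeasurableSpace α]
    [OpensMeasurableSpace α] {Z : α → Matrix (Fin n) κ ℝ} {z : α → Fin n → ℝ} (hZ : Continuous Z)
    (hz : Continuous z) : Measurable fun a => projSq (Z a) (z a) := by
  have h : (fun a => projSq (Z a) (z a)) = fun a => (((Z a)ᵀ * Z a).det)⁻¹ *
      (((Z a)ᵀ *ᵥ z a) ⬝ᵥ ((Z a)ᵀ * Z a).adjugate *ᵥ ((Z a)ᵀ *ᵥ z a)) := by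
    funext a
    rw [projSq, Matrix.inv_def, Ring.inverse_eq_inv', smul_mulVec, dotProduct_smul, smul_eq_mul]
  rw [h]
  have h1 : Continuous fun a => ((Z a)ᵀ * Z a) := hZ.matrix_transpose.matrix_mul hZ
  have h2 : Continuous fun a => (Z a)ᵀ *ᵥ z a := hZ.matrix_transpose.matrix_mulVec hz
  exact h1.matrix_det.measurable.inv.mul
    (h2.dotProduct (h1.matrix_adjugate.matrix_mulVec h2)).measurable

/-- A Gaussian vector has a short projection onto the column space of a matrix with few columns,
even when the matrix is random but independent of the vector. -/
theorem measure_projSq_le {Ω : Type*} [MeasurableSpace Ω] {μ : Measure Ω} [IsProbabilityMeasure μ]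
    {ι : Type*} [Finite ι] {Y : Ω → ι → ℝ} {g : Ω → Fin n → ℝ} (hY : Measurable Y)
    (hg : Measurable g) (hind : IndepFun Y g μ)
    (hl : μ.map g = Measure.pi fun _ => gaussianReal 0 1)
    {Z : (ι → ℝ) → Matrix (Fin n) κ ℝ} (hZ : Continuous Z) (c : ℝ) :
    μ {ω | c ≤ projSq (Z (Y ω)) (g ω)} ≤
      ENNReal.ofReal (2 ^ Fintype.card κ * Real.exp (-(c / 4))) := by
  have hpY : IsProbabilityMeasure (μ.map Y) := Measure.isProbabilityMeasure_map hY.aemeasurable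
  have hmeas : Measurable fun p : (ι → ℝ) × (Fin n → ℝ) => projSq (Z p.1) p.2 :=
    measurable_projSq (hZ.comp continuous_fst) continuous_snd
  have hE : ∫⁻ ω, ENNReal.ofReal (Real.exp (1 / 4 * projSq (Z (Y ω)) (g ω))) ∂μ ≤
      ENNReal.ofReal (2 ^ Fintype.card κ) := by
    have hm2 : Measurable fun p : (ι → ℝ) × (Fin n → ℝ) =>
        ENNReal.ofReal (Real.exp (1 / 4 * projSq (Z p.1) p.2)) :=
      ((hmeas.const_mul _).exp).ennreal_ofReal
    rw [← lintegral_map (g := fun ω => (Y ω, g ω)) hm2 (hY.prodMk hg),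
      (indepFun_iff_map_prod_eq_prod_map_map hY.aemeasurable hg.aemeasurable).1 hind,
      lintegral_prod _ hm2.aemeasurable]
    calc ∫⁻ y, ∫⁻ z, ENNReal.ofReal (Real.exp (1 / 4 * projSq (Z y) z)) ∂(μ.map g) ∂(μ.map Y)
        ≤ ∫⁻ _, ENNReal.ofReal (2 ^ Fintype.card κ) ∂(μ.map Y) :=
          lintegral_mono fun y => by rw [hl]; exact lintegral_exp_projSq_le (Z y)
      _ = ENNReal.ofReal (2 ^ Fintype.card κ) := by simp
  have hpos := Real.exp_pos (c / 4)
  have hsub : {ω | c ≤ projSq (Z (Y ω)) (g ω)} ⊆ {ω | ENNReal.ofReal (Real.exp (c / 4)) ≤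
      ENNReal.ofReal (Real.exp (1 / 4 * projSq (Z (Y ω)) (g ω)))} := fun ω hω =>
    ENNReal.ofReal_le_ofReal (Real.exp_le_exp.2 (by
      have : c ≤ projSq (Z (Y ω)) (g ω) := hω
      linarith))
  refine (measure_mono hsub).trans ((meas_ge_le_lintegral_div ?_ ?_ ?_).trans ?_)
  · exact (((hmeas.comp (hY.prodMk hg)).const_mul _).exp).ennreal_ofReal.aemeasurable
  · simpa using hpos
  · exact ENNReal.ofReal_ne_top
  · refine (ENNReal.div_le_div_right hE _).trans ?_
    rw [← ENNReal.ofReal_div_of_pos hpos, Real.exp_neg, div_eq_mul_inv]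

end Projection

end PCDAG

namespace PCDAG

/-! ### Concentration of sample conditional covariances -/

section Sample

variable {V : Type*} [Fintype V] {n : ℕ}

/-- The mean over the sample of the product of two linear functionals. -/
noncomputable def sampleMom (x : Fin n → EuclideanSpace ℝ V) (u w : V → ℝ) : ℝ :=
  (n : ℝ)⁻¹ * ∑ r, lin u (x r) * lin w (x r)

/-- The mean over the sample of a linear functional. -/
noncomputable def sampleAvg (x : Fin n → EuclideanSpace ℝ V) (u : V → ℝ) : ℝ :=
  (n : ℝ)⁻¹ * ∑ r, lin u (x r)

omit [Fintype V] in
theorem isSymm_sampleCov (x : Fin n → EuclideanSpace ℝ V) : (sampleCov x).IsSymm := by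
  ext i j
  simp [sampleCov, mul_comm]

theorem sampleAvg_eq_sum (x : Fin n → EuclideanSpace ℝ V) (u : V → ℝ) :
    sampleAvg x u = ∑ v, u v * sampleMean x v := by
  simp only [sampleAvg, sampleMean, lin, Finset.mul_sum]
  rw [Finset.sum_comm]
  exact Finset.sum_congr rfl fun v _ => Finset.sum_congr rfl fun r _ => by ring

theorem form_sampleCov_eq_centered (x : Fin n → EuclideanSpace ℝ V) (u w : V → ℝ) :
    form (sampleCov x) u w =
      (n : ℝ)⁻¹ * ∑ r, (lin u (x r) - sampleAvg x u) * (lin w (x r) - sampleAvg x w) := by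
  have h : ∀ (u : V → ℝ) (r : Fin n),
      lin u (x r) - sampleAvg x u = ∑ v, u v * (x r v - sampleMean x v) := by
    intro u r
    rw [sampleAvg_eq_sum, lin, ← Finset.sum_sub_distrib]
    exact Finset.sum_congr rfl fun v _ => by ring
  simp_rw [h, Finset.sum_mul_sum]
  simp only [form, dotProduct, mulVec, sampleCov, of_apply, Finset.mul_sum, Finset.sum_mul]
  rw [Finset.sum_comm' (t' := Finset.univ) (s' := fun _ => Finset.univ) (by simp)]
  rw [Finset.sum_comm]
  conv_rhs => rw [Finset.sum_comm]
  refine Finset.sum_congr rfl fun i _ => ?_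
  conv_rhs => rw [Finset.sum_comm]
  refine Finset.sum_congr rfl fun j _ => Finset.sum_congr rfl fun r _ => by ring

theorem sum_centered_mul (hn : n ≠ 0) (f g : Fin n → ℝ) :
    ∑ r, (f r - (n : ℝ)⁻¹ * ∑ s, f s) * (g r - (n : ℝ)⁻¹ * ∑ s, g s) =
      ∑ r, f r * g r - n * ((n : ℝ)⁻¹ * ∑ s, f s) * ((n : ℝ)⁻¹ * ∑ s, g s) := by
  have hn' : (n : ℝ) ≠ 0 := Nat.cast_ne_zero.2 hn
  set a := (n : ℝ)⁻¹ * ∑ s, f s with ha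
  set b := (n : ℝ)⁻¹ * ∑ s, g s with hb
  have hf : ∑ s, f s = n * a := by rw [ha]; field_simp
  have hg : ∑ s, g s = n * b := by rw [hb]; field_simp
  have : ∀ r, (f r - a) * (g r - b) = f r * g r - a * g r - b * f r + a * b := fun r => by ring
  simp only [this, Finset.sum_add_distrib, Finset.sum_sub_distrib, ← Finset.mul_sum, hf, hg,
    Finset.sum_const, Finset.card_univ, Fintype.card_fin, nsmul_eq_mul]
  ring

theorem form_sampleCov (hn : n ≠ 0) (x : Fin n → EuclideanSpace ℝ V) (u w : V → ℝ) :
    form (sampleCov x) u w = sampleMom x u w - sampleAvg x u * sampleAvg x w := by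
  have hn' : (n : ℝ) ≠ 0 := Nat.cast_ne_zero.2 hn
  rw [form_sampleCov_eq_centered, sampleMom, sampleAvg, sampleAvg, sum_centered_mul hn]
  field_simp

/-- The centered observations of the variables in `K`, one variable in each column. -/
noncomputable def centered {V : Type*} (x : Fin n → EuclideanSpace ℝ V) (K : Finset V) :
    Matrix (Fin n) K ℝ :=
  Matrix.of fun r k => x r k - sampleMean x k

variable [DecidableEq V]

theorem mulVec_sampleCov (hn : n ≠ 0) (x : Fin n → EuclideanSpace ℝ V) (u : V → ℝ) (K : Finset V)
    (k : K) : (sampleCov x *ᵥ u) k =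
      (n : ℝ)⁻¹ * ((centered x K)ᵀ *ᵥ fun r => lin u (x r)) k := by
  have h1 : (sampleCov x *ᵥ u) k = form (sampleCov x) (Pi.single k.1 1) u := by
    rw [form, single_one_dotProduct]
  rw [h1, form_sampleCov hn, sampleMom, sampleAvg, sampleAvg]
  simp only [lin_single, mulVec, dotProduct, transpose_apply, centered, of_apply, sub_mul,
    Finset.sum_sub_distrib, ← Finset.mul_sum, sampleMean]
  ring

omit [Fintype V] [DecidableEq V] in
theorem princ_sampleCov (x : Fin n → EuclideanSpace ℝ V) (K : Finset V) :
    princ (sampleCov x) K = (n : ℝ)⁻¹ • ((centered x K)ᵀ * centered x K) := by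
  ext k l
  simp [sampleCov, centered, Matrix.mul_apply]

theorem inv_smul_of_ne_zero {κ : Type*} [Fintype κ] [DecidableEq κ] {c : ℝ} (hc : c ≠ 0)
    (M : Matrix κ κ ℝ) : (c • M)⁻¹ = c⁻¹ • M⁻¹ := by
  by_cases h : IsUnit M.det
  · refine inv_eq_right_inv ?_
    rw [Matrix.smul_mul, Matrix.mul_smul, mul_nonsing_inv _ h, smul_smul, mul_inv_cancel₀ hc,
      one_smul]
  · have h' : ¬ IsUnit (c • M).det := by
      rw [det_smul]
      intro h'
      exact h (isUnit_of_mul_isUnit_right h')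
    rw [nonsing_inv_apply_not_isUnit _ h, nonsing_inv_apply_not_isUnit _ h', smul_zero]

theorem explained_sampleCov (hn : n ≠ 0) (x : Fin n → EuclideanSpace ℝ V) (K : Finset V)
    (u : V → ℝ) : explained (sampleCov x) K u u =
      (n : ℝ)⁻¹ * projSq (centered x K) fun r => lin u (x r) := by
  have hn' : (n : ℝ) ≠ 0 := Nat.cast_ne_zero.2 hn
  have h : (fun k : K => (sampleCov x *ᵥ u) k) =
      (n : ℝ)⁻¹ • ((centered x K)ᵀ *ᵥ fun r => lin u (x r)) :=
    funext fun k => mulVec_sampleCov hn x u K k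
  rw [explained, h, princ_sampleCov, inv_smul_of_ne_zero (inv_ne_zero hn'), projSq, inv_inv,
    smul_mulVec, mulVec_smul, smul_dotProduct, dotProduct_smul, dotProduct_smul]
  simp only [smul_eq_mul]
  field_simp

omit [DecidableEq V] in
theorem sampleAvg_sq (hn : n ≠ 0) (x : Fin n → EuclideanSpace ℝ V) (u : V → ℝ) :
    sampleAvg x u ^ 2 =
      (n : ℝ)⁻¹ * projSq (Matrix.of fun (_ : Fin n) (_ : Unit) => (1 : ℝ)) fun r => lin u (x r) := by
  have hn' : (n : ℝ) ≠ 0 := Nat.cast_ne_zero.2 hn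
  have h1 : (Matrix.of fun (_ : Fin n) (_ : Unit) => (1 : ℝ))ᵀ *
      (Matrix.of fun (_ : Fin n) (_ : Unit) => (1 : ℝ)) = (n : ℝ) • (1 : Matrix Unit Unit ℝ) := by
    ext
    simp [Matrix.mul_apply]
  have h2 : ((n : ℝ) • (1 : Matrix Unit Unit ℝ))⁻¹ = (n : ℝ)⁻¹ • 1 := by
    rw [inv_smul_of_ne_zero hn', inv_one]
  rw [projSq, h1, h2, smul_mulVec, one_mulVec, dotProduct_smul, sampleAvg]
  simp only [dotProduct, mulVec, transpose_apply, of_apply, one_mul, Finset.univ_unique,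
    Finset.sum_singleton, smul_eq_mul]
  ring

/-- The sample deviates by at most `η` from what is expected of two functionals `u` and `t` that
have unit variance and are uncorrelated with the variables in `K`: their sample covariance is close
to the true one, their sample means are small, and the variables in `K` explain little of them. -/
structure SampleGood (S : Matrix V V ℝ) (x : Fin n → EuclideanSpace ℝ V) (K : Finset V)
    (u t : V → ℝ) (η : ℝ) : Prop where
  mom : |sampleMom x u t - form S u t| ≤ η
  avg_left : sampleAvg x u ^ 2 ≤ η
  avg_right : sampleAvg x t ^ 2 ≤ η
  expl_left : explained (sampleCov x) K u u ≤ η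
  expl_right : explained (sampleCov x) K t t ≤ η

theorem SampleGood.abs_sub_le {S : Matrix V V ℝ} {x : Fin n → EuclideanSpace ℝ V} {K : Finset V}
    {u t : V → ℝ} {η : ℝ} (h : SampleGood S x K u t η) (hn : n ≠ 0)
    (hK : PosDefOn (sampleCov x) K) :
    |form (sampleCov x) u t - explained (sampleCov x) K u t - form S u t| ≤ 3 * η := by
  have hη : 0 ≤ η := (sq_nonneg _).trans h.avg_left
  have h1 : |sampleAvg x u * sampleAvg x t| ≤ η := by
    refine abs_le_of_sq_le_sq ?_ hη
    rw [mul_pow, sq η]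
    exact mul_le_mul h.avg_left h.avg_right (sq_nonneg _) hη
  have hM := ((hK.posDef_princ (isSymm_sampleCov x)).inv).posSemidef
  have hnn : ∀ w : V → ℝ, 0 ≤ explained (sampleCov x) K w w := fun w => by
    have := hM.dotProduct_mulVec_nonneg fun k : K => (sampleCov x *ᵥ w) k
    rwa [star_trivial] at this
  have h2 : |explained (sampleCov x) K u t| ≤ η := by
    refine abs_le_of_sq_le_sq ((explained_sq_le (isSymm_sampleCov x) hK u t).trans ?_) hη
    rw [sq η]
    exact mul_le_mul h.expl_left h.expl_right (hnn _) hη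
  rw [form_sampleCov hn]
  have h3 := h.mom
  rw [abs_le] at h1 h2 h3 ⊢
  constructor <;> linarith [h1.1, h1.2, h2.1, h2.2, h3.1, h3.2]

end Sample

section Data

variable {V : Type*} [Fintype V] [DecidableEq V] {n : ℕ} {Ω : Type*} [MeasurableSpace Ω]
  {μ : Measure Ω} {X : Fin n → Ω → EuclideanSpace ℝ V} {S : Matrix V V ℝ}

/-- `X` is a sample of independent random vectors with law `N(0, S)`. -/
structure IsGaussianSample (X : Fin n → Ω → EuclideanSpace ℝ V) (S : Matrix V V ℝ)
    (μ : Measure Ω) : Prop where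
  posDef : S.PosDef
  measurable : ∀ r, Measurable (X r)
  indep : iIndepFun X μ
  law : ∀ r, μ.map (X r) = multivariateGaussian 0 S

namespace IsGaussianSample

theorem measurable_lin_comp (h : IsGaussianSample X S μ) (u : V → ℝ) (r : Fin n) :
    Measurable fun ω => lin u (X r ω) := (measurable_lin u).comp (h.measurable r)

theorem indep_lin (h : IsGaussianSample X S μ) (u : V → ℝ) :
    iIndepFun (fun r ω => lin u (X r ω)) μ :=
  h.indep.comp (fun _ => lin u) fun _ => measurable_lin u

theorem covariance_lin (h : IsGaussianSample X S μ) (u w : V → ℝ) (r : Fin n) :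
    cov[fun ω => lin u (X r ω), fun ω => lin w (X r ω); μ] = form S u w := by
  rw [← PCDAG.covariance_lin h.posDef, ← h.law r, covariance_map_fun
    (measurable_lin u).aestronglyMeasurable (measurable_lin w).aestronglyMeasurable
    (h.measurable r).aemeasurable]

theorem memLp_lin (h : IsGaussianSample X S μ) (u : V → ℝ) (r : Fin n) :
    MemLp (fun ω => lin u (X r ω)) 2 μ := by
  have := PCDAG.memLp_lin S u
  rw [← h.law r] at this
  exact this.comp_of_map (h.measurable r).aemeasurable

theorem map_lin (h : IsGaussianSample X S μ) {u : V → ℝ} (hu : form S u u = 1) (r : Fin n) :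
    μ.map (fun ω => lin u (X r ω)) = gaussianReal 0 1 := by
  have h1 : μ.map (fun ω => lin u (X r ω)) = (multivariateGaussian 0 S).map (lin u) := by
    rw [← h.law r, Measure.map_map (measurable_lin u) (h.measurable r)]
    rfl
  rw [h1, ((hasGaussianLaw_lin S (fun _ : Unit => u)).eval ()).map_eq_gaussianReal, integral_lin,
    ← covariance_self (measurable_lin u).aemeasurable, PCDAG.covariance_lin h.posDef, hu]
  simp

/-- The observations of the variables in `K` are independent of those of a functional that is
uncorrelated with these variables. -/
theorem indepFun_restrict_lin [IsProbabilityMeasure μ] (h : IsGaussianSample X S μ) {K : Finset V}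
    {u : V → ℝ} (hu : ∀ k ∈ K, (S *ᵥ u) k = 0) :
    IndepFun (fun ω (p : Fin n × K) => X p.1 ω p.2) (fun ω r => lin u (X r ω)) μ := by
  have hg : HasGaussianLaw (fun ω r => X r ω) μ := by
    refine h.indep.hasGaussianLaw fun r => ?_
    have : IsGaussian (μ.map (X r)) := by rw [h.law r]; infer_instance
    exact IsGaussian.hasGaussianLaw
  let L : (Fin n → EuclideanSpace ℝ V) →L[ℝ] ((Fin n × K → ℝ) × (Fin n → ℝ)) :=
    (ContinuousLinearMap.pi fun p : Fin n × K =>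
      (EuclideanSpace.proj p.2.1).comp (ContinuousLinearMap.proj p.1)).prod
    (ContinuousLinearMap.pi fun r : Fin n =>
      ((ContinuousLinearMap.proj ()).comp (linMap fun _ : Unit => u)).comp
        (ContinuousLinearMap.proj r))
  have hL : HasGaussianLaw (fun ω => (fun p : Fin n × K => X p.1 ω p.2,
      fun r => lin u (X r ω))) μ := by
    have h' := hg.map_fun L
    simpa [L, linMap_apply] using h'
  refine hL.indepFun_of_covariance_eval (X := fun (p : Fin n × K) ω => X p.1 ω p.2)
    (Y := fun r ω => lin u (X r ω)) fun p r => ?_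
  have hp : (fun ω => X p.1 ω p.2) = fun ω => lin (Pi.single p.2.1 1) (X p.1 ω) := by
    funext ω
    rw [lin_single]
  rw [hp]
  by_cases hpr : p.1 = r
  · rw [hpr, h.covariance_lin, form, single_one_dotProduct]
    exact hu _ p.2.2
  · have hind := (h.indep.indepFun hpr).comp (measurable_lin (Pi.single p.2.1 1)) (measurable_lin u)
    exact hind.covariance_eq_zero (h.memLp_lin _ _) (h.memLp_lin _ _)

theorem map_lin_pi (h : IsGaussianSample X S μ) {u : V → ℝ} (hu : form S u u = 1) :
    μ.map (fun ω r => lin u (X r ω)) = Measure.pi fun _ => gaussianReal 0 1 := by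
  rw [(h.indep_lin u).map_fun_eq_pi_map fun r => (h.measurable_lin_comp u r).aemeasurable]
  simp [h.map_lin hu]

theorem measure_sampleMom_self [IsProbabilityMeasure μ] (h : IsGaussianSample X S μ) (hn : n ≠ 0)
    (w : V → ℝ) {η : ℝ} (h0 : 0 ≤ η) (h1 : η ≤ 1) :
    μ {ω | η * form S w w < |sampleMom (fun r => X r ω) w w - form S w w|} ≤
      ENNReal.ofReal (2 * Real.exp (-(n * η ^ 2 / 8))) := by
  have hn' : (0 : ℝ) < n := Nat.cast_pos.2 (Nat.pos_of_ne_zero hn)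
  rcases eq_or_ne w 0 with rfl | hw
  · have h2 : {ω | η * form S 0 0 < |sampleMom (fun r => X r ω) 0 0 - form S 0 0|} = ∅ := by
      refine Set.eq_empty_iff_forall_notMem.2 fun ω hω => ?_
      have : η * form S 0 0 < |sampleMom (fun r => X r ω) 0 0 - form S 0 0| := hω
      simp [form, sampleMom, lin] at this
    rw [h2, measure_empty]
    exact zero_le
  · have hv : 0 < form S w w := posDefOn_of_posDef h.posDef Finset.univ w (fun v hv =>
      absurd (Finset.mem_univ v) hv) hw
    set u := (√(form S w w))⁻¹ • w with hu
    have hsq : (√(form S w w))⁻¹ * (√(form S w w))⁻¹ = (form S w w)⁻¹ := by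
      rw [← mul_inv, Real.mul_self_sqrt hv.le]
    have hu1 : form S u u = 1 := by
      rw [hu, form_smul_left, form_smul_right, ← mul_assoc, hsq, inv_mul_cancel₀ hv.ne']
    refine (measure_mono fun ω hω => ?_).trans (measure_chiSquare_le
      (h.measurable_lin_comp u) (h.indep_lin u) (h.map_lin hu1) h0 h1)
    have hω' : η * form S w w < |sampleMom (fun r => X r ω) w w - form S w w| := hω
    have hsum : ∑ r, lin u (X r ω) ^ 2 = n * (form S w w)⁻¹ * sampleMom (fun r => X r ω) w w := by
      rw [sampleMom, Finset.mul_sum, Finset.mul_sum]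
      refine Finset.sum_congr rfl fun r _ => ?_
      rw [hu, lin_smul, mul_pow, sq (√(form S w w))⁻¹, hsq]
      field_simp
    have heq : (∑ r, lin u (X r ω) ^ 2) - n =
        n * (form S w w)⁻¹ * (sampleMom (fun r => X r ω) w w - form S w w) := by
      rw [hsum]
      field_simp
    change n * η ≤ |(∑ r, lin u (X r ω) ^ 2) - n|
    rw [heq, abs_mul, abs_of_pos (by positivity)]
    calc n * η = n * (form S w w)⁻¹ * (η * form S w w) := by field_simp
      _ ≤ _ := by gcongr

theorem measure_sampleMom [IsProbabilityMeasure μ] (h : IsGaussianSample X S μ) (hn : n ≠ 0)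
    {u t : V → ℝ} (hu : form S u u = 1) (ht : form S t t = 1) {η : ℝ} (h0 : 0 ≤ η) (h1 : η ≤ 1) :
    μ {ω | η < |sampleMom (fun r => X r ω) u t - form S u t|} ≤
      ENNReal.ofReal (4 * Real.exp (-(n * η ^ 2 / 8))) := by
  have hp := h.measure_sampleMom_self hn (u + t) h0 h1
  have hm := h.measure_sampleMom_self hn (u - t) h0 h1
  have hcomm := form_comm (isSymm_of_posDef h.posDef) t u
  -- Polarization reduces the product of the functionals to the squares of their sum and difference.
  have hsub : {ω | η < |sampleMom (fun r => X r ω) u t - form S u t|} ⊆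
      {ω | η * form S (u + t) (u + t) <
        |sampleMom (fun r => X r ω) (u + t) (u + t) - form S (u + t) (u + t)|} ∪
      {ω | η * form S (u - t) (u - t) <
        |sampleMom (fun r => X r ω) (u - t) (u - t) - form S (u - t) (u - t)|} := by
    intro ω hω
    have hω' : η < |sampleMom (fun r => X r ω) u t - form S u t| := hω
    by_contra hcon
    rw [Set.mem_union, not_or] at hcon
    have c1 : |sampleMom (fun r => X r ω) (u + t) (u + t) - form S (u + t) (u + t)| ≤
      η * form S (u + t) (u + t) := not_lt.1 hcon.1
    have c2 : |sampleMom (fun r => X r ω) (u - t) (u - t) - form S (u - t) (u - t)| ≤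
      η * form S (u - t) (u - t) := not_lt.1 hcon.2
    have e1 : sampleMom (fun r => X r ω) (u + t) (u + t) -
        sampleMom (fun r => X r ω) (u - t) (u - t) = 4 * sampleMom (fun r => X r ω) u t := by
      simp only [sampleMom, lin_add, lin_sub]
      rw [← mul_sub, ← Finset.sum_sub_distrib, mul_left_comm]
      congr 1
      rw [Finset.mul_sum]
      exact Finset.sum_congr rfl fun r _ => by ring
    simp only [form_add_left, form_add_right, form_sub_left, form_sub_right, hu, ht, hcomm] at c1 c2
    rw [abs_le] at c1 c2
    rw [lt_abs] at hω'
    rcases hω' with hω' | hω' <;> linarith [c1.1, c1.2, c2.1, c2.2]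
  refine (measure_mono hsub).trans ((measure_union_le _ _).trans ((add_le_add hp hm).trans ?_))
  rw [← ENNReal.ofReal_add (by positivity) (by positivity)]
  exact ENNReal.ofReal_le_ofReal (by linarith)

theorem measure_sampleAvg [IsProbabilityMeasure μ] (h : IsGaussianSample X S μ) (hn : n ≠ 0)
    {u : V → ℝ} (hu : form S u u = 1) (η : ℝ) :
    μ {ω | η < sampleAvg (fun r => X r ω) u ^ 2} ≤
      ENNReal.ofReal (2 * Real.exp (-(n * η / 4))) := by
  have hn' : (0 : ℝ) < n := Nat.cast_pos.2 (Nat.pos_of_ne_zero hn)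
  have hb := measure_projSq_le (μ := μ) (κ := Unit) (ι := Unit) (Y := fun _ _ => (0 : ℝ))
    (g := fun ω r => lin u (X r ω)) (by fun_prop)
    (measurable_pi_lambda _ fun r => h.measurable_lin_comp u r)
    (indepFun_const_left _ _) (h.map_lin_pi hu)
    (Z := fun _ => Matrix.of fun _ _ => 1) continuous_const (n * η)
  rw [Fintype.card_unit, pow_one] at hb
  refine (measure_mono fun ω hω => ?_).trans hb
  have hω' : η < sampleAvg (fun r => X r ω) u ^ 2 := hω
  rw [sampleAvg_sq hn, ← div_eq_inv_mul, lt_div_iff₀' hn'] at hω'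
  exact hω'.le

theorem measure_explained [IsProbabilityMeasure μ] (h : IsGaussianSample X S μ) (hn : n ≠ 0)
    {K : Finset V} {u : V → ℝ} (hu : form S u u = 1) (hK : ∀ k ∈ K, (S *ᵥ u) k = 0) (η : ℝ) :
    μ {ω | η < explained (sampleCov fun r => X r ω) K u u} ≤
      ENNReal.ofReal (2 ^ K.card * Real.exp (-(n * η / 4))) := by
  have hn' : (0 : ℝ) < n := Nat.cast_pos.2 (Nat.pos_of_ne_zero hn)
  have hb := measure_projSq_le (μ := μ) (κ := K) (ι := Fin n × K)
    (Y := fun ω (p : Fin n × K) => X p.1 ω p.2) (g := fun ω r => lin u (X r ω))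
    (measurable_pi_lambda _ fun p => by have := h.measurable p.1; fun_prop)
    (measurable_pi_lambda _ fun r => h.measurable_lin_comp u r)
    (h.indepFun_restrict_lin hK) (h.map_lin_pi hu)
    (Z := fun y => Matrix.of fun r k => y (r, k) - (n : ℝ)⁻¹ * ∑ s, y (s, k))
    (by
      refine continuous_matrix fun r k => ?_
      simp only [of_apply]
      fun_prop) (n * η)
  rw [Fintype.card_coe] at hb
  refine (measure_mono fun ω hω => ?_).trans hb
  have hω' : η < explained (sampleCov fun r => X r ω) K u u := hω
  rw [explained_sampleCov hn, ← div_eq_inv_mul, lt_div_iff₀' hn'] at hω'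
  exact hω'.le

/-- The probability that a sample is bad for two functionals that are uncorrelated with the
variables in `K`. -/
theorem measure_not_sampleGood [IsProbabilityMeasure μ] (h : IsGaussianSample X S μ) (hn : n ≠ 0)
    {K : Finset V} {u t : V → ℝ} (hu : form S u u = 1) (ht : form S t t = 1)
    (huK : ∀ k ∈ K, (S *ᵥ u) k = 0) (htK : ∀ k ∈ K, (S *ᵥ t) k = 0) {η : ℝ} (h0 : 0 ≤ η)
    (h1 : η ≤ 1) :
    μ {ω | ¬ SampleGood S (fun r => X r ω) K u t η} ≤
      ENNReal.ofReal (4 * Real.exp (-(n * η ^ 2 / 8)) +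
        6 * 2 ^ K.card * Real.exp (-(n * η / 4))) := by
  have hsub : {ω | ¬ SampleGood S (fun r => X r ω) K u t η} ⊆
      {ω | η < |sampleMom (fun r => X r ω) u t - form S u t|} ∪
      ({ω | η < sampleAvg (fun r => X r ω) u ^ 2} ∪ {ω | η < sampleAvg (fun r => X r ω) t ^ 2} ∪
      ({ω | η < explained (sampleCov fun r => X r ω) K u u} ∪
        {ω | η < explained (sampleCov fun r => X r ω) K t t})) := by
    intro ω hω
    by_contra hcon
    simp only [Set.mem_union, not_or] at hcon
    obtain ⟨c1, ⟨c2, c3⟩, c4, c5⟩ := hcon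
    exact hω ⟨not_lt.1 c1, not_lt.1 c2, not_lt.1 c3, not_lt.1 c4, not_lt.1 c5⟩
  have hpow : (1 : ℝ) ≤ 2 ^ K.card := one_le_pow₀ (by norm_num)
  refine (measure_mono hsub).trans ((measure_union_le _ _).trans ((add_le_add
    (h.measure_sampleMom hn hu ht h0 h1) ((measure_union_le _ _).trans (add_le_add
      ((measure_union_le _ _).trans (add_le_add (h.measure_sampleAvg hn hu η)
        (h.measure_sampleAvg hn ht η)))
      ((measure_union_le _ _).trans (add_le_add (h.measure_explained hn hu huK η)
        (h.measure_explained hn ht htK η)))))).trans ?_))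
  rw [← ENNReal.ofReal_add (by positivity) (by positivity),
    ← ENNReal.ofReal_add (by positivity) (by positivity),
    ← ENNReal.ofReal_add (by positivity) (by positivity),
    ← ENNReal.ofReal_add (by positivity) (by positivity)]
  refine ENNReal.ofReal_le_ofReal ?_
  have := mul_le_mul_of_nonneg_right hpow (Real.exp_pos (-(n * η / 4))).le
  linarith

end IsGaussianSample

end Data

end PCDAG

namespace PCDAG

/-! ### Sample conditional covariances and sample partial correlations -/

section CondGood

variable {V : Type*} [Fintype V] [DecidableEq V] {n : ℕ} {S : Matrix V V ℝ}

/-- The functional of the residual of the variable `i` given the variables in `K`, scaled to unit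
variance. -/
noncomputable def unitRes (S : Matrix V V ℝ) (i : V) (K : Finset V) : V → ℝ :=
  (√(condVar S i K))⁻¹ • resVec S i K

theorem condVar_pos_of_posDef (hS : S.PosDef) {i : V} {K : Finset V} (hi : i ∉ K) :
    0 < condVar S i K :=
  condVar_pos (isSymm_of_posDef hS) (posDefOn_of_posDef hS _) hi

theorem sqrt_smul_unitRes (hS : S.PosDef) {i : V} {K : Finset V} (hi : i ∉ K) :
    √(condVar S i K) • unitRes S i K = resVec S i K := by
  rw [unitRes, smul_smul, mul_inv_cancel₀ (Real.sqrt_pos.2 (condVar_pos_of_posDef hS hi)).ne',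
    one_smul]

theorem form_unitRes (hS : S.PosDef) {i : V} {K : Finset V} (hi : i ∉ K) :
    form S (unitRes S i K) (unitRes S i K) = 1 := by
  have hv := condVar_pos_of_posDef hS hi
  rw [unitRes, form_smul_left, form_smul_right,
    ← condVar_eq_form (isSymm_of_posDef hS) (posDefOn_of_posDef hS K), ← mul_assoc, ← mul_inv,
    Real.mul_self_sqrt hv.le, inv_mul_cancel₀ hv.ne']

theorem mulVec_unitRes (hS : S.PosDef) (i : V) {K : Finset V} {k : V} (hk : k ∈ K) :
    (S *ᵥ unitRes S i K) k = 0 := by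
  rw [unitRes, mulVec_smul, Pi.smul_apply,
    (isResidual_resVec (isSymm_of_posDef hS) (posDefOn_of_posDef hS K) i).orth k hk, smul_zero]

theorem explained_smul_smul (T : Matrix V V ℝ) (K : Finset V) (a b : ℝ) (u t : V → ℝ) :
    explained T K (a • u) (b • t) = a * b * explained T K u t := by
  have h : ∀ (c : ℝ) (w : V → ℝ), (fun k : K => (T *ᵥ (c • w)) k) = c • fun k : K => (T *ᵥ w) k :=
    fun c w => by
      funext k
      simp [mulVec_smul]
  rw [explained, h, h, mulVec_smul, smul_dotProduct, dotProduct_smul, explained, smul_eq_mul,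
    smul_eq_mul, mul_assoc]

/-- The sample deviates by at most `η` from what is expected of the residuals of the variables `i`
and `j` given the variables in `K`. -/
def CondGood (S : Matrix V V ℝ) (x : Fin n → EuclideanSpace ℝ V) (η : ℝ) (i j : V)
    (K : Finset V) : Prop :=
  SampleGood S x K (unitRes S i K) (unitRes S j K) η

variable {x : Fin n → EuclideanSpace ℝ V} {η : ℝ} {i j : V} {K : Finset V}

theorem CondGood.abs_condCov_sub_le (h : CondGood S x η i j K) (hS : S.PosDef) (hn : n ≠ 0)
    (hi : i ∉ K) (hj : j ∉ K) (hK : PosDefOn (sampleCov x) K) :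
    |condCov (sampleCov x) i j K - condCov S i j K| ≤
      3 * η * (√(condVar S i K) * √(condVar S j K)) := by
  have hSs := isSymm_of_posDef hS
  have hSK := posDefOn_of_posDef hS K
  have hb := h.abs_sub_le hn hK
  rw [condCov_eq_form_sub_explained (isSymm_sampleCov x) hK (isResidual_resVec hSs hSK i).supp
    (isResidual_resVec hSs hSK j).supp, condCov_eq_form hSs hSK, ← sqrt_smul_unitRes hS hi,
    ← sqrt_smul_unitRes hS hj, explained_smul_smul, form_smul_left, form_smul_right,
    form_smul_left, form_smul_right]
  have hnn : 0 ≤ √(condVar S i K) * √(condVar S j K) := by positivity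
  calc _ = |(√(condVar S i K) * √(condVar S j K)) *
        (form (sampleCov x) (unitRes S i K) (unitRes S j K) -
          explained (sampleCov x) K (unitRes S i K) (unitRes S j K) -
          form S (unitRes S i K) (unitRes S j K))| := by congr 1; ring
    _ ≤ _ := by
      rw [abs_mul, abs_of_nonneg hnn, mul_comm]
      exact mul_le_mul_of_nonneg_right hb hnn

theorem CondGood.abs_condVar_sub_le (h : CondGood S x η i i K) (hS : S.PosDef) (hn : n ≠ 0)
    (hi : i ∉ K) (hK : PosDefOn (sampleCov x) K) :
    |condVar (sampleCov x) i K - condVar S i K| ≤ 3 * η * condVar S i K := by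
  have := h.abs_condCov_sub_le hS hn hi hi hK
  rwa [Real.mul_self_sqrt (condVar_pos_of_posDef hS hi).le] at this

theorem posDefOn_sampleCov {q : ℕ} (hS : S.PosDef) (hn : n ≠ 0) (hη : 3 * η < 1)
    (h : ∀ i (K : Finset V), i ∉ K → K.card ≤ q → CondGood S x η i i K) (K : Finset V)
    (hK : K.card ≤ q + 1) : PosDefOn (sampleCov x) K := by
  refine posDefOn_of_condVar_pos (isSymm_sampleCov x) (fun i K hi hK hpd => ?_) K hK
  have h1 := ((abs_le.1 ((h i K hi hK).abs_condVar_sub_le hS hn hi hpd)).1)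
  have h2 := condVar_pos_of_posDef hS hi
  nlinarith

theorem condCov_sq_le (hS : S.PosDef) (i j : V) (K : Finset V) :
    condCov S i j K ^ 2 ≤ condVar S i K * condVar S j K := by
  have hSs := isSymm_of_posDef hS
  have hSK := posDefOn_of_posDef hS K
  rw [condCov_eq_form hSs hSK, condVar_eq_form hSs hSK, condVar_eq_form hSs hSK]
  refine form_sq_le hSs fun c => ?_
  have := hS.posSemidef.dotProduct_mulVec_nonneg (resVec S i K + c • resVec S j K)
  rwa [star_trivial] at this

theorem abs_condCov_le (hS : S.PosDef) (i j : V) (K : Finset V) :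
    |condCov S i j K| ≤ √(condVar S i K) * √(condVar S j K) := by
  rw [← Real.sqrt_mul (condVar_nonneg (isSymm_of_posDef hS) (posDefOn_of_posDef hS _)
    (posDefOn_of_posDef hS _))]
  exact Real.abs_le_sqrt (condCov_sq_le hS i j K)

theorem abs_div_sub_div_le {A a X Y δ B r : ℝ} (hr : 0 < r) (hY : r ≤ Y) (hX : r / 2 ≤ X)
    (hA : |A - a| ≤ δ) (hXY : |X - Y| ≤ δ) (ha : |a| ≤ B) :
    |A / X - a / Y| ≤ (2 / r + 2 * B / r ^ 2) * δ := by
  have hY0 : 0 < Y := hr.trans_le hY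
  have hX0 : 0 < X := (half_pos hr).trans_le hX
  have hB : 0 ≤ B := (abs_nonneg _).trans ha
  have hδ : 0 ≤ δ := (abs_nonneg _).trans hA
  have h : A / X - a / Y = (A - a) / X - a * (X - Y) / (X * Y) := by field_simp; ring
  rw [h]
  refine (abs_sub _ _).trans ?_
  rw [abs_div, abs_div, abs_mul, abs_of_pos hX0, abs_of_pos (mul_pos hX0 hY0)]
  have h1 : |A - a| / X ≤ δ / (r / 2) := div_le_div₀ hδ hA (half_pos hr) hX
  have h2 : |a| * |X - Y| / (X * Y) ≤ B * δ / (r / 2 * r) :=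
    div_le_div₀ (by positivity) (mul_le_mul ha hXY (abs_nonneg _) hB) (by positivity)
      (mul_le_mul hX hY hr.le hX0.le)
  calc _ ≤ δ / (r / 2) + B * δ / (r / 2 * r) := add_le_add h1 h2
    _ = _ := by field_simp

theorem CondGood.abs_partialCorr_sub_le (hij : CondGood S x η i j K) (hii : CondGood S x η i i K)
    (hjj : CondGood S x η j j K) (hS : S.PosDef) (hn : n ≠ 0) (hi : i ∉ K) (hj : j ∉ K)
    (hη : 6 * η ≤ 1) (hK : PosDefOn (sampleCov x) K) :
    |partialCorr (sampleCov x) i j K - partialCorr S i j K| ≤ 12 * η := by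
  have hη0 : 0 ≤ η := (sq_nonneg _).trans hij.avg_left
  have h1 := hij.abs_condCov_sub_le hS hn hi hj hK
  have h2 := abs_le.1 (hii.abs_condVar_sub_le hS hn hi hK)
  have h3 := abs_le.1 (hjj.abs_condVar_sub_le hS hn hj hK)
  have hvi := condVar_pos_of_posDef hS hi
  have hvj := condVar_pos_of_posDef hS hj
  have hc := abs_condCov_le hS i j K
  rw [partialCorr, partialCorr]
  set Y := √(condVar S i K) * √(condVar S j K) with hY
  set X := √(condVar (sampleCov x) i K) * √(condVar (sampleCov x) j K) with hX
  have hY0 : 0 < Y := by positivity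
  have hX0 : 0 ≤ X := by positivity
  have hYsq : Y ^ 2 = condVar S i K * condVar S j K := by
    rw [hY, mul_pow, Real.sq_sqrt hvi.le, Real.sq_sqrt hvj.le]
  have hXsq : X ^ 2 = condVar (sampleCov x) i K * condVar (sampleCov x) j K := by
    rw [hX, mul_pow, Real.sq_sqrt (by nlinarith), Real.sq_sqrt (by nlinarith)]
  have hlo : (1 - 3 * η) * Y ≤ X := by
    refine le_of_sq_le_sq ?_ hX0
    rw [mul_pow, hYsq, hXsq]
    calc _ = ((1 - 3 * η) * condVar S i K) * ((1 - 3 * η) * condVar S j K) := by ring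
      _ ≤ _ := mul_le_mul (by linarith) (by linarith)
        (mul_nonneg (by linarith) hvj.le) (by nlinarith)
  have hup : X ≤ (1 + 3 * η) * Y := by
    refine le_of_sq_le_sq ?_ (by positivity)
    rw [hXsq, mul_pow, hYsq]
    calc _ ≤ ((1 + 3 * η) * condVar S i K) * ((1 + 3 * η) * condVar S j K) :=
        mul_le_mul (by linarith) (by linarith) (by nlinarith) (by positivity)
      _ = _ := by ring
  have hmain := abs_div_sub_div_le (A := condCov (sampleCov x) i j K) (X := X) (δ := 3 * η * Y)
    (B := Y) hY0 le_rfl (by nlinarith) h1 (abs_le.2 ⟨by linarith, by linarith⟩) hc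
  refine hmain.trans (le_of_eq ?_)
  field_simp
  ring

theorem IsGaussianSample.measure_not_condGood {Ω : Type*} [MeasurableSpace Ω] {μ : Measure Ω}
    [IsProbabilityMeasure μ] {X : Fin n → Ω → EuclideanSpace ℝ V} (h : IsGaussianSample X S μ)
    (hn : n ≠ 0) (hi : i ∉ K) (hj : j ∉ K) (h0 : 0 ≤ η) (h1 : η ≤ 1) :
    μ {ω | ¬ CondGood S (fun r => X r ω) η i j K} ≤
      ENNReal.ofReal (4 * Real.exp (-(n * η ^ 2 / 8)) +
        6 * 2 ^ K.card * Real.exp (-(n * η / 4))) :=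
  h.measure_not_sampleGood hn (form_unitRes h.posDef hi) (form_unitRes h.posDef hj)
    (fun _ hk => mulVec_unitRes h.posDef i hk) (fun _ hk => mulVec_unitRes h.posDef j hk) h0 h1

end CondGood

/-! ### The tests of the PC-algorithm -/

theorem strictMono_stdNormalCDF : StrictMono stdNormalCDF := by
  intro s t hst
  have hpos : 0 < gaussianReal 0 1 (Set.Ioc s t) := by
    rw [pos_iff_ne_zero]
    intro h
    have := gaussianReal_absolutelyContinuous' 0 (one_ne_zero (α := NNReal)) h
    rw [Real.volume_Ioc, ENNReal.ofReal_eq_zero] at this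
    linarith
  have hdis : Disjoint (Set.Iic s) (Set.Ioc s t) :=
    Set.disjoint_left.2 fun _ h1 h2 => not_lt.2 h1 h2.1
  have := measureReal_union (μ := gaussianReal 0 1) hdis measurableSet_Ioc
  rw [Set.Iic_union_Ioc_eq_Iic hst.le] at this
  rw [stdNormalCDF, stdNormalCDF, cdf_eq_real, cdf_eq_real, this]
  have := ENNReal.toReal_pos hpos.ne' (measure_ne_top _ _)
  rw [measureReal_def (gaussianReal 0 1) (Set.Ioc s t)]
  linarith

theorem stdNormalQuantile_stdNormalCDF (t : ℝ) : stdNormalQuantile (stdNormalCDF t) = t := by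
  have : {s : ℝ | stdNormalCDF t ≤ stdNormalCDF s} = Set.Ici t := by
    ext s
    exact strictMono_stdNormalCDF.le_iff_le
  rw [stdNormalQuantile, this, csInf_Ici]

/-- Fisher's z-transformation `½ log ((1 + y) / (1 - y))`. -/
noncomputable def zTransform (y : ℝ) : ℝ := (1 / 2) * Real.log ((1 + y) / (1 - y))

theorem zTransform_neg (y : ℝ) : zTransform (-y) = -zTransform y := by
  rw [zTransform, zTransform, sub_neg_eq_add, ← sub_eq_add_neg, ← inv_div (1 + y), Real.log_inv]
  ring

theorem abs_zTransform (y : ℝ) : |zTransform y| = |zTransform (|y|)| := by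
  rcases abs_choice y with h | h
  · rw [h]
  · rw [h, zTransform_neg, abs_neg]

theorem abs_le_abs_zTransform {y : ℝ} (hy : |y| < 1) : |y| ≤ |zTransform y| := by
  rw [abs_zTransform]
  set z := |y| with hz
  have hz0 : 0 ≤ z := abs_nonneg y
  refine le_trans ?_ (le_abs_self _)
  have hs := Real.hasSum_log_sub_log_of_abs_lt_one (x := z) (by rwa [abs_of_nonneg hz0])
  have h := le_hasSum hs 0 fun k _ => by positivity
  rw [zTransform, Real.log_div (by linarith) (by linarith)]
  norm_num at h
  linarith

theorem abs_zTransform_le {y : ℝ} (hy : |y| ≤ 1 / 4) : |zTransform y| ≤ 2 * |y| := by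
  rw [abs_zTransform]
  set z := |y| with hz
  have hz0 : 0 ≤ z := abs_nonneg y
  have h1 : (1 + z) / (1 - z) ≥ 1 := by
    rw [ge_iff_le, one_le_div (by linarith)]
    linarith
  rw [zTransform, abs_of_nonneg (mul_nonneg (by norm_num) (Real.log_nonneg h1))]
  have h2 := Real.log_le_sub_one_of_pos (lt_of_lt_of_le one_pos h1)
  have h3 : (1 + z) / (1 - z) - 1 ≤ 4 * z := by
    rw [sub_le_iff_le_add, div_le_iff₀ (by linarith)]
    nlinarith
  linarith

/-- With the tuning parameter `α = 2 (1 - Φ(√n c / 2))` the test detects whether a partial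
correlation vanishes, as soon as the sample partial correlation is close to the true one. -/
theorem testIndep_iff {V : Type*} [Fintype V] [DecidableEq V] {n : ℕ}
    {x : Fin n → EuclideanSpace ℝ V} {i j : V} {K : Finset V} {ρ c M : ℝ} (hc : 0 < c)
    (hM : M < 1) (hρM : |ρ| ≤ M) (hρc : ρ ≠ 0 → c ≤ |ρ|) (hn : 9 * (K.card + 3) < 5 * n)
    (h : |partialCorr (sampleCov x) i j K - ρ| ≤ min (min c 1) (1 - M) / 4) :
    TestIndep x (2 * (1 - stdNormalCDF (√(n : ℝ) * c / 2))) i j K ↔ ρ = 0 := by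
  have hα : 1 - 2 * (1 - stdNormalCDF (√(n : ℝ) * c / 2)) / 2 = stdNormalCDF (√(n : ℝ) * c / 2) := by
    ring
  have hZ : fisherZ x i j K = zTransform (partialCorr (sampleCov x) i j K) := rfl
  rw [TestIndep, hα, stdNormalQuantile_stdNormalCDF, hZ]
  set y := partialCorr (sampleCov x) i j K with hy
  have hm1 : min (min c 1) (1 - M) ≤ c := (min_le_left _ _).trans (min_le_left _ _)
  have hm2 : min (min c 1) (1 - M) ≤ 1 := (min_le_left _ _).trans (min_le_right _ _)
  have hm3 : min (min c 1) (1 - M) ≤ 1 - M := min_le_right _ _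
  have hnR : (9 : ℝ) * (K.card + 3) < 5 * n := by exact_mod_cast hn
  have hk0 : (0 : ℝ) ≤ K.card := Nat.cast_nonneg _
  constructor
  · intro ht
    by_contra hρ
    have hcρ := hρc hρ
    have h1 : 3 / 4 * c ≤ |y| := by
      have := abs_sub_abs_le_abs_sub ρ y
      rw [abs_sub_comm] at this
      linarith
    have h2 : |y| < 1 := by
      have := abs_sub_abs_le_abs_sub y ρ
      linarith
    have h3 : 3 / 4 * c ≤ |zTransform y| := h1.trans (abs_le_abs_zTransform h2)
    have h4 : 2 / 3 * √(n : ℝ) < √((n : ℝ) - K.card - 3) := by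
      refine Real.lt_sqrt_of_sq_lt ?_
      rw [mul_pow, Real.sq_sqrt (Nat.cast_nonneg n)]
      linarith
    have h5 := mul_lt_mul h4 h3 (by positivity) (Real.sqrt_nonneg _)
    linarith
  · rintro rfl
    rw [sub_zero] at h
    have h1 := abs_zTransform_le (h.trans (by linarith))
    have h2 : √((n : ℝ) - K.card - 3) ≤ √(n : ℝ) := Real.sqrt_le_sqrt (by linarith)
    have h3 : |zTransform y| ≤ c / 2 := by linarith
    calc _ ≤ √(n : ℝ) * (c / 2) := mul_le_mul h2 h3 (abs_nonneg _) (Real.sqrt_nonneg _)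
      _ = _ := by ring

end PCDAG

namespace PCDAG

/-! ### Deterministic bounds for a good sample -/

section Deterministic

variable {V : Type*} [Fintype V] [DecidableEq V] {n : ℕ} {S : Matrix V V ℝ} {G D : DAG V}
  {x : Fin n → EuclideanSpace ℝ V}

/-- If all sample conditional covariances given at most `q` variables are close to the true ones,
then the tests of these orders decide correctly and the DAG estimate is equivalent to the true one.
Its concentration matrix is then the one computed from the true DAG. -/
theorem IsPCDAG.dagConcentration_eq {c M η : ℝ} (hS : S.PosDef)
    (hG : IsFaithful (multivariateGaussian 0 S) G) (hc : 0 < c) (hM : M < 1)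
    (hE : ∀ (i j : V) (K : Finset V), i ≠ j → i ∉ K → j ∉ K → |partialCorr S i j K| ≤ M)
    (hE' : ∀ (i j : V) (K : Finset V), i ≠ j → i ∉ K → j ∉ K →
      partialCorr S i j K ≠ 0 → c ≤ |partialCorr S i j K|)
    (hn : 9 * (G.maxAdj + 3) < 5 * n) (hη : 48 * η ≤ min (min c 1) (1 - M))
    (hgood : ∀ (i j : V) (K : Finset V), i ∉ K → j ∉ K → K.card ≤ G.maxAdj →
      CondGood S x η i j K)
    (hD : IsPCDAG x (2 * (1 - stdNormalCDF (√(n : ℝ) * c / 2))) D) :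
    dagConcentration (sampleCov x) D = dagConcentration (sampleCov x) G ∧
      ∀ K : Finset V, K.card ≤ G.maxAdj + 1 → PosDefOn (sampleCov x) K := by
  have hn0 : n ≠ 0 := by omega
  have hη1 : 48 * η ≤ 1 := hη.trans ((min_le_left _ _).trans (min_le_right _ _))
  have hpd : ∀ K : Finset V, K.card ≤ G.maxAdj + 1 → PosDefOn (sampleCov x) K :=
    posDefOn_sampleCov hS hn0 (by linarith) fun i K hi hK => hgood i i K hi hi hK
  refine ⟨?_, hpd⟩
  obtain ⟨H, E, hout, hext⟩ := hD
  have hdec : DecidesDSep (TestIndep x (2 * (1 - stdNormalCDF (√(n : ℝ) * c / 2)))) G := by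
    intro i j K hij hi hj hK
    rw [← partialCorr_eq_zero_iff_dSep hS hG hij hi hj]
    refine testIndep_iff hc hM (hE i j K hij hi hj) (hE' i j K hij hi hj) (by omega) ?_
    refine ((hgood i j K hi hj hK).abs_partialCorr_sub_le (hgood i i K hi hi hK)
      (hgood j j K hj hj hK) hS hn0 hi hj (by linarith) (hpd K (by omega))).trans ?_
    linarith
  exact dagConcentration_eq_of_equivalent (isSymm_sampleCov x) (hout.equivalent hdec hext) hpd

theorem abs_mul_sub_mul_le {a b a' b' L δ : ℝ} (ha : |a| ≤ L) (hb : |b| ≤ L) (haa : |a' - a| ≤ δ)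
    (hbb : |b' - b| ≤ δ) : |a' * b' - a * b| ≤ (2 * L + δ) * δ := by
  have h : a' * b' - a * b = (a' - a) * (b' - b) + a * (b' - b) + b * (a' - a) := by ring
  have hL : 0 ≤ L := (abs_nonneg _).trans ha
  have hδ : 0 ≤ δ := (abs_nonneg _).trans haa
  rw [h]
  refine (abs_add_three _ _ _).trans ?_
  rw [abs_mul, abs_mul, abs_mul]
  have h1 := mul_le_mul haa hbb (abs_nonneg _) hδ
  have h2 := mul_le_mul ha hbb (abs_nonneg _) hL
  have h3 := mul_le_mul hb haa (abs_nonneg _) hL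
  linarith

theorem condVar_le_diag (hS : S.PosDef) {i : V} {K : Finset V} (hi : i ∉ K) :
    condVar S i K ≤ S i i := by
  have hSs := isSymm_of_posDef hS
  induction K using Finset.induction_on with
  | empty => simp [condVar, condCov, dotProduct]
  | insert k K hk ih =>
    have hi' : i ∉ K := fun h => hi (Finset.mem_insert_of_mem h)
    rw [condVar_insert hSs (posDefOn_of_posDef hS _) hk]
    have := div_nonneg (sq_nonneg (condCov S k i K)) (condVar_pos_of_posDef hS hk).le
    linarith [ih hi']

/-- The factor of `η` in the error bound for a regression coefficient, when variances are at most
`σ2` and the residual variances of the regressors are at least `r`. -/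
noncomputable def coefConst (σ2 r : ℝ) : ℝ := (2 / r + 2 * σ2 / r ^ 2) * (3 * σ2)

/-- The factor of `η` in the error bound for one summand of an entry of the concentration matrix of
a DAG, with `σ2` and `r` as in `coefConst`. -/
noncomputable def concConst (σ2 r : ℝ) : ℝ :=
  (2 / r + 2 * (1 + σ2 / r) ^ 2 / r ^ 2) *
    (3 * σ2 + (2 * (1 + σ2 / r) + coefConst σ2 r) * coefConst σ2 r)

/-- The estimation error of the concentration matrix is bounded by the number of nonzero summands of
an entry, one for the variable itself and one for each of its children, times the error of the
residual variances and regression coefficients. -/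
theorem abs_dagConcentration_sub_le {σ2 r η : ℝ} (hS : S.PosDef) (hn : n ≠ 0)
    (hσ : ∀ i, S i i ≤ σ2) (hr : 0 < r)
    (hrj : ∀ i, ∀ j ∈ G.parents i, r ≤ condVar S j ((G.parents i).erase j))
    (hri : ∀ i, r ≤ condVar S i (G.parents i)) (hη : 6 * η ≤ 1)
    (hpd : ∀ K : Finset V, K.card ≤ G.maxAdj + 1 → PosDefOn (sampleCov x) K)
    (h1 : ∀ l, CondGood S x η l l (G.parents l))
    (h2 : ∀ l, ∀ i ∈ G.parents l, CondGood S x η i l ((G.parents l).erase i))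
    (h3 : ∀ l, ∀ i ∈ G.parents l, CondGood S x η i i ((G.parents l).erase i)) (i j : V) :
    |dagConcentration (sampleCov x) G i j - dagConcentration S G i j| ≤
      (G.maxAdj + 1) * (concConst σ2 r * η) := by
  have hη0 : 0 ≤ η := (sq_nonneg _).trans (h1 i).avg_left
  have hσr : r ≤ σ2 :=
    (hri i).trans ((condVar_le_diag hS (G.self_notMem_parents i)).trans (hσ i))
  have hσ0 : 0 < σ2 := hr.trans_le hσr
  have hC0 : 0 ≤ coefConst σ2 r := by unfold coefConst; positivity
  have hSs := isSymm_of_posDef hS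
  have hTs := isSymm_sampleCov x
  have hpa : ∀ l, PosDefOn (sampleCov x) (G.parents l) := fun l =>
    hpd _ ((G.card_parents_le_maxAdj l).trans (Nat.le_succ _))
  have hvar : ∀ l, |condVar (sampleCov x) l (G.parents l) - condVar S l (G.parents l)| ≤
      3 * η * σ2 := fun l =>
    ((h1 l).abs_condVar_sub_le hS hn (G.self_notMem_parents l) (hpa l)).trans
      (mul_le_mul_of_nonneg_left ((condVar_le_diag hS (G.self_notMem_parents l)).trans (hσ l))
        (by linarith))
  have hvarT : ∀ l, r / 2 ≤ condVar (sampleCov x) l (G.parents l) := fun l => by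
    have := (abs_le.1 ((h1 l).abs_condVar_sub_le hS hn (G.self_notMem_parents l) (hpa l))).1
    nlinarith [hri l]
  have hcoef : ∀ l i, i ∈ G.parents l →
      |resVec S l (G.parents l) i| ≤ σ2 / r ∧
      |resVec (sampleCov x) l (G.parents l) i - resVec S l (G.parents l) i| ≤
        coefConst σ2 r * η := by
    intro l i hi
    have hl := G.self_notMem_parents l
    have hle : l ∉ (G.parents l).erase i := fun h => hl (Finset.mem_of_mem_erase h)
    have hie := Finset.notMem_erase i (G.parents l)
    have hpe := (hpa l).mono (Finset.erase_subset i (G.parents l))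
    rw [resVec_apply_of_mem_eq_div hSs (posDefOn_of_posDef hS _) hi hl,
      resVec_apply_of_mem_eq_div hTs (hpa l) hi hl]
    have hvi := (condVar_le_diag hS hie).trans (hσ i)
    have hvl := (condVar_le_diag hS hle).trans (hσ l)
    have hsq : √(condVar S i ((G.parents l).erase i)) * √(condVar S l ((G.parents l).erase i)) ≤
        σ2 := by
      calc _ ≤ √σ2 * √σ2 := mul_le_mul (Real.sqrt_le_sqrt hvi) (Real.sqrt_le_sqrt hvl)
            (Real.sqrt_nonneg _) (Real.sqrt_nonneg _)
        _ = σ2 := Real.mul_self_sqrt hσ0.le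
    have hg := (abs_condCov_le hS i l ((G.parents l).erase i)).trans hsq
    have hri' := hrj l i hi
    have hA := ((h2 l i hi).abs_condCov_sub_le hS hn hie hle hpe).trans
      (mul_le_mul_of_nonneg_left hsq (by linarith))
    have hX := (h3 l i hi).abs_condVar_sub_le hS hn hie hpe
    have hX' := hX.trans (mul_le_mul_of_nonneg_left hvi (by linarith))
    constructor
    · rw [abs_neg, abs_div, abs_of_pos (hr.trans_le hri')]
      exact div_le_div₀ hσ0.le hg hr hri'
    · rw [neg_sub_neg, abs_sub_comm]
      refine (abs_div_sub_div_le hr hri' ?_ hA hX' hg).trans (le_of_eq ?_)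
      · have := (abs_le.1 hX).1
        nlinarith
      · rw [coefConst]
        ring
  have hvec : ∀ l i, |resVec S l (G.parents l) i| ≤ 1 + σ2 / r ∧
      |resVec (sampleCov x) l (G.parents l) i - resVec S l (G.parents l) i| ≤
        coefConst σ2 r * η := by
    intro l i
    by_cases hi : i ∈ G.parents l
    · exact ⟨(hcoef l i hi).1.trans (by linarith), (hcoef l i hi).2⟩
    · have h : ∀ T : Matrix V V ℝ, resVec T l (G.parents l) i = if i = l then 1 else 0 := by
        intro T
        simp [resVec, extendZero, hi, Pi.single_apply]
      rw [h, h, sub_self, abs_zero]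
      refine ⟨?_, by positivity⟩
      have : 0 ≤ σ2 / r := by positivity
      split_ifs <;> simp <;> linarith
  rw [dagConcentration_apply _ _ fun l => ((half_pos hr).trans_le (hvarT l)).ne',
    dagConcentration_apply _ _ fun l => (hr.trans_le (hri l)).ne', ← Finset.sum_sub_distrib]
  have hterm : ∀ l, |resVec (sampleCov x) l (G.parents l) i *
      resVec (sampleCov x) l (G.parents l) j / condVar (sampleCov x) l (G.parents l) -
      resVec S l (G.parents l) i * resVec S l (G.parents l) j / condVar S l (G.parents l)| ≤
      concConst σ2 r * η := by
    intro l
    have hprod := abs_mul_sub_mul_le (hvec l i).1 (hvec l j).1 (hvec l i).2 (hvec l j).2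
    have hB : |resVec S l (G.parents l) i * resVec S l (G.parents l) j| ≤ (1 + σ2 / r) ^ 2 := by
      rw [abs_mul, sq]
      exact mul_le_mul (hvec l i).1 (hvec l j).1 (abs_nonneg _) (by positivity)
    have hδ : (2 * (1 + σ2 / r) + coefConst σ2 r * η) * (coefConst σ2 r * η) ≤
        (2 * (1 + σ2 / r) + coefConst σ2 r) * coefConst σ2 r * η := by
      have : coefConst σ2 r * η ≤ coefConst σ2 r := mul_le_of_le_one_right hC0 (by linarith)
      rw [← mul_assoc]
      exact mul_le_mul_of_nonneg_right (mul_le_mul_of_nonneg_right (by linarith) hC0) hη0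
    have hδ0 : 0 ≤ (2 * (1 + σ2 / r) + coefConst σ2 r) * coefConst σ2 r * η := by positivity
    have hσ3 : 0 ≤ 3 * σ2 * η := by positivity
    refine (abs_div_sub_div_le (δ := (3 * σ2 + (2 * (1 + σ2 / r) + coefConst σ2 r) *
      coefConst σ2 r) * η) hr (hri l) (hvarT l) (hprod.trans (by linarith))
      ((hvar l).trans (by linarith)) hB).trans (le_of_eq ?_)
    rw [concConst]
    ring
  have hzero : ∀ l ∉ insert i (Finset.univ.filter fun l => i ∈ G.parents l),
      resVec (sampleCov x) l (G.parents l) i *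
      resVec (sampleCov x) l (G.parents l) j / condVar (sampleCov x) l (G.parents l) -
      resVec S l (G.parents l) i * resVec S l (G.parents l) j / condVar S l (G.parents l) = 0 := by
    intro l hl
    simp only [Finset.mem_insert, Finset.mem_filter, Finset.mem_univ, true_and, not_or] at hl
    have h : ∀ T : Matrix V V ℝ, resVec T l (G.parents l) i = 0 := by
      intro T
      simp [resVec, extendZero, hl.2, Ne.symm hl.1]
    simp [h]
  rw [← Finset.sum_subset (Finset.subset_univ _) fun l _ hl => hzero l hl]
  refine (Finset.abs_sum_le_sum_abs _ _).trans ((Finset.sum_le_card_nsmul _ _ _ fun l _ =>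
    hterm l).trans ?_)
  rw [nsmul_eq_mul]
  have hcard := (Finset.card_insert_le i (Finset.univ.filter fun l => i ∈ G.parents l)).trans
    (Nat.succ_le_succ (G.card_children_le_maxAdj i))
  refine mul_le_mul_of_nonneg_right (by exact_mod_cast hcard) ?_
  unfold concConst
  positivity

end Deterministic

/-! ### Union bounds -/

section UnionBound

variable {V : Type*} [Fintype V] [DecidableEq V] {n : ℕ} {S : Matrix V V ℝ} {G : DAG V}

theorem measure_exists_le {Ω ι : Type*} [MeasurableSpace Ω] (μ : Measure Ω) (s : Finset ι)
    (A : ι → Set Ω) {B : ENNReal} (h : ∀ i ∈ s, μ (A i) ≤ B) :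
    μ {ω | ∃ i ∈ s, ω ∈ A i} ≤ s.card * B := by
  have : {ω | ∃ i ∈ s, ω ∈ A i} = ⋃ i ∈ s, A i := by ext; simp
  rw [this]
  refine (measure_biUnion_finset_le s A).trans ((Finset.sum_le_card_nsmul _ _ _ h).trans ?_)
  rw [nsmul_eq_mul]

/-- The number of sets of at most `q` elements. -/
theorem card_filter_card_le (q : ℕ) :
    (Finset.univ.filter fun K : Finset V => K.card ≤ q).card ≤ (Fintype.card V + 1) ^ q := by
  have h : (Finset.univ.filter fun K : Finset V => K.card ≤ q) =
      (Finset.range (q + 1)).biUnion fun m => Finset.powersetCard m Finset.univ := by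
    ext K
    simp
  rw [h, add_pow]
  refine Finset.card_biUnion_le.trans (Finset.sum_le_sum fun m hm => ?_)
  rw [Finset.card_powersetCard, Finset.card_univ, one_pow, mul_one]
  refine (Nat.choose_le_pow _ _).trans (Nat.le_mul_of_pos_right _ (Nat.choose_pos ?_))
  exact Nat.lt_succ_iff.1 (Finset.mem_range.1 hm)

variable {Ω : Type*} [MeasurableSpace Ω] {μ : Measure Ω} [IsProbabilityMeasure μ]
  {X : Fin n → Ω → EuclideanSpace ℝ V}

/-- The bound for the probability that a sample is bad for one conditional covariance given at most
`q` variables. -/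
noncomputable def badBound (n q : ℕ) (η : ℝ) : ℝ :=
  4 * Real.exp (-(n * η ^ 2 / 8)) + 6 * 2 ^ q * Real.exp (-(n * η / 4))

theorem IsGaussianSample.measure_not_condGood_le (h : IsGaussianSample X S μ) (hn : n ≠ 0) {q : ℕ}
    {i j : V} {K : Finset V} (hi : i ∉ K) (hj : j ∉ K) (hK : K.card ≤ q) {η : ℝ} (h0 : 0 ≤ η)
    (h1 : η ≤ 1) :
    μ {ω | ¬ CondGood S (fun r => X r ω) η i j K} ≤ ENNReal.ofReal (badBound n q η) := by
  refine (h.measure_not_condGood hn hi hj h0 h1).trans (ENNReal.ofReal_le_ofReal ?_)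
  have : (2 : ℝ) ^ K.card ≤ 2 ^ q := pow_le_pow_right₀ (by norm_num) hK
  have := mul_le_mul_of_nonneg_right this (Real.exp_pos (-(n * η / 4))).le
  rw [badBound]
  linarith

/-- The probability that the sample is bad for some conditional covariance given at most `q`
variables. -/
theorem IsGaussianSample.measure_exists_not_condGood (h : IsGaussianSample X S μ) (hn : n ≠ 0)
    (q : ℕ) {η : ℝ} (h0 : 0 ≤ η) (h1 : η ≤ 1) :
    μ {ω | ¬ ∀ (i j : V) (K : Finset V), i ∉ K → j ∉ K → K.card ≤ q →
      CondGood S (fun r => X r ω) η i j K} ≤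
      ENNReal.ofReal ((Fintype.card V + 1) ^ (q + 2) * badBound n q η) := by
  set s : Finset (V × V × Finset V) := Finset.univ ×ˢ Finset.univ ×ˢ
    (Finset.univ.filter fun K : Finset V => K.card ≤ q)
  set A : V × V × Finset V → Set Ω := fun a =>
    {ω | a.1 ∉ a.2.2 ∧ a.2.1 ∉ a.2.2 ∧ ¬ CondGood S (fun r => X r ω) η a.1 a.2.1 a.2.2}
  have hb : ∀ a ∈ s, μ (A a) ≤ ENNReal.ofReal (badBound n q η) := by
    rintro ⟨i, j, K⟩ ha
    have hK : K.card ≤ q := by simpa [s] using ha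
    by_cases hij : i ∉ K ∧ j ∉ K
    · exact (measure_mono fun ω hω => hω.2.2).trans
        (h.measure_not_condGood_le hn hij.1 hij.2 hK h0 h1)
    · have : A (i, j, K) = ∅ := by
        ext ω
        exact ⟨fun hω => hij ⟨hω.1, hω.2.1⟩, False.elim⟩
      rw [this, measure_empty]
      exact zero_le
  have hsub : {ω | ¬ ∀ (i j : V) (K : Finset V), i ∉ K → j ∉ K → K.card ≤ q →
      CondGood S (fun r => X r ω) η i j K} ⊆ {ω | ∃ a ∈ s, ω ∈ A a} := by
    intro ω hω
    have hω' : ¬ ∀ (i j : V) (K : Finset V), i ∉ K → j ∉ K → K.card ≤ q →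
      CondGood S (fun r => X r ω) η i j K := hω
    push Not at hω'
    obtain ⟨i, j, K, hi, hj, hK, hbad⟩ := hω'
    exact ⟨(i, j, K), by simpa [s] using hK, hi, hj, hbad⟩
  refine (measure_mono hsub).trans ((measure_exists_le μ s A hb).trans ?_)
  have hcard : s.card ≤ (Fintype.card V + 1) ^ (q + 2) := by
    simp only [s, Finset.card_product, Finset.card_univ]
    calc _ ≤ (Fintype.card V + 1) * ((Fintype.card V + 1) * (Fintype.card V + 1) ^ q) :=
        Nat.mul_le_mul (Nat.le_succ _) (Nat.mul_le_mul (Nat.le_succ _) (card_filter_card_le q))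
      _ = _ := by ring
  rw [ENNReal.ofReal_mul (by positivity)]
  gcongr
  calc (s.card : ENNReal) = ENNReal.ofReal (s.card : ℝ) := (ENNReal.ofReal_natCast _).symm
    _ ≤ _ := ENNReal.ofReal_le_ofReal (by exact_mod_cast hcard)

/-- The probability that the sample is bad for one of the conditional covariances on which the
concentration matrix of the DAG depends. -/
theorem IsGaussianSample.measure_exists_not_condGood_parents (h : IsGaussianSample X S μ)
    (hn : n ≠ 0) {η : ℝ} (h0 : 0 ≤ η) (h1 : η ≤ 1) :
    μ {ω | ¬ ((∀ l, CondGood S (fun r => X r ω) η l l (G.parents l)) ∧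
      (∀ l, ∀ i ∈ G.parents l, CondGood S (fun r => X r ω) η i l ((G.parents l).erase i)) ∧
      ∀ l, ∀ i ∈ G.parents l, CondGood S (fun r => X r ω) η i i ((G.parents l).erase i))} ≤
      ENNReal.ofReal (3 * (Fintype.card V + 1) ^ 2 * badBound n G.maxAdj η) := by
  have hpar := G.card_parents_le_maxAdj
  have hb0 : 0 ≤ badBound n G.maxAdj η := by unfold badBound; positivity
  have e1 := measure_exists_le μ Finset.univ
    (fun l => {ω | ¬ CondGood S (fun r => X r ω) η l l (G.parents l)})
    (B := ENNReal.ofReal (badBound n G.maxAdj η)) fun l _ =>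
    h.measure_not_condGood_le hn (G.self_notMem_parents l) (G.self_notMem_parents l) (hpar l) h0 h1
  have e2 : ∀ f : V × V → V, (∀ a, a.2 ∈ G.parents a.1 → f a ∉ (G.parents a.1).erase a.2) →
      μ {ω | ∃ a ∈ Finset.univ.filter fun a : V × V => a.2 ∈ G.parents a.1,
        ω ∈ {ω | ¬ CondGood S (fun r => X r ω) η a.2 (f a) ((G.parents a.1).erase a.2)}} ≤
      (Finset.univ.filter fun a : V × V => a.2 ∈ G.parents a.1).card *
        ENNReal.ofReal (badBound n G.maxAdj η) := by
    intro f hf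
    refine measure_exists_le μ _ _ fun a ha => ?_
    exact h.measure_not_condGood_le hn (Finset.notMem_erase _ _)
      (hf a (by simpa using ha)) ((Finset.card_erase_le).trans (hpar _)) h0 h1
  have e3 := e2 Prod.fst fun a _ h => G.self_notMem_parents a.1 (Finset.mem_of_mem_erase h)
  have e4 := e2 Prod.snd fun a _ => Finset.notMem_erase _ _
  have hc : (Finset.univ.filter fun a : V × V => a.2 ∈ G.parents a.1).card ≤
      (Fintype.card V + 1) ^ 2 := by
    refine (Finset.card_filter_le _ _).trans ?_
    rw [Finset.card_univ, Fintype.card_prod, sq]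
    exact Nat.mul_le_mul (Nat.le_succ _) (Nat.le_succ _)
  have hc' : (Finset.univ : Finset V).card ≤ (Fintype.card V + 1) ^ 2 := by
    rw [Finset.card_univ, sq]
    exact (Nat.le_succ _).trans (Nat.le_mul_of_pos_right _ (Nat.succ_pos _))
  have hconv : ∀ m : ℕ, m ≤ (Fintype.card V + 1) ^ 2 →
      (m : ENNReal) * ENNReal.ofReal (badBound n G.maxAdj η) ≤
      ENNReal.ofReal ((Fintype.card V + 1) ^ 2 * badBound n G.maxAdj η) := by
    intro m hm
    rw [← ENNReal.ofReal_natCast m, ← ENNReal.ofReal_mul (Nat.cast_nonneg m)]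
    exact ENNReal.ofReal_le_ofReal (mul_le_mul_of_nonneg_right (by exact_mod_cast hm) hb0)
  have hsub : {ω | ¬ ((∀ l, CondGood S (fun r => X r ω) η l l (G.parents l)) ∧
      (∀ l, ∀ i ∈ G.parents l, CondGood S (fun r => X r ω) η i l ((G.parents l).erase i)) ∧
      ∀ l, ∀ i ∈ G.parents l, CondGood S (fun r => X r ω) η i i ((G.parents l).erase i))} ⊆
      {ω | ∃ l ∈ Finset.univ, ω ∈ {ω | ¬ CondGood S (fun r => X r ω) η l l (G.parents l)}} ∪
      ({ω | ∃ a ∈ Finset.univ.filter fun a : V × V => a.2 ∈ G.parents a.1,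
        ω ∈ {ω | ¬ CondGood S (fun r => X r ω) η a.2 a.1 ((G.parents a.1).erase a.2)}} ∪
      {ω | ∃ a ∈ Finset.univ.filter fun a : V × V => a.2 ∈ G.parents a.1,
        ω ∈ {ω | ¬ CondGood S (fun r => X r ω) η a.2 a.2 ((G.parents a.1).erase a.2)}}) := by
    intro ω hω
    by_contra hcon
    rw [Set.mem_union, Set.mem_union, not_or, not_or] at hcon
    refine hω ⟨fun l => ?_, fun l i hi => ?_, fun l i hi => ?_⟩
    · by_contra hbad
      exact hcon.1 ⟨l, Finset.mem_univ l, hbad⟩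
    · by_contra hbad
      exact hcon.2.1 ⟨(l, i), by simpa using hi, hbad⟩
    · by_contra hbad
      exact hcon.2.2 ⟨(l, i), by simpa using hi, hbad⟩
  refine (measure_mono hsub).trans ((measure_union_le _ _).trans ((add_le_add
    (e1.trans (hconv _ hc')) ((measure_union_le _ _).trans (add_le_add (e3.trans (hconv _ hc))
      (e4.trans (hconv _ hc))))).trans (le_of_eq ?_)))
  rw [← ENNReal.ofReal_add (by positivity) (by positivity),
    ← ENNReal.ofReal_add (by positivity) (by positivity)]
  congr 1
  ring

end UnionBound

end PCDAG

namespace PCDAG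

/-! ### The probability of a large estimation error -/

theorem IsGaussianSample.measure_error_le {V : Type*} [Fintype V] [DecidableEq V] {n : ℕ}
    {S : Matrix V V ℝ} {G : DAG V} {Ω : Type*} [MeasurableSpace Ω] {μ : Measure Ω}
    [IsProbabilityMeasure μ] {X : Fin n → Ω → EuclideanSpace ℝ V} (h : IsGaussianSample X S μ)
    {σ2 r c M ε η₁ η₂ : ℝ} (hMG : IsMarkov (multivariateGaussian 0 S) G)
    (hFG : IsFaithful (multivariateGaussian 0 S) G) (hσ : ∀ i, S i i ≤ σ2) (hc : 0 < c)
    (hM : M < 1)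
    (hE : ∀ (i j : V) (K : Finset V), i ≠ j → i ∉ K → j ∉ K → |partialCorr S i j K| ≤ M)
    (hE' : ∀ (i j : V) (K : Finset V), i ≠ j → i ∉ K → j ∉ K →
      partialCorr S i j K ≠ 0 → c ≤ |partialCorr S i j K|)
    (hr : 0 < r) (hrj : ∀ i, ∀ j ∈ G.parents i, r ≤ condVar S j ((G.parents i).erase j))
    (hri : ∀ i, r ≤ condVar S i (G.parents i)) {D : Ω → DAG V}
    (hD : ∀ ω, IsPCDAG (fun k => X k ω) (2 * (1 - stdNormalCDF (√(n : ℝ) * c / 2))) (D ω))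
    (hn : 9 * (G.maxAdj + 3) < 5 * n) (hη₁ : 0 ≤ η₁) (hη₁c : 48 * η₁ ≤ min (min c 1) (1 - M))
    (hη₂ : 0 ≤ η₂) (hη₂' : 6 * η₂ ≤ 1) (hε : 0 ≤ ε)
    (herr : (G.maxAdj + 1) * (concConst σ2 r * η₂) ≤ ε) :
    μ {ω | ε < ⨆ ij : V × V,
        |dagConcentration (sampleCov fun k => X k ω) (D ω) ij.1 ij.2 - S⁻¹ ij.1 ij.2|} ≤
      ENNReal.ofReal ((Fintype.card V + 1) ^ (G.maxAdj + 2) * badBound n G.maxAdj η₁) +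
      ENNReal.ofReal (3 * (Fintype.card V + 1) ^ 2 * badBound n G.maxAdj η₂) := by
  have hn0 : n ≠ 0 := by omega
  have hη₁1 : 48 * η₁ ≤ 1 := hη₁c.trans ((min_le_left _ _).trans (min_le_right _ _))
  refine le_trans (measure_mono fun ω hω => ?_) ((measure_union_le _ _).trans (add_le_add
    (h.measure_exists_not_condGood hn0 G.maxAdj hη₁ (by linarith))
    (h.measure_exists_not_condGood_parents (G := G) hn0 hη₂ (by linarith))))
  by_contra hcon
  rw [Set.mem_union, not_or] at hcon
  have hg₁ := not_not.1 hcon.1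
  obtain ⟨h1, h2, h3⟩ := not_not.1 hcon.2
  obtain ⟨heq, hpd⟩ := (hD ω).dagConcentration_eq h.posDef hFG hc hM hE hE' hn hη₁c hg₁
  refine absurd (Real.iSup_le (fun ij => ?_) hε) (not_le.2 hω)
  rw [heq, ← dagConcentration_eq_inv h.posDef hMG]
  exact (abs_dagConcentration_sub_le h.posDef hn0 hσ hr hrj hri hη₂' hpd h1 h2 h3 ij.1 ij.2).trans
    herr

/-! ### Asymptotics of the bounds -/

section Asymp

theorem tendsto_exp_sub_atTop {A B : ℕ → ℝ} (h : A =o[atTop] B) (hB : Tendsto B atTop atTop)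
    {δ : ℝ} (hδ : 0 < δ) : Tendsto (fun n => Real.exp (A n - δ * B n)) atTop (𝓝 0) := by
  refine Real.tendsto_exp_atBot.comp ?_
  have hlim : Tendsto (fun n => -(δ / 2 * B n)) atTop atBot :=
    tendsto_neg_atTop_atBot.comp (hB.const_mul_atTop (half_pos hδ))
  refine tendsto_atBot_mono' _ ?_ hlim
  filter_upwards [h.bound (half_pos hδ), hB.eventually_ge_atTop 0] with n h1 h2
  rw [Real.norm_eq_abs, Real.norm_eq_abs, abs_of_nonneg h2] at h1
  linarith [le_abs_self (A n)]

theorem tendsto_natCast_rpow {s : ℝ} (hs : 0 < s) :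
    Tendsto (fun n : ℕ => (n : ℝ) ^ s) atTop atTop :=
  (tendsto_rpow_atTop hs).comp tendsto_natCast_atTop_atTop

theorem isLittleO_natCast_rpow {s t : ℝ} (h : s < t) :
    (fun n : ℕ => (n : ℝ) ^ s) =o[atTop] fun n : ℕ => (n : ℝ) ^ t := by
  have h1 : (fun _ : ℕ => (1 : ℝ)) =o[atTop] fun n : ℕ => (n : ℝ) ^ (t - s) :=
    isLittleO_const_left.2 (Or.inr
      (tendsto_norm_atTop_atTop.comp (tendsto_natCast_rpow (sub_pos.2 h))))
  refine ((isBigO_refl (fun n : ℕ => (n : ℝ) ^ s) atTop).mul_isLittleO h1).congr' ?_ ?_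
  · exact Eventually.of_forall fun n => mul_one _
  · filter_upwards [eventually_gt_atTop 0] with n hn
    rw [← Real.rpow_add (by exact_mod_cast hn), add_sub_cancel]

theorem one_isBigO_natCast_rpow {s : ℝ} (hs : 0 ≤ s) :
    (fun _ : ℕ => (1 : ℝ)) =O[atTop] fun n : ℕ => (n : ℝ) ^ s := by
  refine IsBigO.of_bound 1 ?_
  filter_upwards [eventually_ge_atTop 1] with n hn
  have : (1 : ℝ) ≤ (n : ℝ) ^ s := Real.one_le_rpow (by exact_mod_cast hn) hs
  rw [norm_one, one_mul, Real.norm_eq_abs]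
  exact this.trans (le_abs_self _)

variable {p : ℕ → ℕ} {a s : ℝ}

/-- The logarithm of a polynomially growing dimension grows slower than every power. -/
theorem isLittleO_log_dim (ha : 0 ≤ a)
    (hp : (fun n => (p n : ℝ)) =O[atTop] fun n : ℕ => (n : ℝ) ^ a) (hs : 0 < s) :
    (fun n => Real.log (2 * (p n + 1))) =o[atTop] fun n : ℕ => (n : ℝ) ^ s := by
  have h1 : (fun n => 2 * ((p n : ℝ) + 1)) =O[atTop] fun n : ℕ => (n : ℝ) ^ a :=
    (hp.add (one_isBigO_natCast_rpow ha)).const_mul_left 2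
  obtain ⟨C, hC, hb⟩ := h1.exists_pos
  have h2 : (fun n => Real.log (2 * (p n + 1))) =O[atTop]
      fun n : ℕ => |Real.log C| + a * Real.log n := by
    refine IsBigO.of_bound 1 ?_
    filter_upwards [hb.bound, eventually_ge_atTop 1] with n hn h1
    have hn0 : (0 : ℝ) < n := by exact_mod_cast h1
    have hp0 : (0 : ℝ) ≤ p n := Nat.cast_nonneg _
    have hna : (0 : ℝ) < (n : ℝ) ^ a := Real.rpow_pos_of_pos hn0 a
    rw [Real.norm_eq_abs, Real.norm_eq_abs, abs_of_pos (by linarith), abs_of_pos hna] at hn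
    have hlog := Real.log_le_log (by linarith) hn
    rw [Real.log_mul hC.ne' hna.ne', Real.log_rpow hn0] at hlog
    rw [Real.norm_eq_abs, Real.norm_eq_abs, abs_of_nonneg (Real.log_nonneg (by linarith)), one_mul]
    exact (hlog.trans (by linarith [le_abs_self (Real.log C)])).trans (le_abs_self _)
  refine h2.trans_isLittleO (IsLittleO.add ?_ ?_)
  · refine isLittleO_const_left.2 (Or.inr ?_)
    exact tendsto_norm_atTop_atTop.comp (tendsto_natCast_rpow hs)
  · exact ((isLittleO_log_rpow_atTop hs).comp_tendsto tendsto_natCast_atTop_atTop).const_mul_left a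

variable {q : ℕ → ℕ} {t : ℝ}

theorem isBigO_add_two (ht : 0 ≤ t)
    (hq : (fun n => (q n : ℝ)) =O[atTop] fun n : ℕ => (n : ℝ) ^ t) :
    (fun n => (q n : ℝ) + 2) =O[atTop] fun n : ℕ => (n : ℝ) ^ t := by
  have := hq.add ((one_isBigO_natCast_rpow ht).const_mul_left 2)
  simpa using this

theorem isLittleO_mul_log_dim (ha : 0 ≤ a)
    (hp : (fun n => (p n : ℝ)) =O[atTop] fun n : ℕ => (n : ℝ) ^ a) (ht : 0 ≤ t)
    (hq : (fun n => (q n : ℝ)) =O[atTop] fun n : ℕ => (n : ℝ) ^ t) (hts : t < s) :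
    (fun n => ((q n : ℝ) + 2) * Real.log (2 * (p n + 1))) =o[atTop]
      fun n : ℕ => (n : ℝ) ^ s := by
  have h := (isBigO_add_two ht hq).mul_isLittleO (isLittleO_log_dim ha hp (sub_pos.2 hts))
  refine h.congr' EventuallyEq.rfl ?_
  filter_upwards [eventually_gt_atTop 0] with n hn
  rw [← Real.rpow_add (by exact_mod_cast hn), add_sub_cancel]

theorem pow_le_exp_mul_log (p m : ℕ) :
    ((p : ℝ) + 1) ^ m ≤ Real.exp (m * Real.log (2 * (p + 1))) := by
  have hp0 : (0 : ℝ) ≤ p := Nat.cast_nonneg _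
  rw [← Real.log_pow, Real.exp_log (by positivity)]
  exact pow_le_pow_left₀ (by positivity) (by linarith) m

theorem pow_mul_two_pow_le_exp_mul_log (p m k : ℕ) (hk : k ≤ m) :
    ((p : ℝ) + 1) ^ m * 2 ^ k ≤ Real.exp (m * Real.log (2 * (p + 1))) := by
  have hp0 : (0 : ℝ) ≤ p := Nat.cast_nonneg _
  rw [← Real.log_pow, Real.exp_log (by positivity), mul_pow, mul_comm]
  exact mul_le_mul_of_nonneg_right (pow_le_pow_right₀ (by norm_num) hk) (by positivity)

theorem mul_badBound_le (n p q m : ℕ) (η : ℝ) (hm : m ≤ q + 2) :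
    ((p : ℝ) + 1) ^ m * badBound n q η ≤
      4 * Real.exp (m * Real.log (2 * (p + 1)) - n * η ^ 2 / 8) +
        6 * Real.exp ((q + 2) * Real.log (2 * (p + 1)) - n * η / 4) := by
  have hp0 : (0 : ℝ) ≤ p := Nat.cast_nonneg _
  have h1 := mul_le_mul_of_nonneg_right (pow_le_exp_mul_log p m)
    (Real.exp_pos (-(n * η ^ 2 / 8))).le
  have h2 : ((p : ℝ) + 1) ^ m * 2 ^ q ≤ Real.exp ((q + 2) * Real.log (2 * (p + 1))) := by
    have h := pow_mul_two_pow_le_exp_mul_log p (q + 2) q (by omega)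
    push_cast at h
    refine (mul_le_mul_of_nonneg_right ?_ (by positivity)).trans h
    exact pow_le_pow_right₀ (by linarith) hm
  have h3 := mul_le_mul_of_nonneg_right h2 (Real.exp_pos (-(n * η / 4))).le
  rw [sub_eq_add_neg, sub_eq_add_neg, Real.exp_add, Real.exp_add, badBound]
  calc _ = 4 * (((p : ℝ) + 1) ^ m * Real.exp (-(n * η ^ 2 / 8))) +
        6 * (((p : ℝ) + 1) ^ m * 2 ^ q * Real.exp (-(n * η / 4))) := by ring
    _ ≤ _ := by linarith

/-- The union bound over the conditional covariances of all orders up to `q n` vanishes if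
`n η²` grows faster than `q n log n`. -/
theorem tendsto_pow_mul_badBound (ha : 0 ≤ a)
    (hp : (fun n => (p n : ℝ)) =O[atTop] fun n : ℕ => (n : ℝ) ^ a) (ht : 0 ≤ t)
    (hq : (fun n => (q n : ℝ)) =O[atTop] fun n : ℕ => (n : ℝ) ^ t) {m : ℕ → ℕ} {η : ℕ → ℝ}
    {s s' δ : ℝ} (hδ : 0 < δ) (hs : 0 < s)
    (hm : ∀ n, m n ≤ q n + 2)
    (hml : (fun n => (m n : ℝ) * Real.log (2 * (p n + 1))) =o[atTop] fun n : ℕ => (n : ℝ) ^ s)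
    (hη : ∀ᶠ n : ℕ in atTop, δ * (n : ℝ) ^ s ≤ n * η n ^ 2)
    (hs' : t < s') (hη' : ∀ᶠ n : ℕ in atTop, δ * (n : ℝ) ^ s' ≤ n * η n) :
    Tendsto (fun n => ((p n : ℝ) + 1) ^ m n * badBound n (q n) (η n)) atTop (𝓝 0) := by
  have h1 := (tendsto_exp_sub_atTop hml (tendsto_natCast_rpow hs)
    (show 0 < δ / 8 by positivity)).const_mul 4
  have h2 := (tendsto_exp_sub_atTop (isLittleO_mul_log_dim ha hp ht hq hs')
    (tendsto_natCast_rpow (ht.trans_lt hs')) (show 0 < δ / 4 by positivity)).const_mul 6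
  have h12 := h1.add h2
  rw [mul_zero, mul_zero, add_zero] at h12
  refine squeeze_zero' (Eventually.of_forall fun n => ?_) ?_ h12
  · unfold badBound
    positivity
  · filter_upwards [hη, hη'] with n hn hn'
    refine (mul_badBound_le n (p n) (q n) (m n) (η n) (hm n)).trans (add_le_add
      (mul_le_mul_of_nonneg_left (Real.exp_le_exp.2 ?_) (by norm_num))
      (mul_le_mul_of_nonneg_left (Real.exp_le_exp.2 ?_) (by norm_num)))
    · linarith
    · linarith

end Asymp

end PCDAG
/-! ### Consistency of the estimator -/

namespace PCDAG

/-- The accuracy `η = min(c, 1, 1 - M) / 48` that the tests require is at least of the order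
`n^{-d}`, so that `n η²` is at least of the order `n^{1 - 2 d}`. -/
theorem eventually_rpow_le_mul_sq_min {c : ℕ → ℝ} {M d : ℝ} (hM : M < 1) (hc : ∀ n, 0 < c n)
    (hd : 0 < d) (hcd : (fun n => (c n)⁻¹) =O[atTop] fun n : ℕ => (n : ℝ) ^ d) :
    ∃ δ > 0, ∀ᶠ n : ℕ in atTop,
      δ * (n : ℝ) ^ (1 - 2 * d) ≤ n * (min (min (c n) 1) (1 - M) / 48) ^ 2 := by
  obtain ⟨C, hC, hb⟩ := hcd.exists_pos
  set δ₀ := min (min C⁻¹ 1) (1 - M) with hδ₀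
  have hδ₀' : 0 < δ₀ := lt_min (lt_min (inv_pos.2 hC) one_pos) (sub_pos.2 hM)
  refine ⟨(δ₀ / 48) ^ 2, by positivity, ?_⟩
  filter_upwards [hb.bound, eventually_ge_atTop 1] with n hn h1
  have hn1 : (1 : ℝ) ≤ n := by exact_mod_cast h1
  have hn0 : (0 : ℝ) < n := one_pos.trans_le hn1
  have hnd : (0 : ℝ) < (n : ℝ) ^ d := Real.rpow_pos_of_pos hn0 d
  have hnd1 : (1 : ℝ) ≤ (n : ℝ) ^ d := Real.one_le_rpow hn1 hd.le
  rw [Real.norm_eq_abs, Real.norm_eq_abs, abs_of_pos (inv_pos.2 (hc n)), abs_of_pos hnd] at hn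
  have hc' : C⁻¹ * ((n : ℝ) ^ d)⁻¹ ≤ c n := by
    rw [← mul_inv]
    exact inv_le_of_inv_le₀ (hc n) hn
  have hi1 : ((n : ℝ) ^ d)⁻¹ ≤ 1 := inv_le_one_of_one_le₀ hnd1
  have hi0 : 0 < ((n : ℝ) ^ d)⁻¹ := inv_pos.2 hnd
  have hle : ∀ b : ℝ, δ₀ ≤ b → δ₀ * ((n : ℝ) ^ d)⁻¹ ≤ b := fun b hb =>
    (mul_le_of_le_one_right hδ₀'.le hi1).trans hb
  have hmin : δ₀ * ((n : ℝ) ^ d)⁻¹ ≤ min (min (c n) 1) (1 - M) :=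
    le_min (le_min ((mul_le_mul_of_nonneg_right ((min_le_left _ _).trans (min_le_left _ _))
      hi0.le).trans hc') (hle _ ((min_le_left _ _).trans (min_le_right _ _))))
      (hle _ (min_le_right _ _))
  have hpow : (n : ℝ) ^ (1 - 2 * d) = n * (((n : ℝ) ^ d)⁻¹) ^ 2 := by
    rw [Real.rpow_sub hn0, Real.rpow_one, mul_comm 2 d, Real.rpow_mul hn0.le, inv_pow,
      div_eq_mul_inv]
    norm_num
  rw [hpow]
  calc _ = n * (δ₀ * ((n : ℝ) ^ d)⁻¹ / 48) ^ 2 := by ring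
    _ ≤ _ := by gcongr

end PCDAG

theorem mainTheorem1
    -- dimensions, covariance matrices, DAGs
    (p : ℕ → ℕ) (S : ∀ n, Matrix (Fin (p n)) (Fin (p n)) ℝ) (G : ∀ n, PCDAG.DAG (Fin (p n)))
    (c : ℕ → ℝ) (σ2 a b d M r : ℝ)
    -- (A): i.i.d. Gaussian data, Markov and faithful
    (hS : ∀ n, (S n).PosDef)
    {Ω : ℕ → Type*} [∀ n, MeasurableSpace (Ω n)] (μ : ∀ n, Measure (Ω n))
    [∀ n, IsProbabilityMeasure (μ n)]
    (X : ∀ n, Fin n → Ω n → EuclideanSpace ℝ (Fin (p n)))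
    (hXm : ∀ n k, Measurable (X n k))
    (hXi : ∀ n, iIndepFun (X n) (μ n))
    (hXl : ∀ n k, (μ n).map (X n k) = multivariateGaussian 0 (S n))
    (hMarkov : ∀ n, PCDAG.IsMarkov (multivariateGaussian 0 (S n)) (G n))
    (hFaithful : ∀ n, PCDAG.IsFaithful (multivariateGaussian 0 (S n)) (G n))
    -- (B): bounded variances
    (hB : ∀ n i, S n i i ≤ σ2)
    -- (C): polynomial dimension
    (ha : 0 ≤ a) (hC : (fun n => (p n : ℝ)) =O[atTop] fun n : ℕ => (n : ℝ) ^ a)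
    -- (D): sparseness
    (hb : 0 < b) (hb' : b ≤ 1 / 2)
    (hD : (fun n => ((G n).maxAdj : ℝ)) =O[atTop] fun n : ℕ => (n : ℝ) ^ (1 / 2 - b))
    -- (E): bounds on partial correlations
    (hM : M < 1)
    (hE : ∀ n (i j : Fin (p n)) (K : Finset (Fin (p n))), i ≠ j → i ∉ K → j ∉ K →
      |PCDAG.partialCorr (S n) i j K| ≤ M)
    (hc : ∀ n, 0 < c n)
    (hE' : ∀ n (i j : Fin (p n)) (K : Finset (Fin (p n))), i ≠ j → i ∉ K → j ∉ K →
      PCDAG.partialCorr (S n) i j K ≠ 0 → c n ≤ |PCDAG.partialCorr (S n) i j K|)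
    (hd : 0 < d) (hd' : d < 1 / 4 + b / 2)
    (hcd : (fun n => (c n)⁻¹) =O[atTop] fun n : ℕ => (n : ℝ) ^ d)
    -- (F): conditional variances bounded below, for every DAG in the equivalence class
    (hr : 0 < r)
    (hF : ∀ n (D : PCDAG.DAG (Fin (p n))), D.Equivalent (G n) →
      (∀ i, ∀ j ∈ D.parents i, r ≤ PCDAG.condVar (S n) j ((D.parents i).erase j)) ∧
      ∀ i, r ≤ PCDAG.condVar (S n) i (D.parents i))
    -- any DAG in the estimated CPDAG, for the tuning parameter `α_n = 2 (1 - Φ(√n c_n / 2))`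
    (Ghat : ∀ n, Ω n → PCDAG.DAG (Fin (p n)))
    (hGhat : ∀ n ω, PCDAG.IsPCDAG (fun k => X n k ω)
      (2 * (1 - PCDAG.stdNormalCDF (√(n : ℝ) * c n / 2))) (Ghat n ω)) :
    ∀ ε > 0, Tendsto
      (fun n => μ n {ω | ε < ⨆ ij : Fin (p n) × Fin (p n),
        |PCDAG.dagConcentration (PCDAG.sampleCov fun k => X n k ω) (Ghat n ω) ij.1 ij.2
          - (S n)⁻¹ ij.1 ij.2|})
      atTop (𝓝 0) := by
  intro ε hε
  have ht : 0 ≤ 1 / 2 - b := sub_nonneg.2 hb'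
  set η₁ : ℕ → ℝ := fun n => min (min (c n) 1) (1 - M) / 48 with hη₁
  -- With this rate both `n η₂² = n ^ b` and `(q_n η₂)⁻¹` tend to infinity.
  set η₂ : ℕ → ℝ := fun n => (n : ℝ) ^ (b / 2 - 1 / 2) with hη₂
  have hη₁0 : ∀ n, 0 ≤ η₁ n := fun n =>
    div_nonneg (le_min (le_min (hc n).le zero_le_one) (sub_nonneg.2 hM.le)) (by norm_num)
  have hη₁1 : ∀ n, η₁ n ≤ 1 := fun n => by
    have : min (min (c n) 1) (1 - M) ≤ 1 := (min_le_left _ _).trans (min_le_right _ _)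
    simp only [hη₁]
    linarith
  have hη₂0 : ∀ n, 0 ≤ η₂ n := fun n => Real.rpow_nonneg (Nat.cast_nonneg n) _
  have hη₂lim : Tendsto η₂ atTop (𝓝 0) := by
    have h := (tendsto_rpow_neg_atTop (show 0 < 1 / 2 - b / 2 by linarith)).comp
      tendsto_natCast_atTop_atTop
    refine h.congr fun n => ?_
    simp [hη₂]
  have hlim₁ : Tendsto (fun n => ENNReal.ofReal (((p n : ℝ) + 1) ^ ((G n).maxAdj + 2) *
      PCDAG.badBound n (G n).maxAdj (η₁ n))) atTop (𝓝 0) := by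
    obtain ⟨δ, hδ, hev⟩ := PCDAG.eventually_rpow_le_mul_sq_min hM hc hd hcd
    have hts : 1 / 2 - b < 1 - 2 * d := by linarith
    rw [← ENNReal.ofReal_zero]
    refine ENNReal.tendsto_ofReal (PCDAG.tendsto_pow_mul_badBound ha hC ht hD hδ
      (ht.trans_lt hts) (fun n => le_rfl) ?_ hev hts ?_)
    · have h := PCDAG.isLittleO_mul_log_dim ha hC ht hD hts
      simpa using h
    · filter_upwards [hev] with n hn
      refine hn.trans (mul_le_mul_of_nonneg_left ?_ (Nat.cast_nonneg n))
      exact pow_le_of_le_one (hη₁0 n) (hη₁1 n) two_ne_zero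
  have hlim₂ : Tendsto (fun n => ENNReal.ofReal (3 * ((p n : ℝ) + 1) ^ 2 *
      PCDAG.badBound n (G n).maxAdj (η₂ n))) atTop (𝓝 0) := by
    have h := (PCDAG.tendsto_pow_mul_badBound ha hC ht hD (m := fun _ => 2) (η := η₂)
      (s := b) (s' := 1 / 2 + b / 2) one_pos hb (fun n => Nat.le_add_left 2 _)
      (by simpa using (PCDAG.isLittleO_log_dim ha hC hb).const_mul_left 2) ?_ (by linarith)
      ?_).const_mul 3
    · rw [← ENNReal.ofReal_zero]
      refine ENNReal.tendsto_ofReal ?_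
      rw [mul_zero] at h
      exact h.congr fun n => by ring
    · filter_upwards [eventually_gt_atTop 0] with n hn
      have hn0 : (0 : ℝ) < n := by exact_mod_cast hn
      rw [one_mul, hη₂, ← Real.rpow_natCast, ← Real.rpow_mul hn0.le, ← Real.rpow_one_add' hn0.le
        (by push_cast; linarith)]
      refine le_of_eq (congrArg _ ?_)
      push_cast
      ring
    · filter_upwards [eventually_gt_atTop 0] with n hn
      have hn0 : (0 : ℝ) < n := by exact_mod_cast hn
      rw [one_mul, hη₂, ← Real.rpow_one_add' hn0.le (by linarith)]
      refine le_of_eq (congrArg _ ?_)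
      ring
  have hq : ∀ᶠ n in atTop, 9 * ((G n).maxAdj + 3) < 5 * n := by
    have h1 := ((PCDAG.isBigO_add_two ht hD).trans_isLittleO
      (PCDAG.isLittleO_natCast_rpow (show 1 / 2 - b < 1 by linarith))).bound
      (show (0 : ℝ) < 1 / 9 by norm_num)
    filter_upwards [h1, eventually_ge_atTop 3] with n hn h3
    rw [Real.rpow_one, Real.norm_eq_abs, Real.norm_eq_abs, abs_of_nonneg (by positivity),
      abs_of_nonneg (by positivity)] at hn
    have h3' : (3 : ℝ) ≤ n := by exact_mod_cast h3
    have : (9 : ℝ) * ((G n).maxAdj + 3) < 5 * n := by linarith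
    exact_mod_cast this
  have herr : ∀ᶠ n in atTop,
      (((G n).maxAdj : ℝ) + 1) * (PCDAG.concConst σ2 r * η₂ n) ≤ ε := by
    have h1 : (fun n => (((G n).maxAdj : ℝ) + 1) * (PCDAG.concConst σ2 r * η₂ n)) =O[atTop]
        fun n : ℕ => (n : ℝ) ^ (1 / 2 - b) * (n : ℝ) ^ (b / 2 - 1 / 2) :=
      (hD.add (PCDAG.one_isBigO_natCast_rpow ht)).mul ((isBigO_refl _ _).const_mul_left _)
    have h2 : Tendsto (fun n : ℕ => (n : ℝ) ^ (1 / 2 - b) * (n : ℝ) ^ (b / 2 - 1 / 2)) atTop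
        (𝓝 0) := by
      have h := (tendsto_rpow_neg_atTop (half_pos hb)).comp tendsto_natCast_atTop_atTop
      refine h.congr' ?_
      filter_upwards [eventually_gt_atTop 0] with n hn
      rw [← Real.rpow_add (by exact_mod_cast hn), Function.comp_apply]
      congr 1
      ring
    exact (h1.trans_tendsto h2).eventually_le_const hε
  refine tendsto_of_tendsto_of_tendsto_of_le_of_le' tendsto_const_nhds
    (by simpa using hlim₁.add hlim₂) (Eventually.of_forall fun n => zero_le) ?_
  filter_upwards [hq, herr, hη₂lim.eventually_le_const (show (0 : ℝ) < 1 / 6 by norm_num)]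
    with n hqn hen h6
  have hX : PCDAG.IsGaussianSample (X n) (S n) (μ n) := ⟨hS n, hXm n, hXi n, hXl n⟩
  obtain ⟨hrj, hri⟩ := hF n (G n) ⟨rfl, fun _ _ _ => Iff.rfl⟩
  have h := hX.measure_error_le (hMarkov n) (hFaithful n) (hB n) (hc n) hM (hE n) (hE' n) hr hrj
    hri (hGhat n) hqn (hη₁0 n) (le_of_eq (by simp only [hη₁]; ring)) (hη₂0 n) (by linarith) hε.le
    hen
  simpa using h
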